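/- Let $D\in\mathfrak{gl}(3,\mathbb{R})$ and let $\mathbb{R}\ltimes_D\mathbb{R}^3$ be the simply connected Lie group $\mathbb{R}^3\times\mathbb{R}$ with product $(x,s)(y,r)=(x+e^{sD}y,\,s+r)$. For a Riemannian metric $g$ on a four-manifold let $\rho$, $\tau$ and $R$ be its Ricci tensor, scalar curvature and curvature tensor, and $R[\rho]_{ij}=R_{ikj\ell}\rho^{k\ell}$ (with $\rho_{ij}=g^{k\ell}R_{ikj\ell}$). For $t\in\mathbb{R}$, $g$ is called $\mathcal{F}_t$-critical if it satisfies the Euler–Lagrange equation (for variations of constant volume) of $\mathcal{F}_t(g)=\int\{\|\rho\|^2+t\tau^2\}\,d\mathrm{vol}_g$, that is $$-\Delta\rho+(2t+1)\nabla^2\tau-\tfrac{t}{2}(\Delta\tau)g+\tfrac12(\|\rho\|^2+t\tau^2)g-2R[\rho]-2t\tau\rho=0 .$$ For a homogeneous metric the constant $E_t=\|\rho\|^2+t\tau^2$ is called the energy. Two metrics $g,g'$ are homothetic if $\varphi^*g'=c\,g$ for some diffeomorphism $\varphi$ and some constant $c>0$ (no compatibility with group structures is required). A metric is non-symmetric if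 $\nabla R\neq0$. A left-invariant metric on a Lie group with Lie algebra $\mathfrak g$ is an algebraic Ricci soliton if its Ricci operator satisfies $\mathrm{Ric}=\lambda\,\mathrm{Id}+\mathfrak{D}$ on $\mathfrak{g}$ for some $\lambda\in\mathbb{R}$ and some derivation $\mathfrak{D}$ of $\mathfrak{g}$. Below, brackets $[e_i,e_4]$ ($i=1,2,3$) determine the left-invariant metric on the corresponding group $\mathbb{R}\ltimes\mathbb{R}^3$ for which $\{e_1,\dots,e_4\}$ is an orthonormal basis of the Lie algebra; brackets that are not listed vanish. **Theorem.** A non-symmetric left-invariant metric on a group $\mathbb{R}\ltimes_D\mathbb{R}^3$ is $\mathcal{F}_t$-critical, for a given $t\in\mathbb{R}$, if and only if one of the following holds: (a) The energy $E_t$ is zero and the metric is homothetic to a metric of one of the following families, with $t$ as indicated: 1. $[e_1,e_4]=e_1+e_3$, $[e_3,e_4]=-(e_1+e_3)$; $t=-3$. 2. $[e_1,e_4]=e_1+\frac{1}{\sqrt2}e_3$, $[e_2,e_4]=-e_2+\frac1{\sqrt2}e_3$, $[e_3,e_4]=-\frac1{\sqrt2}(e_1+e_2)$; $t=-\frac32$.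 3. $[e_1,e_4]=e_1$, $[e_2,e_4]=fe_2$, $[e_3,e_4]=pe_3$, where $-1\le f\le p\le1$, excluding the pairs $(f,p)=(-1,p)$ with $-1\le p<0$ and $(f,p)\in\{(0,0),(0,1),(1,1)\}$; $t=-\frac{f^2+p^2+1}{2(f^2+p^2+fp+f+p+1)}$. 4. $[e_1,e_4]=e_1$, $[e_2,e_4]=-(\kappa+\frac12)e_2+he_3$, $[e_3,e_4]=-he_2+(\kappa-\frac12)e_3$, where $\kappa>\frac{\sqrt3}{2}$ and $h$ is the only positive solution of $h^2(4\kappa^2-3)-\kappa^2(4\kappa^2+3)=0$; $t=-\frac{48\kappa^4-9}{16\kappa^4-9}$. 5. $[e_1,e_4]=e_1+ce_3$, $[e_2,e_4]=-(p+1)e_2+he_3$, $[e_3,e_4]=-ce_1-he_2+pe_3$, where $p\in(\zeta,-1)\cup(\frac{1-\sqrt{21}}{10},0)$, $\zeta=-1.697464\dots$ is the only real solution of $8p^3+15p^2+3p+1=0$, and $c,h$ are the only positive solutions of $$c^2(p+2)(5p^2-p-1)+(2p+1)(8p^3+15p^2+3p+1)=0,$$ $$h^2(p+2)(5p^2-p-1)-(p+1)(p-1)(5p^3+12p^2+1)=0;$$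 $t=-\frac{30p^4-3p^2-6p-3}{2(p^2+p+1)(5p^2-p-1)}$. (b) The energy $E_t$ is non-zero and the metric is homothetic to a metric of one of the following families, with $t$ as indicated: 6. $[e_1,e_4]=\frac13e_1$, $[e_2,e_4]=fe_2+he_3$, $[e_3,e_4]=-he_2-(f-\frac23)e_3$, where $h>0$ and $f$ is the only positive solution of $36(f^2-h^2)-24f-5=0$; $t=-\frac{36h^2+5}{12h^2+11}$. 7. $[e_1,e_4]=ae_1+be_2$, $[e_2,e_4]=-be_1+\frac13e_2+be_3$, $[e_3,e_4]=-be_2-(a-\frac23)e_3$, where $b>0$ and $a$ is the only positive solution of $9a^2-18b^2-6a-8=0$; $t=-\frac{18b^2+7}{12b^2+10}$. All the metrics listed in (1)–(7) are themselves non-symmetric and $\mathcal{F}_t$-critical for the indicated $t$. For this $t$, a non-symmetric left-invariant metric on a group $\mathbb{R}\ltimes_D\mathbb{R}^3$ that is homothetic to a metric of the families (1)–(5) has zero energy, and one that is homothetic to a metric of the families (6)–(7) has negative energy; the energy of the listed metrics themselves is $E_t=-\frac{16}{3}h^2$ in (6) and $E_t=-\frac83b^2$ in (7). Moreover, the metrics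 in families (1)–(3) are algebraic Ricci solitons, while those in families (4)–(7) are not. -/

import Mathlib

open scoped ContDiff Manifold Matrix

noncomputable section

namespace QuadraticCurvature

/-! ### Riemannian geometry in a global chart of a four-manifold diffeomorphic to `ℝ⁴` -/

/-- The underlying manifold `ℝ⁴` (with its usual smooth structure). -/
abbrev R4 : Type := Fin 4 → ℝ

/-- The components `g_{ij}` of a metric in the standard coordinates of `ℝ⁴`. -/
abbrev MetricField : Type := R4 → Matrix (Fin 4) (Fin 4) ℝ

/-- The components `T_{i₁ … iₖ}` of a covariant tensor field of rank `k` on `ℝ⁴`. -/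
abbrev TensorField (k : ℕ) : Type := R4 → (Fin k → Fin 4) → ℝ

/-- The partial derivative `∂ᵢ f`. -/
def partialDeriv (i : Fin 4) (f : R4 → ℝ) : R4 → ℝ :=
  fun x => fderiv ℝ f x (Pi.single i 1)

/-- Christoffel symbols `Γᵏ_{ij}` of the Levi-Civita connection of `g`. -/
def christoffel (g : MetricField) (k i j : Fin 4) : R4 → ℝ := fun x =>
  (1 / 2) * ∑ l, (g x)⁻¹ k l *
    (partialDeriv i (fun y => g y j l) x + partialDeriv j (fun y => g y i l) x
      - partialDeriv l (fun y => g y i j) x)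

/-- Components of the curvature operator,
`R(∂ᵢ, ∂ⱼ) ∂ₖ = ∑ₗ (curvatureOp g l i j k) ∂ₗ`, where `R(X, Y) = [∇_X, ∇_Y] - ∇_{[X, Y]}`. -/
def curvatureOp (g : MetricField) (l i j k : Fin 4) : R4 → ℝ := fun x =>
  partialDeriv i (christoffel g l j k) x - partialDeriv j (christoffel g l i k) x
    + ∑ m, (christoffel g l i m x * christoffel g m j k x
        - christoffel g l j m x * christoffel g m i k x)

/-- The curvature tensor `R_{ijkl} = g(R(∂ᵢ, ∂ⱼ) ∂ₗ, ∂ₖ)`; the sectional curvature of the plane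
spanned by orthonormal vectors `u, v` is `R(u, v, u, v)`. -/
def riemann (g : MetricField) : TensorField 4 := fun x I =>
  ∑ m, g x (I 2) m * curvatureOp g m (I 0) (I 1) (I 3) x

/-- The Ricci tensor `ρ_{ij} = g^{kl} R_{ikjl}`. -/
def ricci (g : MetricField) : TensorField 2 := fun x I =>
  ∑ k, ∑ l, (g x)⁻¹ k l * riemann g x ![I 0, k, I 1, l]

/-- The scalar curvature `τ = g^{ij} ρ_{ij}`. -/
def scalarCurvature (g : MetricField) : R4 → ℝ := fun x =>
  ∑ i, ∑ j, (g x)⁻¹ i j * ricci g x ![i, j]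

/-- The covariant derivative of a covariant tensor field:
`(∇T)_{i₀ i₁ … iₖ} = (∇_{∂_{i₀}} T)_{i₁ … iₖ}`. -/
def covDeriv (g : MetricField) {k : ℕ} (T : TensorField k) : TensorField (k + 1) := fun x I =>
  partialDeriv (I 0) (fun y => T y (Fin.tail I)) x
    - ∑ a : Fin k, ∑ m, christoffel g m (I 0) (I a.succ) x * T x (Function.update (Fin.tail I) a m)

/-- The (rough) Laplacian `ΔT = g^{ij} ∇ᵢ ∇ⱼ T`. -/
def laplacian (g : MetricField) {k : ℕ} (T : TensorField k) : TensorField k := fun x I =>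
  ∑ i, ∑ j, (g x)⁻¹ i j *
    covDeriv g (covDeriv g T) x (Matrix.vecCons i (Matrix.vecCons j I))

/-- A function as a tensor field of rank `0`. -/
def ofFun (f : R4 → ℝ) : TensorField 0 := fun x _ => f x

/-- `‖ρ‖² = g^{ik} g^{jl} ρ_{ij} ρ_{kl}`. -/
def ricciNormSq (g : MetricField) : R4 → ℝ := fun x =>
  ∑ i, ∑ j, ∑ k, ∑ l, (g x)⁻¹ i k * (g x)⁻¹ j l * ricci g x ![i, j] * ricci g x ![k, l]

/-- `R[ρ]_{ij} = R_{ikjl} ρ^{kl}`. -/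
def curvatureRicci (g : MetricField) : TensorField 2 := fun x I =>
  ∑ k, ∑ l, ∑ p, ∑ q, riemann g x ![I 0, k, I 1, l] *
    ((g x)⁻¹ k p * (g x)⁻¹ l q * ricci g x ![p, q])

/-- The energy density `E_t = ‖ρ‖² + t τ²` of the functional `F_t : g ↦ ∫ (‖ρ‖² + t τ²) dvol`. It
is constant on a homogeneous manifold, and is then called the energy. -/
def energy (t : ℝ) (g : MetricField) : R4 → ℝ := fun x =>
  ricciNormSq g x + t * scalarCurvature g x ^ 2

/-- The left-hand side of the Euler–Lagrange equation of `F_t` in dimension four,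
`-Δρ + (2t+1)∇²τ - (2t/n)(Δτ) g + (2/n)(‖ρ‖² + tτ²) g - 2R[ρ] - 2tτρ` with `n = 4`. -/
def eulerLagrange (t : ℝ) (g : MetricField) : TensorField 2 := fun x I =>
  - laplacian g (ricci g) x I
    + (2 * t + 1) * covDeriv g (covDeriv g (ofFun (scalarCurvature g))) x I
    - (2 * t / 4) * laplacian g (ofFun (scalarCurvature g)) x ![] * g x (I 0) (I 1)
    + (2 / 4) * (ricciNormSq g x + t * scalarCurvature g x ^ 2) * g x (I 0) (I 1)
    - 2 * curvatureRicci g x I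
    - 2 * t * scalarCurvature g x * ricci g x I

/-- `g` is `F_t`-critical: it satisfies the Euler–Lagrange equation of `F_t`. -/
def IsCritical (t : ℝ) (g : MetricField) : Prop :=
  ∀ x I, eulerLagrange t g x I = 0

/-- `∇R = 0`. -/
def IsLocallySymmetric (g : MetricField) : Prop :=
  ∀ x I, covDeriv g (riemann g) x I = 0

/-- The pull-back `φ^* g`. -/
def pullback (φ : R4 → R4) (g : MetricField) : MetricField := fun x =>
  (LinearMap.toMatrix' (fderiv ℝ φ x : R4 →ₗ[ℝ] R4))ᵀ * g (φ x) *
    LinearMap.toMatrix' (fderiv ℝ φ x : R4 →ₗ[ℝ] R4)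

/-- `g` and `g'` are homothetic: `φ^* g' = c g` for a diffeomorphism `φ` and a constant `c > 0`. -/
def Homothetic (g g' : MetricField) : Prop :=
  ∃ c : ℝ, 0 < c ∧ ∃ φ : R4 ≃ₘ^∞⟮𝓘(ℝ, R4), 𝓘(ℝ, R4)⟯ R4, ∀ x, pullback φ g' x = c • g x

/-! ### The Lie groups `ℝ ⋉ ℝ³` and their left-invariant metrics -/

/-- The product of the simply connected Lie group `ℝ ⋉_D ℝ³` determined by a derivation
`D ∈ 𝔤𝔩(3, ℝ)` of the Abelian Lie algebra: `(x, s) (y, r) = (x + e^{sD} y, s + r)`, where the last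
coordinate of `ℝ⁴ = ℝ³ × ℝ` is that of the factor `ℝ`. -/
def semiMul (D : Matrix (Fin 3) (Fin 3) ℝ) (p q : R4) : R4 :=
  Fin.snoc (α := fun _ => ℝ)
    (Fin.init p + NormedSpace.exp (p (Fin.last 3) • D) *ᵥ Fin.init q)
    (p (Fin.last 3) + q (Fin.last 3))

/-- The inverse in the group `ℝ ⋉_D ℝ³`; the identity element is `0`. -/
def semiInv (D : Matrix (Fin 3) (Fin 3) ℝ) (p : R4) : R4 :=
  Fin.snoc (α := fun _ => ℝ)
    (-(NormedSpace.exp ((-p (Fin.last 3)) • D) *ᵥ Fin.init p)) (-p (Fin.last 3))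

theorem exp_add_smul (D : Matrix (Fin 3) (Fin 3) ℝ) (s r : ℝ) :
    NormedSpace.exp ((s + r) • D) = NormedSpace.exp (s • D) * NormedSpace.exp (r • D) := by
  rw [add_smul]
  exact Matrix.exp_add_of_commute _ _ (((Commute.refl D).smul_left s).smul_right r)

theorem semiMul_assoc (D : Matrix (Fin 3) (Fin 3) ℝ) (p q r : R4) :
    semiMul D (semiMul D p q) r = semiMul D p (semiMul D q r) := by
  simp only [semiMul, Fin.init_snoc, Fin.snoc_last, exp_add_smul, Matrix.mulVec_add,
    Matrix.mulVec_mulVec, add_assoc]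

theorem zero_semiMul (D : Matrix (Fin 3) (Fin 3) ℝ) (p : R4) : semiMul D 0 p = p := by
  have h : Fin.init (α := fun _ : Fin 4 => ℝ) (0 : R4) = 0 := rfl
  simp only [semiMul, h, Pi.zero_apply, zero_smul, NormedSpace.exp_zero, Matrix.one_mulVec, zero_add]
  exact Fin.snoc_init_self p

theorem semiInv_semiMul (D : Matrix (Fin 3) (Fin 3) ℝ) (p : R4) : semiMul D (semiInv D p) p = 0 := by
  simp only [semiMul, semiInv, Fin.init_snoc, Fin.snoc_last, neg_add_cancel]
  ext i
  refine Fin.lastCases ?_ (fun j => ?_) i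
  · rw [Fin.snoc_last]; rfl
  · rw [Fin.snoc_castSucc]; rfl

theorem mul_eq_affine (D : Matrix (Fin 3) (Fin 3) ℝ) (p : R4) :
    ∃ L : R4 →L[ℝ] R4, (∀ v, L v = Fin.snoc (α := fun _ => ℝ)
      (NormedSpace.exp (p (Fin.last 3) • D) *ᵥ Fin.init v) (v (Fin.last 3))) ∧ ∀ q, semiMul D p q = p + L q := by
  let L : R4 →ₗ[ℝ] R4 :=
    { toFun := fun v => Fin.snoc (α := fun _ => ℝ)
        (NormedSpace.exp (p (Fin.last 3) • D) *ᵥ Fin.init v) (v (Fin.last 3))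
      map_add' := by
        intro u v
        have h : Fin.init (α := fun _ : Fin 4 => ℝ) (u + v) = Fin.init (α := fun _ : Fin 4 => ℝ) u + Fin.init (α := fun _ : Fin 4 => ℝ) v := rfl
        ext i
        refine Fin.lastCases ?_ (fun j => ?_) i
        · simp only [Fin.snoc_last, Pi.add_apply]
        · simp only [Fin.snoc_castSucc, Pi.add_apply, h, Matrix.mulVec_add]
      map_smul' := by
        intro c v
        have h : Fin.init (α := fun _ : Fin 4 => ℝ) (c • v) = c • Fin.init (α := fun _ : Fin 4 => ℝ) v := rfl
        ext i
        refine Fin.lastCases ?_ (fun j => ?_) i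
        · simp only [Fin.snoc_last, Pi.smul_apply, RingHom.id_apply]
        · simp only [Fin.snoc_castSucc, Pi.smul_apply, h, Matrix.mulVec_smul, RingHom.id_apply] }
  refine ⟨L.toContinuousLinearMap, fun v => rfl, fun q => ?_⟩
  have hL : L.toContinuousLinearMap q = Fin.snoc (α := fun _ => ℝ)
      (NormedSpace.exp (p (Fin.last 3) • D) *ᵥ Fin.init q) (q (Fin.last 3)) := rfl
  ext i
  rw [hL, semiMul]
  refine Fin.lastCases ?_ (fun j => ?_) i
  · simp only [Fin.snoc_last, Pi.add_apply]
  · simp only [Fin.snoc_castSucc, Pi.add_apply]; rfl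

/-- The left-invariant vector field on `ℝ ⋉_D ℝ³` with value `u` at the identity. -/
def leftInvariantField (D : Matrix (Fin 3) (Fin 3) ℝ) (u : R4) : R4 → R4 := fun p =>
  fderiv ℝ (semiMul D p) 0 u

/-- The Lie bracket of the Lie algebra of `ℝ ⋉_D ℝ³`. -/
def bracket (D : Matrix (Fin 3) (Fin 3) ℝ) (u v : R4) : R4 :=
  VectorField.lieBracket ℝ (leftInvariantField D u) (leftInvariantField D v) 0

theorem leftInvariantField_apply (D : Matrix (Fin 3) (Fin 3) ℝ) (u p : R4) :
    leftInvariantField D u p = Fin.snoc (α := fun _ => ℝ)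
      (NormedSpace.exp (p (Fin.last 3) • D) *ᵥ Fin.init u) (u (Fin.last 3)) := by
  obtain ⟨L, hL, h⟩ := mul_eq_affine D p
  have : semiMul D p = fun q => p + L q := funext h
  rw [leftInvariantField, this, fderiv_const_add, L.fderiv, hL]

theorem fderiv_leftInvariantField (D : Matrix (Fin 3) (Fin 3) ℝ) (u w : R4) :
    fderiv ℝ (leftInvariantField D u) 0 w = Fin.snoc (α := fun _ => ℝ)
      (w (Fin.last 3) • (D *ᵥ Fin.init u)) 0 := by
  have hexp : HasDerivAt (fun s : ℝ => NormedSpace.exp (s • D)) D 0 := by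
    open scoped Matrix.Norms.Operator in
    have := hasDerivAt_exp_smul_const (𝕂 := ℝ) D (0:ℝ)
    simp only [zero_smul, NormedSpace.exp_zero, one_mul] at this
    exact this
  have h : HasFDerivAt (leftInvariantField D u) (ContinuousLinearMap.pi fun i : Fin 4 =>
      (Fin.lastCases (motive := fun _ => R4 →L[ℝ] ℝ) 0 (fun j : Fin 3 => (D *ᵥ Fin.init u) j • ContinuousLinearMap.proj (Fin.last 3)) i)) 0 := by
    rw [hasFDerivAt_pi']
    intro i
    refine Fin.lastCases ?_ (fun j => ?_) i
    · have : (fun x => leftInvariantField D u x (Fin.last 3)) = fun _ => u (Fin.last 3) := by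
        ext x; rw [leftInvariantField_apply, Fin.snoc_last]
      rw [this]
      refine (hasFDerivAt_const _ _).congr_fderiv ?_
      ext v
      simp only [ContinuousLinearMap.comp_apply, ContinuousLinearMap.proj_apply, ContinuousLinearMap.coe_pi', Fin.lastCases_last]
    · have : (fun x => leftInvariantField D u x j.castSucc) = fun x : R4 =>
          (NormedSpace.exp (x (Fin.last 3) • D) *ᵥ Fin.init u) j := by
        ext x; rw [leftInvariantField_apply, Fin.snoc_castSucc]
      rw [this]
      have h1 : HasDerivAt (fun s : ℝ => (NormedSpace.exp (s • D) *ᵥ Fin.init u) j) ((D *ᵥ Fin.init u) j) 0 := by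
        simp only [Matrix.mulVec, dotProduct]
        apply HasDerivAt.fun_sum
        intro k _
        exact ((hasDerivAt_pi.1 ((hasDerivAt_pi.1 hexp) j)) k).mul_const _
      have h2 : HasFDerivAt (fun x : R4 => x (Fin.last 3)) (ContinuousLinearMap.proj (R := ℝ) (φ := fun _ : Fin 4 => ℝ) (Fin.last 3)) 0 :=
        hasFDerivAt_apply _ _
      have h3 := HasDerivAt.comp_hasFDerivAt (f := fun x : R4 => x (Fin.last 3)) (0 : R4) (h₂ := fun s : ℝ => (NormedSpace.exp (s • D) *ᵥ Fin.init u) j) h1 h2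
      refine HasFDerivAt.congr_fderiv (f := fun x : R4 => (NormedSpace.exp (x (Fin.last 3) • D) *ᵥ Fin.init u) j) h3 ?_
      ext v; simp
  rw [h.fderiv]
  ext i
  refine Fin.lastCases ?_ (fun j => ?_) i
  · simp only [Fin.snoc_last, ContinuousLinearMap.coe_pi', Fin.lastCases_last]; rfl
  · simp only [Fin.snoc_castSucc, ContinuousLinearMap.coe_pi', Fin.lastCases_castSucc]
    simp [mul_comm]

/-- In `ℝ ⋉_D ℝ³` the bracket is `[(x, s), (y, r)] = (s D y - r D x, 0)`; so `[e₄, y] = D y`. -/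
theorem bracket_eq (D : Matrix (Fin 3) (Fin 3) ℝ) (u v : R4) :
    bracket D u v = Fin.snoc (α := fun _ => ℝ)
      (u (Fin.last 3) • (D *ᵥ Fin.init v) - v (Fin.last 3) • (D *ᵥ Fin.init u)) 0 := by
  have h0 : ∀ w, leftInvariantField D w 0 = w := fun w => by
    rw [leftInvariantField_apply]
    simp only [Pi.zero_apply, zero_smul, NormedSpace.exp_zero, Matrix.one_mulVec]
    exact Fin.snoc_init_self w
  rw [bracket, VectorField.lieBracket, fderiv_leftInvariantField, fderiv_leftInvariantField, h0, h0]
  ext i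
  refine Fin.lastCases ?_ (fun j => ?_) i
  · simp only [Pi.sub_apply, Fin.snoc_last, sub_zero]
  · simp only [Pi.sub_apply, Fin.snoc_castSucc]

/-- The left-invariant metric on `ℝ ⋉_D ℝ³` whose value on the Lie algebra (the tangent space at
the identity) is the inner product with Gram matrix `Q`: `g_p(u, v) = Q(dL_{p⁻¹} u, dL_{p⁻¹} v)`. -/
def leftInvariantMetric (D : Matrix (Fin 3) (Fin 3) ℝ) (Q : Matrix (Fin 4) (Fin 4) ℝ) :
    MetricField := fun p => pullback (semiMul D (semiInv D p)) (fun _ => Q) p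

/-- The metric is indeed left-invariant. -/
theorem pullback_leftInvariantMetric (D : Matrix (Fin 3) (Fin 3) ℝ) (Q : Matrix (Fin 4) (Fin 4) ℝ) (p q : R4) :
   pullback (semiMul D p) (leftInvariantMetric D Q) q = leftInvariantMetric D Q q := by
  have hd : ∀ p q, HasFDerivAt (semiMul D p) (fderiv ℝ (semiMul D p) 0) q := by
    intro p q
    obtain ⟨L, hL, h⟩ := mul_eq_affine D p
    have : semiMul D p = fun q => p + L q := funext h
    rw [this, fderiv_const_add, L.fderiv]
    exact L.hasFDerivAt.const_add p
  have key : semiMul D (semiInv D q) = fun r => semiMul D (semiInv D (semiMul D p q)) (semiMul D p r) := by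
    have linv : semiInv D (semiMul D p q) = semiMul D (semiInv D q) (semiInv D p) := by
      have inj : ∀ a b : R4, semiMul D a (semiMul D p q) = 0 → semiMul D b (semiMul D p q) = 0 → a = b := by
        intro a b ha hb
        have hr : ∀ x, semiMul D x (semiInv D x) = 0 := by
          intro x
          have h1 := semiInv_semiMul D (semiInv D x)
          have : semiMul D (semiMul D (semiMul D (semiInv D (semiInv D x)) (semiInv D x)) x) (semiInv D x) = semiMul D (semiInv D (semiInv D x)) (semiMul D (semiMul D (semiInv D x) x) (semiInv D x)) := by
            simp only [semiMul_assoc]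
          rw [h1, semiInv_semiMul, zero_semiMul, zero_semiMul, h1] at this
          exact this
        have z : ∀ x, semiMul D x 0 = x := by
          intro x; rw [← semiInv_semiMul D x, ← semiMul_assoc, hr, zero_semiMul]
        have : semiMul D (semiMul D a (semiMul D p q)) (semiInv D (semiMul D p q)) = semiMul D (semiMul D b (semiMul D p q)) (semiInv D (semiMul D p q)) := by rw [ha, hb]
        rw [semiMul_assoc D a, semiMul_assoc D b, hr, z, z] at this
        exact this
      apply inj _ _ (semiInv_semiMul D _)
      rw [semiMul_assoc, ← semiMul_assoc D (semiInv D p), semiInv_semiMul, zero_semiMul, semiInv_semiMul]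
    funext r
    rw [linv, semiMul_assoc, ← semiMul_assoc D (semiInv D p), semiInv_semiMul, zero_semiMul]
  have hc : fderiv ℝ (semiMul D (semiInv D q)) q = (fderiv ℝ (semiMul D (semiInv D (semiMul D p q))) (semiMul D p q)).comp (fderiv ℝ (semiMul D p) q) := by
    conv_lhs => rw [key]
    exact fderiv_comp (𝕜 := ℝ) q (hd _ _).differentiableAt (hd _ _).differentiableAt
  simp only [pullback, leftInvariantMetric]
  rw [hc, ContinuousLinearMap.toLinearMap_comp, LinearMap.toMatrix'_comp, Matrix.transpose_mul]
  simp only [Matrix.mul_assoc]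

/-- The Ricci operator, `g(Ric X, Y) = ρ(X, Y)`, at the point `x`. -/
def ricciOperator (g : MetricField) (x : R4) : Matrix (Fin 4) (Fin 4) ℝ :=
  (g x)⁻¹ * Matrix.of fun i j => ricci g x ![i, j]

/-- The left-invariant metric `g` on `ℝ ⋉_D ℝ³` is an algebraic Ricci soliton: `Ric = l Id + A` on
the Lie algebra, for a real number `l` and a derivation `A` of the Lie algebra. -/
def IsAlgebraicRicciSoliton (D : Matrix (Fin 3) (Fin 3) ℝ) (g : MetricField) : Prop :=
  ∃ (l : ℝ) (A : Matrix (Fin 4) (Fin 4) ℝ),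
    (∀ u v, A *ᵥ bracket D u v = bracket D (A *ᵥ u) v + bracket D u (A *ᵥ v)) ∧
    ricciOperator g 0 = l • (1 : Matrix (Fin 4) (Fin 4) ℝ) + A

/-- The derivation `D = ad e₄` of the Lie algebra with `[eᵢ, e₄] = ∑ⱼ B i j eⱼ`, `i = 1, 2, 3`. -/
def derivationOf (B : Matrix (Fin 3) (Fin 3) ℝ) : Matrix (Fin 3) (Fin 3) ℝ := -Bᵀ

/-- The left-invariant metric determined by the brackets `[eᵢ, e₄] = ∑ⱼ B i j eⱼ`, `i = 1, 2, 3`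
(the other brackets vanishing), the basis `e₁, …, e₄` being orthonormal. -/
def metricOf (B : Matrix (Fin 3) (Fin 3) ℝ) : MetricField :=
  leftInvariantMetric (derivationOf B) 1

/-! ### The seven families

In each family, row `i` of `B` lists the components of `[eᵢ, e₄]` in `e₁, e₂, e₃`, and `t` is the
parameter of the functional; in the last two, `E` is the energy. -/

def Family1 (B : Matrix (Fin 3) (Fin 3) ℝ) (t : ℝ) : Prop :=
  B = !![1, 0, 1; 0, 0, 0; -1, 0, -1] ∧ t = -3

def Family2 (B : Matrix (Fin 3) (Fin 3) ℝ) (t : ℝ) : Prop :=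
  B = !![1, 0, 1 / √2; 0, -1, 1 / √2; -(1 / √2), -(1 / √2), 0] ∧ t = -(3 / 2)

def Family3 (B : Matrix (Fin 3) (Fin 3) ℝ) (t : ℝ) : Prop :=
  ∃ f p : ℝ, -1 ≤ f ∧ f ≤ p ∧ p ≤ 1 ∧ ¬ (f = -1 ∧ -1 ≤ p ∧ p < 0) ∧
    ¬ (f = 0 ∧ p = 0) ∧ ¬ (f = 0 ∧ p = 1) ∧ ¬ (f = 1 ∧ p = 1) ∧
    B = !![1, 0, 0; 0, f, 0; 0, 0, p] ∧
    t = -((f ^ 2 + p ^ 2 + 1) / (2 * (f ^ 2 + p ^ 2 + f * p + f + p + 1)))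

/-- The equation for `h` in the fourth family. -/
def Eq4 (κ h : ℝ) : Prop :=
  h ^ 2 * (4 * κ ^ 2 - 3) - κ ^ 2 * (4 * κ ^ 2 + 3) = 0

def Family4 (B : Matrix (Fin 3) (Fin 3) ℝ) (t : ℝ) : Prop :=
  ∃ κ h : ℝ, √3 / 2 < κ ∧ 0 < h ∧ Eq4 κ h ∧
    B = !![1, 0, 0; 0, -(κ + 1 / 2), h; 0, -h, κ - 1 / 2] ∧
    t = -((48 * κ ^ 4 - 9) / (16 * κ ^ 4 - 9))

/-- The equation for the left end point `ζ` of the parameter range of the fifth family. -/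
def EqZeta (ζ : ℝ) : Prop := 8 * ζ ^ 3 + 15 * ζ ^ 2 + 3 * ζ + 1 = 0

/-- The parameter range `(ζ, -1) ∪ ((1 - √21) / 10, 0)` of the fifth family. -/
def Range5 (p : ℝ) : Prop :=
  (∃ ζ, EqZeta ζ ∧ ζ < p ∧ p < -1) ∨ ((1 - √21) / 10 < p ∧ p < 0)

/-- The equation for `c` in the fifth family. -/
def Eq5c (p c : ℝ) : Prop :=
  c ^ 2 * (p + 2) * (5 * p ^ 2 - p - 1)
    + (2 * p + 1) * (8 * p ^ 3 + 15 * p ^ 2 + 3 * p + 1) = 0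

/-- The equation for `h` in the fifth family. -/
def Eq5h (p h : ℝ) : Prop :=
  h ^ 2 * (p + 2) * (5 * p ^ 2 - p - 1)
    - (p + 1) * (p - 1) * (5 * p ^ 3 + 12 * p ^ 2 + 1) = 0

def Family5 (B : Matrix (Fin 3) (Fin 3) ℝ) (t : ℝ) : Prop :=
  ∃ p c h : ℝ, Range5 p ∧ 0 < c ∧ Eq5c p c ∧ 0 < h ∧ Eq5h p h ∧
    B = !![1, 0, c; 0, -(p + 1), h; -c, -h, p] ∧
    t = -((30 * p ^ 4 - 3 * p ^ 2 - 6 * p - 3) /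
      (2 * (p ^ 2 + p + 1) * (5 * p ^ 2 - p - 1)))

/-- The equation for `f` in the sixth family. -/
def Eq6 (h f : ℝ) : Prop := 36 * (f ^ 2 - h ^ 2) - 24 * f - 5 = 0

def Family6 (B : Matrix (Fin 3) (Fin 3) ℝ) (t E : ℝ) : Prop :=
  ∃ h f : ℝ, 0 < h ∧ 0 < f ∧ Eq6 h f ∧
    B = !![1 / 3, 0, 0; 0, f, h; 0, -h, -(f - 2 / 3)] ∧
    t = -((36 * h ^ 2 + 5) / (12 * h ^ 2 + 11)) ∧ E = -(16 / 3) * h ^ 2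

/-- The equation for `a` in the seventh family. -/
def Eq7 (b a : ℝ) : Prop := 9 * a ^ 2 - 18 * b ^ 2 - 6 * a - 8 = 0

def Family7 (B : Matrix (Fin 3) (Fin 3) ℝ) (t E : ℝ) : Prop :=
  ∃ b a : ℝ, 0 < b ∧ 0 < a ∧ Eq7 b a ∧
    B = !![a, b, 0; -b, 1 / 3, b; 0, -b, -(a - 2 / 3)] ∧
    t = -((18 * b ^ 2 + 7) / (12 * b ^ 2 + 10)) ∧ E = -(8 / 3) * b ^ 2

/-- The five families of zero energy. -/
def ZeroEnergyFamily (B : Matrix (Fin 3) (Fin 3) ℝ) (t : ℝ) : Prop :=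
  Family1 B t ∨ Family2 B t ∨ Family3 B t ∨ Family4 B t ∨ Family5 B t

/-- The two families of non-zero energy. -/
def NonzeroEnergyFamily (B : Matrix (Fin 3) (Fin 3) ℝ) (t E : ℝ) : Prop :=
  Family6 B t E ∨ Family7 B t E

end QuadraticCurvature

end

/-!
Why the classification holds.

*Reduction to algebra.* The curvature, its covariant derivatives and the Euler–Lagrange tensor are
natural under diffeomorphisms and scale under constant multiples of the metric, so being critical
and being symmetric are invariant under homotheties (`Homothetic.isCritical_iff`,
`Homothetic.isLocallySymmetric_iff`), while the energy is multiplied by a positive constant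
(`Homothetic.energy_eq`). In particular these tensors are left-invariant for a left-invariant
metric, and it suffices to know them at the identity. An orthonormal basis of the Lie algebra
whose first three vectors lie in the ideal `ℝ³` and diagonalize the symmetric part of `ad e₄`
exhibits every left-invariant metric, up to homothety, as one in the normal form with matrix of
brackets `B = S + A`, where `S = diag(a₁, a₂, a₃)` and `A` is skew-symmetric with entries `x, y, z`
(`exists_homothetic_normalForm`). There the Euler–Lagrange equation becomes the system
`CriticalEquations` of polynomial equations (`isCritical_normalForm_iff`).

*Solving the equations.* Write `θ = tr S`, `σ = |S|²`, `S₀ = S - (θ/3) Id` and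
`u = σ + t (θ² + σ)`; the energy of a critical metric is `(4/3) θ² u`. The component of the equation
along `e₄` says `|[S, A]|² = -u |S₀|²`.

* If `S` and `A` commute, then `exp(sA)` is a group of isometries, so `A` may be dropped; and
  `u = 0`. These are the metrics of the third family.
* If they do not commute and `θ ≠ 0`, pairing the equation on `ℝ³` with the double commutator
  `M = [A, [S, A]]`, up to sign, gives `|M|² = -u |[S, A]|²`. With the first relation this is
  `|M - u S₀|² = 0`, so `M = u S₀` (`CriticalEquations.doubleCommutator`). Hence
  at most two of `x, y, z` are non-zero, which gives the sixth and the seventh family.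
* If they do not commute and `θ = 0`, the diagonal equations force `x y z = 0`. One non-zero
  entry of `A` gives the first and the fourth family. For two non-zero entries the equations are
  linear in the squares of these entries and in `u`; solving them gives the second and the fifth
  family, the range of the parameter being determined by the signs of the squares.

*Solitons.* The Ricci operator preserves `ℝ³` and the line of `e₄`, and the soliton equation reduces
to `[P, D] = r D` for its restriction `P` to `ℝ³` (`isAlgebraicRicciSoliton_normalForm_iff`).
-/

noncomputable section

namespace QuadraticCurvature

/-! ### The action of linear maps on covariant tensors -/

/-- The covariant tensors of rank `k` on `ℝ⁴`. -/
abbrev Tensor (k : ℕ) : Type := (Fin k → Fin 4) → ℝ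

/-- The pull-back of a covariant tensor by the linear map with matrix `J`. -/
def tensorAct {k : ℕ} (J : Matrix (Fin 4) (Fin 4) ℝ) (T : Tensor k) : Tensor k :=
  fun I => ∑ K : Fin k → Fin 4, (∏ a, J (K a) (I a)) * T K

theorem tensorAct_tensorAct {k : ℕ} (J L : Matrix (Fin 4) (Fin 4) ℝ) (T : Tensor k) :
    tensorAct J (tensorAct L T) = tensorAct (L * J) T := by
  funext I
  simp only [tensorAct, Finset.mul_sum]
  rw [Finset.sum_comm]
  refine Finset.sum_congr rfl fun K _ => ?_
  simp only [Matrix.mul_apply, Finset.prod_univ_sum, Fintype.piFinset_univ, Finset.sum_mul,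
    Finset.prod_mul_distrib]
  refine Finset.sum_congr rfl fun M _ => ?_
  ring

theorem tensorAct_one {k : ℕ} (T : Tensor k) : tensorAct 1 T = T := by
  funext I
  rw [tensorAct, Finset.sum_eq_single I]
  · simp
  · intro K _ hK
    obtain ⟨a, ha⟩ := Function.ne_iff.1 hK
    have h0 : ∏ a, (1 : Matrix (Fin 4) (Fin 4) ℝ) (K a) (I a) = 0 :=
      Finset.prod_eq_zero (Finset.mem_univ a) (Matrix.one_apply_ne ha)
    rw [h0, zero_mul]
  · simp

theorem tensorAct_zero {k : ℕ} (J : Matrix (Fin 4) (Fin 4) ℝ) :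
    tensorAct J (0 : Tensor k) = 0 := by
  funext I; simp [tensorAct]

theorem tensorAct_add {k : ℕ} (J : Matrix (Fin 4) (Fin 4) ℝ) (T U : Tensor k) :
    tensorAct J (T + U) = tensorAct J T + tensorAct J U := by
  funext I; simp [tensorAct, mul_add, Finset.sum_add_distrib]

theorem tensorAct_smul {k : ℕ} (J : Matrix (Fin 4) (Fin 4) ℝ) (c : ℝ) (T : Tensor k) :
    tensorAct J (c • T) = c • tensorAct J T := by
  funext I
  simp only [tensorAct, Pi.smul_apply, smul_eq_mul, Finset.mul_sum]
  exact Finset.sum_congr rfl fun K _ => by ring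

theorem tensorAct_eq_zero_iff {k : ℕ} {J : Matrix (Fin 4) (Fin 4) ℝ} (hJ : IsUnit J.det)
    (T : Tensor k) : tensorAct J T = 0 ↔ T = 0 := by
  constructor
  · intro h
    have := congrArg (tensorAct J⁻¹) h
    rwa [tensorAct_tensorAct, Matrix.mul_nonsing_inv _ hJ, tensorAct_one, tensorAct_zero] at this
  · rintro rfl
    exact tensorAct_zero J

theorem tensorAct_comp_perm {k : ℕ} (J : Matrix (Fin 4) (Fin 4) ℝ) (T : Tensor k)
    (σ : Equiv.Perm (Fin k)) (I : Fin k → Fin 4) :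
    tensorAct J (fun K => T (K ∘ σ)) I = tensorAct J T (I ∘ σ) := by
  simp only [tensorAct]
  refine Fintype.sum_equiv (Equiv.arrowCongr σ.symm (Equiv.refl _)) _ _ fun K => ?_
  have : (Equiv.arrowCongr σ.symm (Equiv.refl (Fin 4))) K = K ∘ σ := by
    funext a; simp [Equiv.arrowCongr]
  rw [this]
  congr 1
  exact (Equiv.prod_comp σ fun a => J (K a) (I a)).symm

theorem tensorAct_succ {k : ℕ} (J : Matrix (Fin 4) (Fin 4) ℝ) (T : Tensor (k + 1)) (i : Fin 4)
    (I : Fin k → Fin 4) :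
    tensorAct J T (Matrix.vecCons i I)
      = ∑ a, J a i * tensorAct J (fun K => T (Matrix.vecCons a K)) I := by
  simp only [tensorAct, Finset.mul_sum]
  rw [← (Fin.consEquiv fun _ : Fin (k + 1) => Fin 4).sum_comp, Fintype.sum_prod_type]
  refine Finset.sum_congr rfl fun a _ => Finset.sum_congr rfl fun K _ => ?_
  have h : (Fin.consEquiv fun _ : Fin (k + 1) => Fin 4) (a, K) = Fin.cons a K := rfl
  rw [Fin.prod_univ_succ, h]
  simp only [Fin.cons_zero, Fin.cons_succ, Matrix.vecCons]
  ring

theorem tensorAct_zero_rank (J : Matrix (Fin 4) (Fin 4) ℝ) (T : Tensor 0) : tensorAct J T = T := by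
  funext I
  simp only [tensorAct, Finset.univ_unique, Finset.sum_singleton, Finset.univ_eq_empty,
    Finset.prod_empty, one_mul]
  exact congrArg T (Subsingleton.elim _ _)

/-- The contraction of the first two indices of a tensor with the bilinear form `h`. -/
def contract {k : ℕ} (h : Matrix (Fin 4) (Fin 4) ℝ) (T : Tensor (k + 2)) : Tensor k :=
  fun I => ∑ i, ∑ j, h i j * T (Matrix.vecCons i (Matrix.vecCons j I))

/-- Contraction commutes with a linear change of coordinates, if the contracting form is
transformed contravariantly. -/
theorem contract_tensorAct {k : ℕ} {J h h' : Matrix (Fin 4) (Fin 4) ℝ} (hh : J * h * Jᵀ = h')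
    (T : Tensor (k + 2)) : contract h (tensorAct J T) = tensorAct J (contract h' T) := by
  funext I
  have hab : ∀ a b, h' a b = ∑ i, ∑ j, J a i * h i j * J b j := by
    intro a b
    rw [← hh]
    simp only [Matrix.mul_apply, Matrix.transpose_apply, Finset.sum_mul]
    exact Finset.sum_comm
  have hr : tensorAct J (contract h' T) I
      = ∑ a, ∑ b, h' a b * tensorAct J (fun K => T (Matrix.vecCons a (Matrix.vecCons b K))) I := by
    simp only [tensorAct, contract, Finset.mul_sum]
    rw [Finset.sum_comm]
    refine Finset.sum_congr rfl fun a _ => ?_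
    rw [Finset.sum_comm]
    refine Finset.sum_congr rfl fun b _ => Finset.sum_congr rfl fun K _ => ?_
    ring
  rw [hr]
  simp only [contract, tensorAct_succ, hab, Finset.mul_sum, Finset.sum_mul]
  have e : ∀ F : Fin 4 → Fin 4 → Fin 4 → Fin 4 → ℝ, ∑ i, ∑ j, ∑ a, ∑ b, F i j a b
      = ∑ a, ∑ b, ∑ i, ∑ j, F i j a b := by
    intro F
    rw [Finset.sum_congr rfl fun i _ => Finset.sum_comm, Finset.sum_comm]
    refine Finset.sum_congr rfl fun a _ => ?_
    rw [Finset.sum_congr rfl fun i _ => Finset.sum_comm, Finset.sum_comm]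
  rw [e]
  refine Finset.sum_congr rfl fun a _ => Finset.sum_congr rfl fun b _ =>
    Finset.sum_congr rfl fun i _ => Finset.sum_congr rfl fun j _ => ?_
  ring

/-- The tensor product of two covariant tensors. -/
def tensorMul {k l : ℕ} (T : Tensor k) (U : Tensor l) : Tensor (k + l) :=
  fun I => T (I ∘ Fin.castAdd l) * U (I ∘ Fin.natAdd k)

theorem tensorAct_tensorMul {k l : ℕ} (J : Matrix (Fin 4) (Fin 4) ℝ) (T : Tensor k)
    (U : Tensor l) : tensorAct J (tensorMul T U) = tensorMul (tensorAct J T) (tensorAct J U) := by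
  funext I
  simp only [tensorAct, tensorMul, Finset.sum_mul_sum]
  rw [← (Fin.appendEquiv k l).sum_comp, Fintype.sum_prod_type]
  refine Finset.sum_congr rfl fun K _ => Finset.sum_congr rfl fun M _ => ?_
  have h1 : Fin.appendEquiv k l (K, M) ∘ Fin.castAdd l = K := by
    funext a; simp [Fin.appendEquiv]
  have h2 : Fin.appendEquiv k l (K, M) ∘ Fin.natAdd k = M := by
    funext a; simp [Fin.appendEquiv]
  rw [h1, h2, Fin.prod_univ_add]
  have h3 : ∀ a, Fin.appendEquiv k l (K, M) (Fin.castAdd l a) = K a := fun a => congrFun h1 a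
  have h4 : ∀ a, Fin.appendEquiv k l (K, M) (Fin.natAdd k a) = M a := fun a => congrFun h2 a
  simp only [h3, h4, Function.comp_apply]
  ring

/-! ### Partial derivatives and smoothness -/

theorem partialDeriv_sub {f h : R4 → ℝ} {x : R4} (hf : DifferentiableAt ℝ f x)
    (hh : DifferentiableAt ℝ h x) (i : Fin 4) :
    partialDeriv i (fun y => f y - h y) x = partialDeriv i f x - partialDeriv i h x := by
  simp [partialDeriv, fderiv_fun_sub hf hh]

theorem partialDeriv_mul {f h : R4 → ℝ} {x : R4} (hf : DifferentiableAt ℝ f x)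
    (hh : DifferentiableAt ℝ h x) (i : Fin 4) :
    partialDeriv i (fun y => f y * h y) x = partialDeriv i f x * h x + f x * partialDeriv i h x := by
  simp [partialDeriv, fderiv_fun_mul hf hh]; ring

theorem partialDeriv_sum {ι : Type*} (s : Finset ι) {f : ι → R4 → ℝ} {x : R4}
    (hf : ∀ a ∈ s, DifferentiableAt ℝ (f a) x) (i : Fin 4) :
    partialDeriv i (fun y => ∑ a ∈ s, f a y) x = ∑ a ∈ s, partialDeriv i (f a) x := by
  simp [partialDeriv, fderiv_fun_sum hf]

theorem partialDeriv_const_mul (c : ℝ) (f : R4 → ℝ) (x : R4) (i : Fin 4) :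
    partialDeriv i (fun y => c * f y) x = c * partialDeriv i f x := by
  have : (fun y => c * f y) = c • f := rfl
  rw [partialDeriv, this, fderiv_const_smul_field]
  simp [partialDeriv]

theorem partialDeriv_const (c : ℝ) (x : R4) (i : Fin 4) : partialDeriv i (fun _ => c) x = 0 := by
  simp [partialDeriv]

theorem partialDeriv_prod {k : ℕ} {f : Fin k → R4 → ℝ} {x : R4}
    (hf : ∀ a, DifferentiableAt ℝ (f a) x) (i : Fin 4) :
    partialDeriv i (fun y => ∏ a, f a y) x
      = ∑ b, (∏ a ∈ Finset.univ.erase b, f a x) * partialDeriv i (f b) x := by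
  have h := HasFDerivAt.finsetProd (u := Finset.univ) (g := f)
    (g' := fun a => fderiv ℝ (f a) x) (x := x) fun a _ => (hf a).hasFDerivAt
  rw [partialDeriv, h.fderiv]
  simp [partialDeriv]

theorem fderiv_eq_sum_partialDeriv (f : R4 → ℝ) (x v : R4) :
    fderiv ℝ f x v = ∑ m, v m * partialDeriv m f x := by
  have h := LinearMap.pi_apply_eq_sum_univ (fderiv ℝ f x : R4 →ₗ[ℝ] ℝ) v
  simp only [ContinuousLinearMap.coe_coe, smul_eq_mul] at h
  rw [h]
  refine Finset.sum_congr rfl fun m _ => ?_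
  have : (fun j => if m = j then (1 : ℝ) else 0) = Pi.single m 1 := by
    funext j; simp [Pi.single_apply, eq_comm]
  rw [this, partialDeriv]

theorem partialDeriv_comm {f : R4 → ℝ} (hf : ContDiff ℝ ∞ f) (i j : Fin 4) (x : R4) :
    partialDeriv i (partialDeriv j f) x = partialDeriv j (partialDeriv i f) x := by
  have hd : Differentiable ℝ (fderiv ℝ f) :=
    (hf.fderiv_right (m := ∞) (by simp)).differentiable (by simp)
  have h : ∀ u v : R4, fderiv ℝ (fun y => fderiv ℝ f y u) x v = fderiv ℝ (fderiv ℝ f) x v u := by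
    intro u v
    rw [fderiv_clm_apply (hd x) (differentiableAt_const u)]
    simp
  have hs : IsSymmSndFDerivAt ℝ f x :=
    (hf.contDiffAt).isSymmSndFDerivAt (by simpa using ENat.LEInfty.out)
  change fderiv ℝ (fun y => fderiv ℝ f y (Pi.single j 1)) x (Pi.single i 1)
    = fderiv ℝ (fun y => fderiv ℝ f y (Pi.single i 1)) x (Pi.single j 1)
  rw [h, h]
  exact hs _ _

theorem contDiff_partialDeriv {f : R4 → ℝ} (hf : ContDiff ℝ ∞ f) (i : Fin 4) :
    ContDiff ℝ ∞ (partialDeriv i f) :=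
  (hf.fderiv_right (m := ∞) (by simp)).clm_apply contDiff_const

theorem contDiff_det {n : ℕ} {M : R4 → Matrix (Fin n) (Fin n) ℝ}
    (hM : ∀ i j, ContDiff ℝ ∞ fun x => M x i j) : ContDiff ℝ ∞ fun x => (M x).det := by
  simp only [Matrix.det_apply]
  exact ContDiff.sum fun σ _ => (contDiff_prod fun i _ => hM _ _).const_smul _

theorem contDiff_matrix_inv {M : R4 → Matrix (Fin 4) (Fin 4) ℝ}
    (hM : ∀ i j, ContDiff ℝ ∞ fun x => M x i j) (hdet : ∀ x, IsUnit (M x).det) (i j : Fin 4) :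
    ContDiff ℝ ∞ fun x => (M x)⁻¹ i j := by
  simp only [Matrix.inv_def, Ring.inverse_eq_inv', Matrix.smul_apply, smul_eq_mul,
    Matrix.adjugate_apply]
  refine ((contDiff_det hM).inv fun x => (hdet x).ne_zero).mul (contDiff_det fun a b => ?_)
  by_cases h : a = j
  · subst h
    simp only [Matrix.updateRow_self]
    exact contDiff_const
  · simp only [Matrix.updateRow_ne h]
    exact hM a b

/-- A nondegenerate symmetric matrix of smooth functions. -/
structure IsSmoothMetric (g : MetricField) : Prop where
  smooth : ∀ i j, ContDiff ℝ ∞ fun x => g x i j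
  symm : ∀ x i j, g x i j = g x j i
  isUnit_det : ∀ x, IsUnit (g x).det

/-- A tensor field with smooth components. -/
def IsSmoothTensor {k : ℕ} (T : TensorField k) : Prop := ∀ I, ContDiff ℝ ∞ fun x => T x I

theorem IsSmoothMetric.inv {g : MetricField} (hg : IsSmoothMetric g) (i j : Fin 4) :
    ContDiff ℝ ∞ fun x => (g x)⁻¹ i j :=
  contDiff_matrix_inv hg.smooth hg.isUnit_det i j

theorem IsSmoothMetric.christoffel {g : MetricField} (hg : IsSmoothMetric g) (k i j : Fin 4) :
    ContDiff ℝ ∞ (christoffel g k i j) :=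
  contDiff_const.mul <| ContDiff.sum fun l _ => (hg.inv k l).mul <|
    ((contDiff_partialDeriv (hg.smooth _ _) _).add (contDiff_partialDeriv (hg.smooth _ _) _)).sub
      (contDiff_partialDeriv (hg.smooth _ _) _)

theorem IsSmoothMetric.curvatureOp {g : MetricField} (hg : IsSmoothMetric g) (l i j k : Fin 4) :
    ContDiff ℝ ∞ (curvatureOp g l i j k) :=
  ((contDiff_partialDeriv (hg.christoffel _ _ _) _).sub
    (contDiff_partialDeriv (hg.christoffel _ _ _) _)).add <| ContDiff.sum fun _ _ =>
      ((hg.christoffel _ _ _).mul (hg.christoffel _ _ _)).sub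
        ((hg.christoffel _ _ _).mul (hg.christoffel _ _ _))

theorem IsSmoothMetric.riemann {g : MetricField} (hg : IsSmoothMetric g) :
    IsSmoothTensor (riemann g) := fun I =>
  ContDiff.sum fun _ _ => (hg.smooth (I 2) _).mul (hg.curvatureOp _ (I 0) (I 1) (I 3))

theorem IsSmoothMetric.ricci {g : MetricField} (hg : IsSmoothMetric g) :
    IsSmoothTensor (ricci g) := fun _ =>
  ContDiff.sum fun k _ => ContDiff.sum fun l _ => (hg.inv k l).mul (hg.riemann _)

theorem IsSmoothMetric.scalarCurvature {g : MetricField} (hg : IsSmoothMetric g) :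
    ContDiff ℝ ∞ (scalarCurvature g) :=
  ContDiff.sum fun k _ => ContDiff.sum fun l _ => (hg.inv k l).mul (hg.ricci _)

theorem IsSmoothTensor.covDeriv {g : MetricField} (hg : IsSmoothMetric g) {k : ℕ}
    {T : TensorField k} (hT : IsSmoothTensor T) : IsSmoothTensor (covDeriv g T) := fun I =>
  (contDiff_partialDeriv (hT (Fin.tail I)) (I 0)).sub <| ContDiff.sum fun a _ =>
    ContDiff.sum fun m _ => (hg.christoffel m (I 0) (I a.succ)).mul (hT _)

theorem ContDiff.differentiableAt' {f : R4 → ℝ} (hf : ContDiff ℝ ∞ f) (x : R4) :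
    DifferentiableAt ℝ f x :=
  (hf.differentiable (by simp)) x

theorem christoffel_symm {g : MetricField} (hg : IsSmoothMetric g) (k i j : Fin 4) (x : R4) :
    christoffel g k i j x = christoffel g k j i x := by
  simp only [christoffel]
  congr 1
  refine Finset.sum_congr rfl fun l _ => ?_
  have : (fun y => g y i j) = fun y => g y j i := funext fun y => hg.symm y i j
  rw [this]
  ring

/-! ### Naturality under diffeomorphisms -/

/-- The Jacobian matrix of a map. -/
def jacobian (φ : R4 → R4) (x : R4) : Matrix (Fin 4) (Fin 4) ℝ :=
  LinearMap.toMatrix' (fderiv ℝ φ x : R4 →ₗ[ℝ] R4)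

/-- The pull-back of a covariant tensor field. -/
def tensorPullback {k : ℕ} (φ : R4 → R4) (T : TensorField k) : TensorField k :=
  fun x => tensorAct (jacobian φ x) (T (φ x))

theorem pullback_eq (φ : R4 → R4) (g : MetricField) (x : R4) :
    pullback φ g x = (jacobian φ x)ᵀ * g (φ x) * jacobian φ x := rfl

/-- A smooth map with invertible differential. -/
structure IsSmoothImmersion (φ : R4 → R4) : Prop where
  smooth : ContDiff ℝ ∞ φ
  isUnit_det : ∀ x, IsUnit (jacobian φ x).det

theorem IsSmoothImmersion.comp_apply {φ : R4 → R4} (hφ : IsSmoothImmersion φ) (a : Fin 4) :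
    ContDiff ℝ ∞ fun x => φ x a :=
  contDiff_pi.1 hφ.smooth a

theorem IsSmoothImmersion.jacobian_apply {φ : R4 → R4} (hφ : IsSmoothImmersion φ) (x : R4)
    (a i : Fin 4) : jacobian φ x a i = partialDeriv i (fun y => φ y a) x := by
  have h := fderiv_pi fun a => ContDiff.differentiableAt' (hφ.comp_apply a) x
  have h2 : fderiv ℝ φ x = ContinuousLinearMap.pi fun a => fderiv ℝ (fun y => φ y a) x := h
  rw [jacobian, LinearMap.toMatrix'_apply, h2]
  rfl

theorem IsSmoothImmersion.contDiff_jacobian {φ : R4 → R4} (hφ : IsSmoothImmersion φ)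
    (a i : Fin 4) : ContDiff ℝ ∞ fun x => jacobian φ x a i := by
  simp only [hφ.jacobian_apply]
  exact contDiff_partialDeriv (hφ.comp_apply a) i

theorem IsSmoothImmersion.partialDeriv_jacobian_symm {φ : R4 → R4} (hφ : IsSmoothImmersion φ)
    (x : R4) (a i j : Fin 4) : partialDeriv i (fun y => jacobian φ y a j) x
      = partialDeriv j (fun y => jacobian φ y a i) x := by
  simp only [hφ.jacobian_apply]
  exact partialDeriv_comm (hφ.comp_apply a) i j x

theorem IsSmoothImmersion.partialDeriv_comp {φ : R4 → R4} (hφ : IsSmoothImmersion φ)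
    {f : R4 → ℝ} (hf : ContDiff ℝ ∞ f) (i : Fin 4) (x : R4) :
    partialDeriv i (fun y => f (φ y)) x = ∑ m, jacobian φ x m i * partialDeriv m f (φ x) := by
  have h : fderiv ℝ (fun y => f (φ y)) x = (fderiv ℝ f (φ x)).comp (fderiv ℝ φ x) :=
    fderiv_comp (𝕜 := ℝ) x (ContDiff.differentiableAt' hf _) ((hφ.smooth.differentiable (by simp)) x)
  rw [partialDeriv, h, ContinuousLinearMap.comp_apply, fderiv_eq_sum_partialDeriv]
  rfl

theorem IsSmoothMetric.pullback {φ : R4 → R4} (hφ : IsSmoothImmersion φ) {g : MetricField}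
    (hg : IsSmoothMetric g) : IsSmoothMetric (pullback φ g) where
  smooth i j := by
    simp only [pullback_eq, Matrix.mul_apply, Matrix.transpose_apply]
    exact ContDiff.sum fun b _ => (ContDiff.sum fun a _ => (hφ.contDiff_jacobian _ _).mul
      ((hg.smooth _ _).comp hφ.smooth)).mul (hφ.contDiff_jacobian _ _)
  symm x i j := by
    have hs : (g (φ x))ᵀ = g (φ x) := by ext a b; exact hg.symm _ _ _
    have h : (QuadraticCurvature.pullback φ g x)ᵀ = QuadraticCurvature.pullback φ g x := by
      simp only [pullback_eq, Matrix.transpose_mul, Matrix.transpose_transpose, hs, Matrix.mul_assoc]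
    exact congrFun (congrFun h j) i
  isUnit_det x := by
    rw [pullback_eq, Matrix.det_mul, Matrix.det_mul, Matrix.det_transpose]
    exact ((hφ.isUnit_det x).mul (hg.isUnit_det _)).mul (hφ.isUnit_det x)

theorem IsSmoothTensor.pullback {φ : R4 → R4} (hφ : IsSmoothImmersion φ) {k : ℕ}
    {T : TensorField k} (hT : IsSmoothTensor T) : IsSmoothTensor (tensorPullback φ T) := fun _ =>
  ContDiff.sum fun K _ => (contDiff_prod fun _ _ => hφ.contDiff_jacobian _ _).mul
    ((hT K).comp hφ.smooth)

theorem jacobian_mul_inv_pullback {φ : R4 → R4} (hφ : IsSmoothImmersion φ) {g : MetricField}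
    (x : R4) : jacobian φ x * (pullback φ g x)⁻¹ = (g (φ x))⁻¹ * ((jacobian φ x)ᵀ)⁻¹ := by
  rw [pullback_eq, Matrix.mul_inv_rev, Matrix.mul_inv_rev, ← Matrix.mul_assoc,
    Matrix.mul_nonsing_inv _ (hφ.isUnit_det x), Matrix.one_mul]

theorem jacobian_conj_inv_pullback {φ : R4 → R4} (hφ : IsSmoothImmersion φ) {g : MetricField}
    (x : R4) : jacobian φ x * (pullback φ g x)⁻¹ * (jacobian φ x)ᵀ = (g (φ x))⁻¹ := by
  have h : IsUnit ((jacobian φ x)ᵀ).det := by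
    rw [Matrix.det_transpose]; exact hφ.isUnit_det x
  rw [jacobian_mul_inv_pullback hφ, Matrix.mul_assoc, Matrix.nonsing_inv_mul _ h, Matrix.mul_one]

/-- The transformation law of Christoffel symbols. -/
theorem jacobian_christoffel_pullback {φ : R4 → R4} (hφ : IsSmoothImmersion φ) {g : MetricField}
    (hg : IsSmoothMetric g) (a i j : Fin 4) (x : R4) :
    ∑ k, jacobian φ x a k * christoffel (pullback φ g) k i j x
      = partialDeriv i (fun y => jacobian φ y a j) x
        + ∑ b, ∑ c, christoffel g a b c (φ x) * jacobian φ x b i * jacobian φ x c j := by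
  set J := jacobian φ x with hJ
  set H : Fin 4 → Fin 4 → Fin 4 → ℝ := fun a i j => partialDeriv i (fun y => jacobian φ y a j) x
    with hH
  set G := g (φ x) with hG
  set d : Fin 4 → Fin 4 → Fin 4 → ℝ := fun c a b => partialDeriv c (fun y => g y a b) (φ x) with hd
  have hHs : ∀ a i j, H a i j = H a j i := fun a i j => hφ.partialDeriv_jacobian_symm x a i j
  have hGs : ∀ a b, G a b = G b a := hg.symm _
  have hds : ∀ c a b, d c a b = d c b a := by
    intro c a b
    have : (fun y => g y a b) = fun y => g y b a := funext fun y => hg.symm y a b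
    simp only [hd, this]
  have hdp : ∀ i j l, partialDeriv i (fun y => pullback φ g y j l) x
      = ∑ a, ∑ b, (H a i j * G a b * J b l + J a j * G a b * H b i l)
        + ∑ a, ∑ b, ∑ c, J c i * d c a b * J a j * J b l := by
    intro i j l
    have e : (fun y => pullback φ g y j l)
        = fun y => ∑ a, ∑ b, jacobian φ y a j * g (φ y) a b * jacobian φ y b l := by
      funext y
      simp only [pullback_eq, Matrix.mul_apply, Matrix.transpose_apply, Finset.sum_mul]
      exact Finset.sum_comm
    have hGd : ∀ a b, ContDiff ℝ ∞ fun y => g (φ y) a b := fun a b =>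
      (hg.smooth a b).comp hφ.smooth
    have h1 : ∀ a b, ContDiff ℝ ∞ fun y => jacobian φ y a j * g (φ y) a b := fun a b =>
      (hφ.contDiff_jacobian a j).mul (hGd a b)
    have h2 : ∀ a b, ContDiff ℝ ∞ fun y => jacobian φ y a j * g (φ y) a b * jacobian φ y b l :=
      fun a b => (h1 a b).mul (hφ.contDiff_jacobian b l)
    rw [e, partialDeriv_sum _ fun a _ =>
      ContDiff.differentiableAt' (ContDiff.sum fun b _ => h2 a b) x, ← Finset.sum_add_distrib]
    refine Finset.sum_congr rfl fun a _ => ?_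
    rw [partialDeriv_sum _ fun b _ => ContDiff.differentiableAt' (h2 a b) x,
      ← Finset.sum_add_distrib]
    refine Finset.sum_congr rfl fun b _ => ?_
    rw [partialDeriv_mul (ContDiff.differentiableAt' (h1 a b) x)
        (ContDiff.differentiableAt' (hφ.contDiff_jacobian b l) x),
      partialDeriv_mul (ContDiff.differentiableAt' (hφ.contDiff_jacobian a j) x)
        (ContDiff.differentiableAt' (hGd a b) x), hφ.partialDeriv_comp (hg.smooth a b) i x]
    have e3 : ∑ c, J c i * d c a b * J a j * J b l
        = (∑ m, jacobian φ x m i * partialDeriv m (fun y => g y a b) (φ x)) * J a j * J b l := by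
      simp only [Finset.sum_mul, hJ, hd]
    rw [e3]
    simp only [hH, hJ, hG]
    ring
  -- the Christoffel symbols of the first kind
  have hL : ∀ l, partialDeriv i (fun y => pullback φ g y j l) x
        + partialDeriv j (fun y => pullback φ g y i l) x
        - partialDeriv l (fun y => pullback φ g y i j) x
      = (Jᵀ *ᵥ fun e => 2 * ∑ a, G e a * H a i j
          + ∑ b, ∑ c, (d b c e + d c b e - d e b c) * J b i * J c j) l := by
    intro l
    rw [hdp, hdp, hdp]
    have r : (Jᵀ *ᵥ fun e => 2 * ∑ a, G e a * H a i j
          + ∑ b, ∑ c, (d b c e + d c b e - d e b c) * J b i * J c j) l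
        = ∑ e, ∑ a, 2 * (J e l * G e a * H a i j)
          + (∑ e, ∑ b, ∑ c, J e l * d b c e * J b i * J c j
            + ∑ e, ∑ b, ∑ c, J e l * d c b e * J b i * J c j
            - ∑ e, ∑ b, ∑ c, J e l * d e b c * J b i * J c j) := by
      simp only [Matrix.mulVec, dotProduct, Matrix.transpose_apply, ← Finset.sum_add_distrib,
        ← Finset.sum_sub_distrib, Finset.mul_sum, mul_add]
      refine Finset.sum_congr rfl fun e _ => Finset.sum_congr rfl fun b _ => ?_
      congr 1
      · ring
      · refine Finset.sum_congr rfl fun c _ => ?_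
        ring
    rw [r]
    have s2 : ∀ F F' : Fin 4 → Fin 4 → ℝ, (∀ a b, F a b = F' b a) →
        ∑ a, ∑ b, F a b = ∑ a, ∑ b, F' a b := by
      intro F F' h
      rw [Finset.sum_comm]
      exact Finset.sum_congr rfl fun b _ => Finset.sum_congr rfl fun a _ => h a b
    have s3 : ∀ F : Fin 4 → Fin 4 → Fin 4 → ℝ,
        ∑ e, ∑ b, ∑ c, F e b c = ∑ c, ∑ e, ∑ b, F e b c := by
      intro F
      rw [Finset.sum_congr rfl fun e _ => Finset.sum_comm, Finset.sum_comm]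
    have t1 : ∑ e, ∑ b, ∑ c, J e l * d b c e * J b i * J c j
        = ∑ a, ∑ b, ∑ c, J c i * d c a b * J a j * J b l := by
      rw [s3]
      refine Finset.sum_congr rfl fun a _ => Finset.sum_congr rfl fun b _ =>
        Finset.sum_congr rfl fun c _ => ?_
      ring
    have t2 : ∑ e, ∑ b, ∑ c, J e l * d c b e * J b i * J c j
        = ∑ a, ∑ b, ∑ c, J c j * d c a b * J a i * J b l := by
      rw [Finset.sum_comm]
      refine Finset.sum_congr rfl fun a _ => Finset.sum_congr rfl fun b _ =>
        Finset.sum_congr rfl fun c _ => ?_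
      ring
    have t3 : ∑ e, ∑ b, ∑ c, J e l * d e b c * J b i * J c j
        = ∑ a, ∑ b, ∑ c, J c l * d c a b * J a i * J b j := by
      rw [s3 fun a b c => J c l * d c a b * J a i * J b j]
    rw [t1, t2, t3]
    have q1 : ∑ a, ∑ b, H a i j * G a b * J b l = ∑ e, ∑ a, J e l * G e a * H a i j :=
      s2 _ _ fun a b => by rw [hGs a b]; ring
    have q2 : ∑ a, ∑ b, H a j i * G a b * J b l = ∑ e, ∑ a, J e l * G e a * H a i j :=
      s2 _ _ fun a b => by rw [hGs a b, hHs a j i]; ring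
    have q3 : ∑ a, ∑ b, J a j * G a b * H b i l = ∑ a, ∑ b, H a l i * G a b * J b j :=
      s2 _ _ fun a b => by rw [hGs a b, hHs b i l]; ring
    have q4 : ∑ a, ∑ b, J a i * G a b * H b j l = ∑ a, ∑ b, J a i * G a b * H b l j :=
      Finset.sum_congr rfl fun a _ => Finset.sum_congr rfl fun b _ => by rw [hHs b j l]
    simp only [Finset.sum_add_distrib, ← Finset.mul_sum]
    rw [q1, q2, q3, q4]
    ring
  have hJu : IsUnit (Jᵀ).det := by rw [Matrix.det_transpose]; exact hφ.isUnit_det x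
  have hlhs : ∑ k, J a k * christoffel (pullback φ g) k i j x
      = 1 / 2 * ((J * (pullback φ g x)⁻¹) *ᵥ (Jᵀ *ᵥ fun e => 2 * ∑ a, G e a * H a i j
          + ∑ b, ∑ c, (d b c e + d c b e - d e b c) * J b i * J c j)) a := by
    rw [← Matrix.mulVec_mulVec]
    simp only [christoffel, hL]
    rw [Matrix.mulVec.eq_1 J, dotProduct, Finset.mul_sum]
    refine Finset.sum_congr rfl fun k _ => ?_
    rw [Matrix.mulVec.eq_1 (pullback φ g x)⁻¹, dotProduct]
    ring
  have hGu : IsUnit G.det := hg.isUnit_det _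
  rw [hlhs, hJ, jacobian_mul_inv_pullback hφ, Matrix.mulVec_mulVec, Matrix.mul_assoc,
    Matrix.nonsing_inv_mul _ hJu, Matrix.mul_one]
  have hsplit : (fun e => 2 * ∑ a, G e a * H a i j
      + ∑ b, ∑ c, (d b c e + d c b e - d e b c) * J b i * J c j)
      = G *ᵥ (fun a => 2 * H a i j)
        + fun e => ∑ b, ∑ c, (d b c e + d c b e - d e b c) * J b i * J c j := by
    funext e
    simp only [Pi.add_apply, Matrix.mulVec, dotProduct, Finset.mul_sum]
    congr 1
    exact Finset.sum_congr rfl fun a _ => by ring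
  rw [hsplit, Matrix.mulVec_add, Matrix.mulVec_mulVec, Matrix.nonsing_inv_mul _ hGu,
    Matrix.one_mulVec, Pi.add_apply, mul_add]
  congr 1
  · ring
  · simp only [Matrix.mulVec, dotProduct, christoffel, Finset.mul_sum, Finset.sum_mul]
    rw [Finset.sum_comm]
    refine Finset.sum_congr rfl fun b _ => ?_
    rw [Finset.sum_comm]
    refine Finset.sum_congr rfl fun c _ => Finset.sum_congr rfl fun e _ => ?_
    simp only [hd]
    ring

/-- Exchanging the slot `b` of `K` with the additional index is a bijection of the index set. -/
theorem sum_update_swap {k : ℕ} (b : Fin k) (F : (Fin k → Fin 4) → Fin 4 → ℝ) :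
    ∑ K : Fin k → Fin 4, ∑ d, F K d = ∑ K : Fin k → Fin 4, ∑ d, F (Function.update K b d) (K b) := by
  rw [← Fintype.sum_prod_type', ← Fintype.sum_prod_type']
  let e : ((Fin k → Fin 4) × Fin 4) ≃ ((Fin k → Fin 4) × Fin 4) :=
    { toFun := fun p => (Function.update p.1 b p.2, p.1 b)
      invFun := fun p => (Function.update p.1 b p.2, p.1 b)
      left_inv := fun p => by simp
      right_inv := fun p => by simp }
  exact (e.sum_comp fun p => F p.1 p.2).symm

/-- Covariant differentiation is natural. -/
theorem covDeriv_pullback {φ : R4 → R4} (hφ : IsSmoothImmersion φ) {g : MetricField}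
    (hg : IsSmoothMetric g) {k : ℕ} {T : TensorField k} (hT : IsSmoothTensor T) :
    covDeriv (pullback φ g) (tensorPullback φ T) = tensorPullback φ (covDeriv g T) := by
  funext x I
  obtain ⟨i, I, rfl⟩ : ∃ i I', I = Matrix.vecCons i I' := ⟨I 0, Fin.tail I, (Fin.cons_self_tail I).symm⟩
  have ht : Fin.tail (Matrix.vecCons i I) = I := Fin.tail_cons (α := fun _ => Fin 4) i I
  have hsucc : ∀ a : Fin k, Matrix.vecCons i I a.succ = I a := fun a => rfl
  have h0 : Matrix.vecCons i I 0 = i := rfl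
  set J := jacobian φ x with hJ
  set H : Fin 4 → Fin 4 → Fin 4 → ℝ := fun a i j => partialDeriv i (fun y => jacobian φ y a j) x
    with hH
  set P : Fin k → (Fin k → Fin 4) → ℝ := fun b K => ∏ a ∈ Finset.univ.erase b, J (K a) (I a) with hP
  have hPJ : ∀ b K, ∏ a, J (K a) (I a) = P b K * J (K b) (I b) := fun b K =>
    (Finset.prod_erase_mul _ _ (Finset.mem_univ b)).symm
  have hPu : ∀ b K d, P b (Function.update K b d) = P b K := by
    intro b K d
    refine Finset.prod_congr rfl fun a ha => ?_
    rw [Function.update_of_ne (Finset.ne_of_mem_erase ha)]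
  -- the partial derivatives of the components of the pulled back tensor
  have h1 : partialDeriv i (fun y => tensorPullback φ T y I) x
      = ∑ K : Fin k → Fin 4, (∑ b, P b K * H (K b) i (I b)) * T (φ x) K
        + ∑ c, J c i * ∑ K : Fin k → Fin 4, (∏ a, J (K a) (I a)) *
            partialDeriv c (fun y => T y K) (φ x) := by
    have hs1 : ∀ K : Fin k → Fin 4, ContDiff ℝ ∞ fun y => ∏ a, jacobian φ y (K a) (I a) :=
      fun K => contDiff_prod fun a _ => hφ.contDiff_jacobian _ _
    have hs2 : ∀ K : Fin k → Fin 4, ContDiff ℝ ∞ fun y => T (φ y) K := fun K =>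
      (hT K).comp hφ.smooth
    have e : (fun y => tensorPullback φ T y I)
      = fun y => ∑ K : Fin k → Fin 4, (∏ a, jacobian φ y (K a) (I a)) * T (φ y) K := rfl
    rw [e, partialDeriv_sum _ fun K _ => ContDiff.differentiableAt' ((hs1 K).mul (hs2 K)) x]
    have : ∑ c, J c i * ∑ K : Fin k → Fin 4, (∏ a, J (K a) (I a)) *
            partialDeriv c (fun y => T y K) (φ x)
        = ∑ K : Fin k → Fin 4, (∏ a, J (K a) (I a)) *
            ∑ c, J c i * partialDeriv c (fun y => T y K) (φ x) := by
      simp only [Finset.mul_sum]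
      rw [Finset.sum_comm]
      exact Finset.sum_congr rfl fun K _ => Finset.sum_congr rfl fun c _ => by ring
    rw [this, ← Finset.sum_add_distrib]
    refine Finset.sum_congr rfl fun K _ => ?_
    rw [partialDeriv_mul (ContDiff.differentiableAt' (hs1 K) x)
        (ContDiff.differentiableAt' (hs2 K) x), hφ.partialDeriv_comp (hT K) i x,
      partialDeriv_prod fun a => ContDiff.differentiableAt' (hφ.contDiff_jacobian _ _) x]
  -- the correction terms
  have h2 : ∀ b, ∑ m, christoffel (pullback φ g) m i (I b) x *
        tensorPullback φ T x (Function.update I b m)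
      = ∑ K : Fin k → Fin 4, P b K * H (K b) i (I b) * T (φ x) K
        + ∑ c, J c i * ∑ K : Fin k → Fin 4, (∏ a, J (K a) (I a)) *
            ∑ m, christoffel g m c (K b) (φ x) * T (φ x) (Function.update K b m) := by
    intro b
    have e1 : ∀ m, tensorPullback φ T x (Function.update I b m)
        = ∑ K : Fin k → Fin 4, P b K * J (K b) m * T (φ x) K := by
      intro m
      refine Finset.sum_congr rfl fun K _ => ?_
      rw [← Finset.prod_erase_mul _ _ (Finset.mem_univ b), Function.update_self]
      congr 2
      refine Finset.prod_congr rfl fun a ha => ?_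
      rw [Function.update_of_ne (Finset.ne_of_mem_erase ha)]
    have e2 : ∑ m, christoffel (pullback φ g) m i (I b) x *
        tensorPullback φ T x (Function.update I b m)
        = ∑ K : Fin k → Fin 4, P b K * T (φ x) K *
            ∑ m, J (K b) m * christoffel (pullback φ g) m i (I b) x := by
      simp only [e1, Finset.mul_sum]
      rw [Finset.sum_comm]
      exact Finset.sum_congr rfl fun K _ => Finset.sum_congr rfl fun m _ => by ring
    have e3 : ∀ K : Fin k → Fin 4, P b K * T (φ x) K *
        ∑ m, J (K b) m * christoffel (pullback φ g) m i (I b) x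
        = P b K * H (K b) i (I b) * T (φ x) K + P b K * T (φ x) K *
            ∑ c, ∑ d, christoffel g (K b) c d (φ x) * J c i * J d (I b) := by
      intro K
      rw [jacobian_christoffel_pullback hφ hg]
      ring
    rw [e2, Finset.sum_congr rfl fun K _ => e3 K, Finset.sum_add_distrib]
    congr 1
    have e4 : ∑ K : Fin k → Fin 4, P b K * T (φ x) K *
            ∑ c, ∑ d, christoffel g (K b) c d (φ x) * J c i * J d (I b)
        = ∑ c, J c i * ∑ K : Fin k → Fin 4, ∑ d, P b K * J d (I b) *
            (christoffel g (K b) c d (φ x) * T (φ x) K) := by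
      simp only [Finset.mul_sum]
      rw [Finset.sum_comm]
      exact Finset.sum_congr rfl fun c _ => Finset.sum_congr rfl fun K _ =>
        Finset.sum_congr rfl fun d _ => by ring
    rw [e4]
    refine Finset.sum_congr rfl fun c _ => ?_
    rw [sum_update_swap b]
    congr 1
    refine Finset.sum_congr rfl fun K _ => ?_
    rw [hPJ b K, Finset.mul_sum]
    refine Finset.sum_congr rfl fun d _ => ?_
    rw [hPu, Function.update_self]
  have hr : tensorPullback φ (covDeriv g T) x (Matrix.vecCons i I)
      = ∑ c, J c i * ∑ K : Fin k → Fin 4, (∏ a, J (K a) (I a)) *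
          (partialDeriv c (fun y => T y K) (φ x)
            - ∑ b, ∑ m, christoffel g m c (K b) (φ x) * T (φ x) (Function.update K b m)) :=
    tensorAct_succ _ _ _ _
  rw [hr]
  simp only [covDeriv, ht, hsucc, h0, h1, h2, mul_sub, Finset.sum_sub_distrib,
    Finset.sum_add_distrib]
  have f1 : ∑ K : Fin k → Fin 4, (∑ b, P b K * H (K b) i (I b)) * T (φ x) K
      = ∑ b, ∑ K : Fin k → Fin 4, P b K * H (K b) i (I b) * T (φ x) K := by
    rw [Finset.sum_comm]
    simp only [Finset.sum_mul]
  have f2 : ∑ b, ∑ c, J c i * ∑ K : Fin k → Fin 4, (∏ a, J (K a) (I a)) *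
            ∑ m, christoffel g m c (K b) (φ x) * T (φ x) (Function.update K b m)
      = ∑ c, J c i * ∑ K : Fin k → Fin 4, (∏ a, J (K a) (I a)) *
          ∑ b, ∑ m, christoffel g m c (K b) (φ x) * T (φ x) (Function.update K b m) := by
    rw [Finset.sum_comm]
    simp only [← Finset.mul_sum]
    refine Finset.sum_congr rfl fun c _ => ?_
    congr 1
    rw [Finset.sum_comm]
    simp only [← Finset.mul_sum]
  rw [f1, f2]
  ring

theorem covDeriv_one_apply (g : MetricField) (T : TensorField 1) (x : R4) (i j : Fin 4) :
    covDeriv g T x ![i, j]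
      = partialDeriv i (fun y => T y ![j]) x - ∑ m, christoffel g m i j x * T x ![m] := by
  have ht : Fin.tail (α := fun _ => Fin 4) ![i, j] = ![j] := Fin.tail_cons (α := fun _ => Fin 4) _ _
  have hu : ∀ m, Function.update (![j] : Fin 1 → Fin 4) 0 m = ![m] := by
    intro m; funext a; fin_cases a; simp
  have h0 : (![i, j] : Fin 2 → Fin 4) 0 = i := rfl
  have h1 : (![i, j] : Fin 2 → Fin 4) (Fin.succ 0) = j := rfl
  simp only [covDeriv, ht, Fin.sum_univ_one, hu, h0, h1]

theorem covDeriv_two_apply (g : MetricField) (T : TensorField 2) (x : R4) (i j k : Fin 4) :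
    covDeriv g T x ![i, j, k]
      = partialDeriv i (fun y => T y ![j, k]) x - (∑ m, christoffel g m i j x * T x ![m, k]
        + ∑ m, christoffel g m i k x * T x ![j, m]) := by
  have ht : Fin.tail (α := fun _ => Fin 4) ![i, j, k] = ![j, k] :=
    Fin.tail_cons (α := fun _ => Fin 4) _ _
  have hu : ∀ m, Function.update (![j, k] : Fin 2 → Fin 4) 0 m = ![m, k] := by
    intro m; funext a; fin_cases a <;> simp
  have hu' : ∀ m, Function.update (![j, k] : Fin 2 → Fin 4) 1 m = ![j, m] := by
    intro m; funext a; fin_cases a <;> simp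
  have h0 : (![i, j, k] : Fin 3 → Fin 4) 0 = i := rfl
  have h1 : (![i, j, k] : Fin 3 → Fin 4) (Fin.succ 0) = j := rfl
  have h2 : (![i, j, k] : Fin 3 → Fin 4) (Fin.succ 1) = k := rfl
  simp only [covDeriv, ht, Fin.sum_univ_two, hu, hu', h0, h1, h2]

/-- The Ricci identity for one-forms. -/
theorem covDeriv_covDeriv_sub_swap {g : MetricField} (hg : IsSmoothMetric g) {η : TensorField 1}
    (hη : IsSmoothTensor η) (x : R4) (i j k : Fin 4) :
    covDeriv g (covDeriv g η) x ![i, j, k] - covDeriv g (covDeriv g η) x ![j, i, k]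
      = -∑ l, curvatureOp g l i j k x * η x ![l] := by
  have hd : ∀ i j, partialDeriv i (fun y => covDeriv g η y ![j, k]) x
      = partialDeriv i (partialDeriv j (fun y => η y ![k])) x
        - ∑ m, (partialDeriv i (christoffel g m j k) x * η x ![m]
          + christoffel g m j k x * partialDeriv i (fun y => η y ![m]) x) := by
    intro i j
    have e : (fun y => covDeriv g η y ![j, k]) = fun y => partialDeriv j (fun y => η y ![k]) y
        - ∑ m, christoffel g m j k y * η y ![m] := funext fun y => covDeriv_one_apply g η y j k
    have s1 := fun m => (hg.christoffel m j k).mul (hη ![m])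
    rw [e, partialDeriv_sub (ContDiff.differentiableAt' (contDiff_partialDeriv (hη _) _) x)
        (ContDiff.differentiableAt' (ContDiff.sum fun m _ => s1 m) x),
      partialDeriv_sum _ fun m _ => ContDiff.differentiableAt' (s1 m) x]
    congr 1
    refine Finset.sum_congr rfl fun m _ => ?_
    exact partialDeriv_mul (ContDiff.differentiableAt' (hg.christoffel m j k) x)
      (ContDiff.differentiableAt' (hη _) x) i
  rw [covDeriv_two_apply, covDeriv_two_apply, hd, hd, partialDeriv_comm (hη ![k]) i j]
  simp only [covDeriv_one_apply, fun m => christoffel_symm hg m j i x]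
  have hq : ∑ l, curvatureOp g l i j k x * η x ![l]
      = ∑ l, (partialDeriv i (christoffel g l j k) x * η x ![l]
        - partialDeriv j (christoffel g l i k) x * η x ![l])
        + (∑ m, christoffel g m j k x * ∑ l, christoffel g l i m x * η x ![l]
          - ∑ m, christoffel g m i k x * ∑ l, christoffel g l j m x * η x ![l]) := by
    simp only [curvatureOp, Finset.mul_sum, add_mul, sub_mul, Finset.sum_mul,
      Finset.sum_add_distrib, Finset.sum_sub_distrib]
    congr 1
    congr 1
    · rw [Finset.sum_comm]
      exact Finset.sum_congr rfl fun m _ => Finset.sum_congr rfl fun l _ => by ring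
    · rw [Finset.sum_comm]
      exact Finset.sum_congr rfl fun m _ => Finset.sum_congr rfl fun l _ => by ring
  rw [hq]
  simp only [mul_sub, Finset.sum_add_distrib, Finset.sum_sub_distrib]
  ring

theorem tensorPullback_one_apply (φ : R4 → R4) (T : TensorField 1) (x : R4) (i : Fin 4) :
    tensorPullback φ T x ![i] = ∑ a, jacobian φ x a i * T (φ x) ![a] := by
  rw [tensorPullback, tensorAct_succ]
  simp only [tensorAct_zero_rank]

/-- The transformation law of the curvature operator. It follows from the Ricci identity for a
coordinate one-form, since covariant derivatives are natural. -/
theorem curvatureOp_pullback {φ : R4 → R4} (hφ : IsSmoothImmersion φ) {g : MetricField}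
    (hg : IsSmoothMetric g) (c i j k : Fin 4) (x : R4) :
    ∑ l, jacobian φ x c l * curvatureOp (pullback φ g) l i j k x
      = ∑ a, jacobian φ x a i * ∑ b, jacobian φ x b j * ∑ e, jacobian φ x e k *
          curvatureOp g c a b e (φ x) := by
  set η : TensorField 1 := fun _ I => if I 0 = c then 1 else 0 with hη
  have hs : IsSmoothTensor η := fun I => contDiff_const
  have h1 := covDeriv_covDeriv_sub_swap (hg.pullback hφ) (hs.pullback hφ) x i j k
  rw [covDeriv_pullback hφ hg hs, covDeriv_pullback hφ hg (hs.covDeriv hg)] at h1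
  have h2 : ∀ l, tensorPullback φ η x ![l] = jacobian φ x c l := by
    intro l
    simp [tensorPullback_one_apply, hη]
  have h3 := fun a b e => covDeriv_covDeriv_sub_swap hg hs (φ x) a b e
  have h4 : ∀ a b e, ∑ l, curvatureOp g l a b e (φ x) * η (φ x) ![l]
      = curvatureOp g c a b e (φ x) := by
    intro a b e; simp [hη]
  simp only [h4] at h3
  simp only [h2] at h1
  have h5 : ∀ i j k, tensorPullback φ (covDeriv g (covDeriv g η)) x ![i, j, k]
      = ∑ a, jacobian φ x a i * ∑ b, jacobian φ x b j * ∑ e, jacobian φ x e k *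
        covDeriv g (covDeriv g η) (φ x) ![a, b, e] := by
    intro i j k
    rw [tensorPullback, tensorAct_succ]
    simp only [tensorAct_succ, tensorAct_zero_rank]
  rw [h5, h5] at h1
  have h6 : ∑ a, jacobian φ x a j * ∑ b, jacobian φ x b i * ∑ e, jacobian φ x e k *
        covDeriv g (covDeriv g η) (φ x) ![a, b, e]
      = ∑ a, jacobian φ x a i * ∑ b, jacobian φ x b j * ∑ e, jacobian φ x e k *
        covDeriv g (covDeriv g η) (φ x) ![b, a, e] := by
    simp only [Finset.mul_sum]
    rw [Finset.sum_comm]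
    exact Finset.sum_congr rfl fun a _ => Finset.sum_congr rfl fun b _ =>
      Finset.sum_congr rfl fun e _ => by ring
  rw [h6] at h1
  have h7 : ∀ a b e, curvatureOp g c a b e (φ x) = covDeriv g (covDeriv g η) (φ x) ![b, a, e]
      - covDeriv g (covDeriv g η) (φ x) ![a, b, e] := fun a b e => by linarith [h3 a b e]
  simp only [h7, mul_sub, Finset.sum_sub_distrib]
  have h8 : ∑ l, jacobian φ x c l * curvatureOp (pullback φ g) l i j k x
      = ∑ l, curvatureOp (pullback φ g) l i j k x * jacobian φ x c l :=
    Finset.sum_congr rfl fun l _ => mul_comm _ _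
  rw [h8]
  linarith

theorem vec_two_eta (I : Fin 2 → Fin 4) : I = ![I 0, I 1] := by
  funext a; fin_cases a <;> rfl

theorem vec_four_eta (I : Fin 4 → Fin 4) : I = ![I 0, I 1, I 2, I 3] := by
  funext a; fin_cases a <;> rfl

theorem riemann_pullback {φ : R4 → R4} (hφ : IsSmoothImmersion φ) {g : MetricField}
    (hg : IsSmoothMetric g) : riemann (pullback φ g) = tensorPullback φ (riemann g) := by
  funext x I
  rw [vec_four_eta I]
  generalize I 0 = i
  generalize I 1 = j
  generalize I 2 = k
  generalize I 3 = l
  have hr : tensorPullback φ (riemann g) x ![i, j, k, l]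
      = ∑ a, jacobian φ x a i * ∑ b, jacobian φ x b j * ∑ c, jacobian φ x c k *
        ∑ e, jacobian φ x e l * ∑ m, g (φ x) c m * curvatureOp g m a b e (φ x) := by
    rw [tensorPullback, tensorAct_succ]
    simp only [tensorAct_succ, tensorAct_zero_rank]
    rfl
  rw [hr]
  have hl : riemann (pullback φ g) x ![i, j, k, l]
      = ∑ c, jacobian φ x c k * ∑ n, g (φ x) c n *
          ∑ m, jacobian φ x n m * curvatureOp (pullback φ g) m i j l x := by
    change ∑ m, pullback φ g x k m * curvatureOp (pullback φ g) m i j l x = _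
    simp only [pullback_eq, Matrix.mul_apply, Matrix.transpose_apply, Finset.sum_mul,
      Finset.mul_sum]
    rw [Finset.sum_congr rfl fun m _ => Finset.sum_comm, Finset.sum_comm]
    refine Finset.sum_congr rfl fun c _ => ?_
    rw [Finset.sum_comm]
    exact Finset.sum_congr rfl fun n _ => Finset.sum_congr rfl fun m _ => by ring
  rw [hl]
  simp only [curvatureOp_pullback hφ hg, Finset.mul_sum]
  -- both sides are the same sum over `a b c e n`, in different orders
  have e1 : ∀ F : Fin 4 → Fin 4 → Fin 4 → Fin 4 → Fin 4 → ℝ,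
      ∑ c, ∑ n, ∑ a, ∑ b, ∑ e, F a b c e n = ∑ a, ∑ b, ∑ c, ∑ e, ∑ n, F a b c e n := by
    intro F
    calc ∑ c, ∑ n, ∑ a, ∑ b, ∑ e, F a b c e n
        = ∑ c, ∑ a, ∑ n, ∑ b, ∑ e, F a b c e n :=
          Finset.sum_congr rfl fun c _ => Finset.sum_comm
      _ = ∑ a, ∑ c, ∑ n, ∑ b, ∑ e, F a b c e n := Finset.sum_comm
      _ = ∑ a, ∑ c, ∑ b, ∑ n, ∑ e, F a b c e n := Finset.sum_congr rfl fun a _ =>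
          Finset.sum_congr rfl fun c _ => Finset.sum_comm
      _ = ∑ a, ∑ b, ∑ c, ∑ n, ∑ e, F a b c e n := Finset.sum_congr rfl fun a _ =>
          Finset.sum_comm
      _ = ∑ a, ∑ b, ∑ c, ∑ e, ∑ n, F a b c e n := Finset.sum_congr rfl fun a _ =>
          Finset.sum_congr rfl fun b _ => Finset.sum_congr rfl fun c _ => Finset.sum_comm
  rw [e1]
  exact Finset.sum_congr rfl fun a _ => Finset.sum_congr rfl fun b _ =>
    Finset.sum_congr rfl fun c _ => Finset.sum_congr rfl fun e _ =>
    Finset.sum_congr rfl fun n _ => by ring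

/-- The permutation taking the positions of `(k, l, i, j)` to those of `(i, k, j, l)`. -/
def interleave : Equiv.Perm (Fin 4) :=
  ⟨![2, 0, 3, 1], ![1, 3, 0, 2], by decide, by decide⟩

/-- The permutation taking the positions of `(l, q, k, p, i, j)` to those of
`(i, k, j, l, p, q)`. -/
def interleaveSix : Equiv.Perm (Fin 6) :=
  ⟨![4, 2, 5, 0, 3, 1], ![3, 5, 1, 4, 0, 2], by decide, by decide⟩

theorem ricci_eq_contract (g : MetricField) (x : R4) :
    ricci g x = contract (g x)⁻¹ (fun K => riemann g x (K ∘ interleave)) := by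
  funext I
  refine Finset.sum_congr rfl fun k _ => Finset.sum_congr rfl fun l _ => ?_
  congr 2
  funext a; fin_cases a <;> rfl

theorem scalarCurvature_eq_contract (g : MetricField) (x : R4) :
    scalarCurvature g x = contract (k := 0) (g x)⁻¹ (ricci g x) ![] := rfl

theorem ricciNormSq_eq_contract (g : MetricField) (x : R4) :
    ricciNormSq g x = contract (k := 0) (g x)⁻¹ (contract (g x)⁻¹ fun K =>
      tensorMul (ricci g x) (ricci g x) (K ∘ interleave)) ![] := by
  have h : ∀ i j k l : Fin 4, tensorMul (ricci g x) (ricci g x) (![j, l, i, k] ∘ interleave)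
      = ricci g x ![i, j] * ricci g x ![k, l] := by
    intro i j k l
    simp only [tensorMul]
    congr 2 <;> (funext a; fin_cases a <;> rfl)
  have h2 : contract (k := 0) (g x)⁻¹ (contract (g x)⁻¹ fun K =>
      tensorMul (ricci g x) (ricci g x) (K ∘ interleave)) ![]
      = ∑ i, ∑ k, (g x)⁻¹ i k * ∑ j, ∑ l, (g x)⁻¹ j l *
        tensorMul (ricci g x) (ricci g x) (![j, l, i, k] ∘ interleave) := rfl
  rw [h2]
  simp only [h, ricciNormSq, Finset.mul_sum]
  refine Finset.sum_congr rfl fun i _ => ?_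
  rw [Finset.sum_comm]
  exact Finset.sum_congr rfl fun k _ => Finset.sum_congr rfl fun j _ =>
    Finset.sum_congr rfl fun l _ => by ring

theorem curvatureRicci_eq_contract (g : MetricField) (x : R4) :
    curvatureRicci g x = contract (g x)⁻¹ (contract (g x)⁻¹ fun K =>
      tensorMul (riemann g x) (ricci g x) (K ∘ interleaveSix)) := by
  funext I
  have h : ∀ i j k l p q : Fin 4,
      tensorMul (riemann g x) (ricci g x) (![l, q, k, p, i, j] ∘ interleaveSix)
        = riemann g x ![i, k, j, l] * ricci g x ![p, q] := by
    intro i j k l p q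
    simp only [tensorMul]
    congr 2 <;> (funext a; fin_cases a <;> rfl)
  rw [vec_two_eta I]
  have h2 : contract (g x)⁻¹ (contract (g x)⁻¹ fun K =>
      tensorMul (riemann g x) (ricci g x) (K ∘ interleaveSix)) ![I 0, I 1]
      = ∑ k, ∑ p, (g x)⁻¹ k p * ∑ l, ∑ q, (g x)⁻¹ l q *
        tensorMul (riemann g x) (ricci g x) (![l, q, k, p, I 0, I 1] ∘ interleaveSix) := rfl
  have h3 : curvatureRicci g x ![I 0, I 1] = ∑ k, ∑ l, ∑ p, ∑ q, riemann g x ![I 0, k, I 1, l] *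
    ((g x)⁻¹ k p * (g x)⁻¹ l q * ricci g x ![p, q]) := rfl
  rw [h2, h3]
  simp only [h, Finset.mul_sum]
  refine Finset.sum_congr rfl fun k _ => ?_
  rw [Finset.sum_comm]
  exact Finset.sum_congr rfl fun p _ => Finset.sum_congr rfl fun l _ =>
    Finset.sum_congr rfl fun q _ => by ring

theorem ricci_pullback {φ : R4 → R4} (hφ : IsSmoothImmersion φ) {g : MetricField}
    (hg : IsSmoothMetric g) : ricci (pullback φ g) = tensorPullback φ (ricci g) := by
  funext x
  rw [ricci_eq_contract, riemann_pullback hφ hg, tensorPullback, tensorPullback, ricci_eq_contract,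
    ← contract_tensorAct (jacobian_conj_inv_pullback hφ x)]
  congr 1
  funext K
  rw [tensorAct_comp_perm]

theorem scalarCurvature_pullback {φ : R4 → R4} (hφ : IsSmoothImmersion φ) {g : MetricField}
    (hg : IsSmoothMetric g) (x : R4) :
    scalarCurvature (pullback φ g) x = scalarCurvature g (φ x) := by
  rw [scalarCurvature_eq_contract, ricci_pullback hφ hg, tensorPullback,
    contract_tensorAct (jacobian_conj_inv_pullback hφ x), tensorAct_zero_rank]
  rfl

theorem ricciNormSq_pullback {φ : R4 → R4} (hφ : IsSmoothImmersion φ) {g : MetricField}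
    (hg : IsSmoothMetric g) (x : R4) : ricciNormSq (pullback φ g) x = ricciNormSq g (φ x) := by
  rw [ricciNormSq_eq_contract, ricci_pullback hφ hg, tensorPullback, ricciNormSq_eq_contract]
  simp only [← tensorAct_tensorMul, ← tensorAct_comp_perm]
  rw [contract_tensorAct (jacobian_conj_inv_pullback hφ x),
    contract_tensorAct (jacobian_conj_inv_pullback hφ x), tensorAct_zero_rank]

theorem curvatureRicci_pullback {φ : R4 → R4} (hφ : IsSmoothImmersion φ) {g : MetricField}
    (hg : IsSmoothMetric g) :
    curvatureRicci (pullback φ g) = tensorPullback φ (curvatureRicci g) := by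
  funext x
  rw [curvatureRicci_eq_contract, ricci_pullback hφ hg, riemann_pullback hφ hg, tensorPullback,
    tensorPullback, tensorPullback, curvatureRicci_eq_contract]
  simp only [← tensorAct_tensorMul, ← tensorAct_comp_perm]
  rw [contract_tensorAct (jacobian_conj_inv_pullback hφ x),
    contract_tensorAct (jacobian_conj_inv_pullback hφ x)]

theorem laplacian_pullback {φ : R4 → R4} (hφ : IsSmoothImmersion φ) {g : MetricField}
    (hg : IsSmoothMetric g) {k : ℕ} {T : TensorField k} (hT : IsSmoothTensor T) :
    laplacian (pullback φ g) (tensorPullback φ T) = tensorPullback φ (laplacian g T) := by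
  funext x
  have h : ∀ (g : MetricField) (T : TensorField k),
      laplacian g T x = contract (g x)⁻¹ (covDeriv g (covDeriv g T) x) := fun _ _ => rfl
  have h' : laplacian g T (φ x) = contract (g (φ x))⁻¹ (covDeriv g (covDeriv g T) (φ x)) := rfl
  rw [h, covDeriv_pullback hφ hg hT, covDeriv_pullback hφ hg (hT.covDeriv hg), tensorPullback,
    tensorPullback, contract_tensorAct (jacobian_conj_inv_pullback hφ x), h']

theorem ofFun_comp (φ : R4 → R4) (f : R4 → ℝ) :
    ofFun (fun x => f (φ x)) = tensorPullback φ (ofFun f) := by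
  funext x
  rw [tensorPullback, tensorAct_zero_rank]
  rfl

theorem eulerLagrange_eq (t : ℝ) (g : MetricField) (x : R4) :
    eulerLagrange t g x = (-1 : ℝ) • laplacian g (ricci g) x
    + (2 * t + 1) • covDeriv g (covDeriv g (ofFun (scalarCurvature g))) x
    + (- (2 * t / 4) * laplacian g (ofFun (scalarCurvature g)) x ![]
      + (2 / 4) * (ricciNormSq g x + t * scalarCurvature g x ^ 2)) • (fun I => g x (I 0) (I 1))
    + (- 2 : ℝ) • curvatureRicci g x
    + (- 2 * t * scalarCurvature g x) • ricci g x := by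
  funext I
  simp only [eulerLagrange, Pi.add_apply, Pi.smul_apply, smul_eq_mul]
  ring

theorem tensorAct_metric (J G : Matrix (Fin 4) (Fin 4) ℝ) :
    tensorAct J (fun I : Fin 2 → Fin 4 => G (I 0) (I 1)) = fun I => (Jᵀ * G * J) (I 0) (I 1) := by
  funext I
  rw [vec_two_eta I, tensorAct_succ]
  simp only [tensorAct_succ, tensorAct_zero_rank, Matrix.mul_apply, Matrix.transpose_apply,
    Finset.mul_sum, Finset.sum_mul]
  rw [Finset.sum_comm]
  exact Finset.sum_congr rfl fun a _ => Finset.sum_congr rfl fun b _ => by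
    simp only [Matrix.cons_val_zero, Matrix.cons_val_one]
    ring

theorem eulerLagrange_pullback (t : ℝ) {φ : R4 → R4} (hφ : IsSmoothImmersion φ) {g : MetricField}
    (hg : IsSmoothMetric g) :
    eulerLagrange t (pullback φ g) = tensorPullback φ (eulerLagrange t g) := by
  funext x
  have hs : IsSmoothTensor (ofFun (scalarCurvature g)) := fun _ => hg.scalarCurvature
  have h1 : scalarCurvature (pullback φ g) = fun x => scalarCurvature g (φ x) :=
    funext fun x => scalarCurvature_pullback hφ hg x
  rw [eulerLagrange_eq, h1, ofFun_comp, laplacian_pullback hφ hg hs, ricci_pullback hφ hg,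
    laplacian_pullback hφ hg hg.ricci, curvatureRicci_pullback hφ hg, ricciNormSq_pullback hφ hg,
    covDeriv_pullback hφ hg hs, covDeriv_pullback hφ hg (hs.covDeriv hg), tensorPullback,
    tensorPullback, tensorPullback, tensorPullback, tensorPullback, tensorPullback,
    eulerLagrange_eq]
  simp only [tensorAct_add, tensorAct_smul, tensorAct_zero_rank, tensorAct_metric]
  rfl

theorem isCritical_pullback_iff (t : ℝ) {φ : R4 → R4} (hφ : IsSmoothImmersion φ)
    (hs : Function.Surjective φ) {g : MetricField} (hg : IsSmoothMetric g) :
    IsCritical t (pullback φ g) ↔ IsCritical t g := by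
  simp only [IsCritical, eulerLagrange_pullback t hφ hg]
  constructor
  · intro h x I
    obtain ⟨y, rfl⟩ := hs x
    exact congrFun ((tensorAct_eq_zero_iff (hφ.isUnit_det y) _).1 (funext (h y))) I
  · intro h x I
    exact congrFun ((tensorAct_eq_zero_iff (hφ.isUnit_det x) _).2 (funext (h (φ x)))) I

theorem isLocallySymmetric_pullback_iff {φ : R4 → R4} (hφ : IsSmoothImmersion φ)
    (hs : Function.Surjective φ) {g : MetricField} (hg : IsSmoothMetric g) :
    IsLocallySymmetric (pullback φ g) ↔ IsLocallySymmetric g := by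
  simp only [IsLocallySymmetric, riemann_pullback hφ hg, covDeriv_pullback hφ hg hg.riemann]
  constructor
  · intro h x I
    obtain ⟨y, rfl⟩ := hs x
    exact congrFun ((tensorAct_eq_zero_iff (hφ.isUnit_det y) _).1 (funext (h y))) I
  · intro h x I
    exact congrFun ((tensorAct_eq_zero_iff (hφ.isUnit_det x) _).2 (funext (h (φ x)))) I

theorem energy_pullback (t : ℝ) {φ : R4 → R4} (hφ : IsSmoothImmersion φ) {g : MetricField}
    (hg : IsSmoothMetric g) (x : R4) : energy t (pullback φ g) x = energy t g (φ x) := by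
  rw [energy, ricciNormSq_pullback hφ hg, scalarCurvature_pullback hφ hg, energy]

section
/-! ### Constant multiples of a metric and homotheties -/

theorem IsSmoothMetric.const_smul {g : MetricField} (hg : IsSmoothMetric g) {c : ℝ} (hc : c ≠ 0) :
    IsSmoothMetric (fun x => c • g x) where
  smooth i j := contDiff_const.mul (hg.smooth i j)
  symm x i j := congrArg (c * ·) (hg.symm x i j)
  isUnit_det x := by
    rw [Matrix.det_smul]
    exact ((isUnit_iff_ne_zero.2 hc).pow _).mul (hg.isUnit_det x)

theorem const_smul_inv {g : MetricField} (hg : IsSmoothMetric g) {c : ℝ} (hc : c ≠ 0) (x : R4) :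
    (c • g x)⁻¹ = c⁻¹ • (g x)⁻¹ :=
  Matrix.inv_eq_right_inv (by
    rw [Matrix.smul_mul, Matrix.mul_smul, Matrix.mul_nonsing_inv _ (hg.isUnit_det x), smul_smul,
      mul_inv_cancel₀ hc, one_smul])

theorem covDeriv_const_mul (g : MetricField) {k : ℕ} (a : ℝ) (T : TensorField k) (x : R4) :
    covDeriv g (fun x => a • T x) x = a • covDeriv g T x := by
  funext I
  simp only [covDeriv, Pi.smul_apply, smul_eq_mul, partialDeriv_const_mul, mul_sub, Finset.mul_sum]
  congr 1
  exact Finset.sum_congr rfl fun b _ => Finset.sum_congr rfl fun m _ => by ring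

section
variable {g : MetricField} (hg : IsSmoothMetric g) {c : ℝ} (hc : c ≠ 0)
include hg hc

theorem christoffel_const_smul (k i j : Fin 4) :
    christoffel (fun x => c • g x) k i j = christoffel g k i j := by
  funext x
  simp only [christoffel, const_smul_inv hg hc, Matrix.smul_apply, smul_eq_mul,
    partialDeriv_const_mul]
  congr 1
  refine Finset.sum_congr rfl fun l _ => ?_
  field_simp

theorem covDeriv_const_smul {k : ℕ} (T : TensorField k) :
    covDeriv (fun x => c • g x) T = covDeriv g T := by
  funext x I
  simp only [covDeriv, christoffel_const_smul hg hc]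

theorem riemann_const_smul (x : R4) : riemann (fun x => c • g x) x = c • riemann g x := by
  funext I
  simp only [riemann, curvatureOp, christoffel_const_smul hg hc, Matrix.smul_apply, smul_eq_mul,
    Pi.smul_apply, Finset.mul_sum, mul_assoc]

theorem ricci_const_smul : ricci (fun x => c • g x) = ricci g := by
  funext x I
  simp only [ricci, riemann_const_smul hg hc, const_smul_inv hg hc, Matrix.smul_apply, smul_eq_mul,
    Pi.smul_apply]
  refine Finset.sum_congr rfl fun k _ => Finset.sum_congr rfl fun l _ => ?_
  field_simp

theorem scalarCurvature_const_smul :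
    scalarCurvature (fun x => c • g x) = fun x => c⁻¹ * scalarCurvature g x := by
  funext x
  simp only [scalarCurvature, ricci_const_smul hg hc, const_smul_inv hg hc, Matrix.smul_apply,
    smul_eq_mul, Finset.mul_sum, mul_assoc]

theorem ricciNormSq_const_smul (x : R4) :
    ricciNormSq (fun x => c • g x) x = (c⁻¹) ^ 2 * ricciNormSq g x := by
  simp only [ricciNormSq, ricci_const_smul hg hc, const_smul_inv hg hc, Matrix.smul_apply,
    smul_eq_mul, Finset.mul_sum]
  refine Finset.sum_congr rfl fun i _ => Finset.sum_congr rfl fun j _ =>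
    Finset.sum_congr rfl fun k _ => Finset.sum_congr rfl fun l _ => ?_
  ring

theorem curvatureRicci_const_smul (x : R4) :
    curvatureRicci (fun x => c • g x) x = c⁻¹ • curvatureRicci g x := by
  funext I
  simp only [curvatureRicci, ricci_const_smul hg hc, riemann_const_smul hg hc,
    const_smul_inv hg hc, Matrix.smul_apply, Pi.smul_apply, smul_eq_mul, Finset.mul_sum]
  refine Finset.sum_congr rfl fun i _ => Finset.sum_congr rfl fun j _ =>
    Finset.sum_congr rfl fun k _ => Finset.sum_congr rfl fun l _ => ?_
  field_simp

theorem laplacian_const_smul {k : ℕ} (T : TensorField k) (x : R4) :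
    laplacian (fun x => c • g x) T x = c⁻¹ • laplacian g T x := by
  funext I
  simp only [laplacian, covDeriv_const_smul hg hc, const_smul_inv hg hc, Matrix.smul_apply,
    Pi.smul_apply, smul_eq_mul, Finset.mul_sum, mul_assoc]

theorem eulerLagrange_const_smul (t : ℝ) (x : R4) :
    eulerLagrange t (fun x => c • g x) x = c⁻¹ • eulerLagrange t g x := by
  have e : ofFun (fun x => c⁻¹ * scalarCurvature g x)
      = fun x => c⁻¹ • ofFun (scalarCurvature g) x := rfl
  have h1 : covDeriv g (covDeriv g (ofFun fun x => c⁻¹ * scalarCurvature g x)) x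
      = c⁻¹ • covDeriv g (covDeriv g (ofFun (scalarCurvature g))) x := by
    rw [e, funext fun y => covDeriv_const_mul g c⁻¹ (ofFun (scalarCurvature g)) y,
      covDeriv_const_mul]
  have h2 : laplacian g (ofFun fun x => c⁻¹ * scalarCurvature g x) x ![]
      = c⁻¹ * laplacian g (ofFun (scalarCurvature g)) x ![] := by
    simp only [laplacian, h1, Pi.smul_apply, smul_eq_mul, Finset.mul_sum]
    exact Finset.sum_congr rfl fun b _ => Finset.sum_congr rfl fun m _ => by ring
  rw [eulerLagrange_eq, scalarCurvature_const_smul hg hc, laplacian_const_smul hg hc,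
    laplacian_const_smul hg hc, covDeriv_const_smul hg hc, covDeriv_const_smul hg hc, h1,
    curvatureRicci_const_smul hg hc, ricciNormSq_const_smul hg hc, ricci_const_smul hg hc,
    Pi.smul_apply, h2, eulerLagrange_eq]
  funext I
  simp only [Pi.add_apply, Pi.smul_apply, smul_eq_mul, Matrix.smul_apply]
  field_simp

theorem isCritical_const_smul_iff (t : ℝ) :
    IsCritical t (fun x => c • g x) ↔ IsCritical t g := by
  simp only [IsCritical, eulerLagrange_const_smul hg hc, Pi.smul_apply, smul_eq_mul, mul_eq_zero,
    inv_eq_zero, hc, false_or]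

theorem isLocallySymmetric_const_smul_iff :
    IsLocallySymmetric (fun x => c • g x) ↔ IsLocallySymmetric g := by
  have h : riemann (fun x => c • g x) = fun x => c • riemann g x :=
    funext fun x => riemann_const_smul hg hc x
  simp only [IsLocallySymmetric, covDeriv_const_smul hg hc, h, covDeriv_const_mul,
    Pi.smul_apply, smul_eq_mul, mul_eq_zero, hc, false_or]

theorem energy_const_smul (t : ℝ) (x : R4) :
    energy t (fun x => c • g x) x = (c⁻¹) ^ 2 * energy t g x := by
  rw [energy, ricciNormSq_const_smul hg hc, scalarCurvature_const_smul hg hc, energy]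
  ring

end

theorem isSmoothImmersion_diffeomorph (φ : R4 ≃ₘ^∞⟮𝓘(ℝ, R4), 𝓘(ℝ, R4)⟯ R4) :
    IsSmoothImmersion φ where
  smooth := φ.contMDiff.contDiff
  isUnit_det x := by
    have h1 : DifferentiableAt ℝ φ x :=
      (φ.contMDiff.contDiff.differentiable (by simp)) x
    have h2 : DifferentiableAt ℝ φ.symm (φ x) :=
      (φ.symm.contMDiff.contDiff.differentiable (by simp)) (φ x)
    have h3 : (fderiv ℝ φ.symm (φ x)).comp (fderiv ℝ φ x) = ContinuousLinearMap.id ℝ R4 := by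
      rw [← fderiv_comp x h2 h1]
      have : (φ.symm : R4 → R4) ∘ φ = id := funext fun y => φ.symm_apply_apply y
      rw [this, fderiv_id]
    have h4 : jacobian φ.symm (φ x) * jacobian φ x = 1 := by
      rw [jacobian, jacobian, ← LinearMap.toMatrix'_comp, ← ContinuousLinearMap.toLinearMap_comp, h3]
      exact LinearMap.toMatrix'_id
    exact Matrix.isUnit_det_of_left_inverse h4

theorem Homothetic.isCritical_iff {g g' : MetricField} (h : Homothetic g g')
    (hg : IsSmoothMetric g) (hg' : IsSmoothMetric g') (t : ℝ) :
    IsCritical t g ↔ IsCritical t g' := by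
  obtain ⟨c, hc, φ, h⟩ := h
  rw [← isCritical_pullback_iff t (isSmoothImmersion_diffeomorph φ) φ.surjective hg', funext h,
    isCritical_const_smul_iff hg hc.ne']

theorem Homothetic.isLocallySymmetric_iff {g g' : MetricField} (h : Homothetic g g')
    (hg : IsSmoothMetric g) (hg' : IsSmoothMetric g') :
    IsLocallySymmetric g ↔ IsLocallySymmetric g' := by
  obtain ⟨c, hc, φ, h⟩ := h
  rw [← isLocallySymmetric_pullback_iff (isSmoothImmersion_diffeomorph φ) φ.surjective hg',
    funext h, isLocallySymmetric_const_smul_iff hg hc.ne']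

theorem Homothetic.energy_eq {g g' : MetricField} (h : Homothetic g g')
    (hg : IsSmoothMetric g) (hg' : IsSmoothMetric g') (t : ℝ) :
    ∃ c : ℝ, 0 < c ∧ ∀ x, ∃ y, energy t g x = c * energy t g' y := by
  obtain ⟨c, hc, φ, h⟩ := h
  refine ⟨c ^ 2, by positivity, fun x => ⟨φ x, ?_⟩⟩
  rw [← energy_pullback t (isSmoothImmersion_diffeomorph φ) hg', funext h,
    energy_const_smul hg hc.ne']
  field_simp

theorem Homothetic.trans {g g' g'' : MetricField} (h : Homothetic g g') (h' : Homothetic g' g'') :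
    Homothetic g g'' := by
  obtain ⟨c, hc, φ, h⟩ := h
  obtain ⟨d, hd, ψ, h'⟩ := h'
  refine ⟨d * c, mul_pos hd hc, φ.trans ψ, fun x => ?_⟩
  have h1 : DifferentiableAt ℝ φ x := (φ.contMDiff.contDiff.differentiable (by simp)) x
  have h2 : DifferentiableAt ℝ ψ (φ x) := (ψ.contMDiff.contDiff.differentiable (by simp)) (φ x)
  have hj : jacobian (φ.trans ψ) x = jacobian ψ (φ x) * jacobian φ x := by
    have : ((φ.trans ψ : R4 ≃ₘ^∞⟮𝓘(ℝ, R4), 𝓘(ℝ, R4)⟯ R4) : R4 → R4) = ψ ∘ φ := rfl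
    rw [this, jacobian, fderiv_comp x h2 h1, ContinuousLinearMap.toLinearMap_comp,
      LinearMap.toMatrix'_comp]
    rfl
  have h3 := h' (φ x)
  have h4 := h x
  rw [pullback_eq] at h3 h4 ⊢
  rw [hj, mul_smul, ← h4, Matrix.transpose_mul]
  have h5 : (jacobian φ x)ᵀ * (jacobian ψ (φ x))ᵀ * g'' ((φ.trans ψ) x) *
        (jacobian ψ (φ x) * jacobian φ x)
      = (jacobian φ x)ᵀ * ((jacobian ψ (φ x))ᵀ * g'' (ψ (φ x)) * jacobian ψ (φ x)) *
        jacobian φ x := by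
    simp only [Matrix.mul_assoc]
    rfl
  rw [h5, h3, Matrix.mul_smul, Matrix.smul_mul]

end

section
/-! ### Left-invariant metrics and tensors -/

/-- The block matrix with rows `(M, v)` and `(0, a)`, of a linear map of `ℝ⁴ = ℝ³ × ℝ` which
preserves `ℝ³`. -/
def blockMatrix (M : Matrix (Fin 3) (Fin 3) ℝ) (v : Fin 3 → ℝ) (a : ℝ) :
    Matrix (Fin 4) (Fin 4) ℝ :=
  Matrix.of (Fin.snoc (α := fun _ => Fin 4 → ℝ) (fun i => Fin.snoc (α := fun _ => ℝ) (M i) (v i))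
    (Fin.snoc (α := fun _ => ℝ) 0 a))

section blockMatrix
variable (M N : Matrix (Fin 3) (Fin 3) ℝ) (v w : Fin 3 → ℝ) (a b : ℝ)

theorem blockMatrix_castSucc_castSucc (i j : Fin 3) :
    blockMatrix M v a i.castSucc j.castSucc = M i j := by
  rw [blockMatrix, Matrix.of_apply, Fin.snoc_castSucc, Fin.snoc_castSucc]

theorem blockMatrix_castSucc_last (i : Fin 3) :
    blockMatrix M v a i.castSucc (Fin.last 3) = v i := by
  rw [blockMatrix, Matrix.of_apply, Fin.snoc_castSucc, Fin.snoc_last]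

theorem blockMatrix_last_castSucc (j : Fin 3) :
    blockMatrix M v a (Fin.last 3) j.castSucc = 0 := by
  rw [blockMatrix, Matrix.of_apply, Fin.snoc_last, Fin.snoc_castSucc, Pi.zero_apply]

theorem blockMatrix_last_last : blockMatrix M v a (Fin.last 3) (Fin.last 3) = a := by
  rw [blockMatrix, Matrix.of_apply, Fin.snoc_last, Fin.snoc_last]

theorem blockMatrix_mul : blockMatrix M v a * blockMatrix N w b
    = blockMatrix (M * N) (M *ᵥ w + b • v) (a * b) := by
  ext i j
  refine Fin.lastCases ?_ (fun i => ?_) i <;> refine Fin.lastCases ?_ (fun j => ?_) j <;>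
  simp only [Matrix.mul_apply, Fin.sum_univ_castSucc, blockMatrix_castSucc_castSucc,
    blockMatrix_castSucc_last, blockMatrix_last_castSucc, blockMatrix_last_last, zero_mul, mul_zero,
    Finset.sum_const_zero, zero_add, add_zero, Pi.add_apply, Pi.smul_apply, smul_eq_mul,
    Matrix.mulVec, dotProduct, mul_comm b]

theorem blockMatrix_one : blockMatrix 1 0 1 = 1 := by
  ext i j
  refine Fin.lastCases ?_ (fun i => ?_) i <;> refine Fin.lastCases ?_ (fun j => ?_) j
  · rw [blockMatrix_last_last, Matrix.one_apply_eq]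
  · rw [blockMatrix_last_castSucc, Matrix.one_apply_ne (Fin.castSucc_ne_last _).symm]
  · rw [blockMatrix_castSucc_last, Matrix.one_apply_ne (Fin.castSucc_ne_last _), Pi.zero_apply]
  · rw [blockMatrix_castSucc_castSucc, Matrix.one_apply, Matrix.one_apply]
    simp only [Fin.castSucc_inj]

theorem blockMatrix_mulVec (u : R4) : blockMatrix M v a *ᵥ u
    = Fin.snoc (α := fun _ => ℝ) (M *ᵥ Fin.init u + u (Fin.last 3) • v) (a * u (Fin.last 3)) := by
  ext i
  refine Fin.lastCases ?_ (fun i => ?_) i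
  · simp only [Matrix.mulVec, dotProduct, Fin.sum_univ_castSucc, blockMatrix_last_castSucc,
      blockMatrix_last_last, Fin.snoc_last, zero_mul, Finset.sum_const_zero, zero_add]
  · simp only [Matrix.mulVec, dotProduct, Fin.sum_univ_castSucc, blockMatrix_castSucc_castSucc,
      blockMatrix_castSucc_last, Fin.snoc_castSucc, Fin.init, Pi.add_apply, Pi.smul_apply,
      smul_eq_mul, mul_comm (v i)]

theorem blockMatrix_transpose : (blockMatrix M 0 a)ᵀ = blockMatrix Mᵀ 0 a := by
  ext i j
  refine Fin.lastCases ?_ (fun i => ?_) i <;> refine Fin.lastCases ?_ (fun j => ?_) j <;>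
  simp only [Matrix.transpose_apply, blockMatrix_castSucc_castSucc, blockMatrix_castSucc_last,
    blockMatrix_last_castSucc, blockMatrix_last_last, Pi.zero_apply]

end blockMatrix

/-- The one-parameter group `exp(sD)` of matrices. -/
def expFlow (D : Matrix (Fin 3) (Fin 3) ℝ) (s : ℝ) : Matrix (Fin 3) (Fin 3) ℝ :=
  NormedSpace.exp (s • D)

theorem expFlow_zero (D : Matrix (Fin 3) (Fin 3) ℝ) : expFlow D 0 = 1 := by
  rw [expFlow, zero_smul, NormedSpace.exp_zero]

theorem expFlow_add (D : Matrix (Fin 3) (Fin 3) ℝ) (s r : ℝ) :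
    expFlow D (s + r) = expFlow D s * expFlow D r := exp_add_smul D s r

theorem expFlow_neg_mul (D : Matrix (Fin 3) (Fin 3) ℝ) (s : ℝ) :
    expFlow D (-s) * expFlow D s = 1 := by
  rw [← expFlow_add, neg_add_cancel, expFlow_zero]

open scoped Matrix.Norms.Operator in
theorem contDiff_expFlow (D : Matrix (Fin 3) (Fin 3) ℝ) (i j : Fin 3) :
    ContDiff ℝ ∞ fun s => expFlow D s i j := by
  have h1 : ContDiff ℝ ∞ (NormedSpace.exp : Matrix (Fin 3) (Fin 3) ℝ → _) :=
    AnalyticOnNhd.contDiff fun x _ => NormedSpace.exp_analytic (𝕂 := ℝ) x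
  have h2 : ContDiff ℝ ∞ fun s : ℝ => NormedSpace.exp (s • D) :=
    h1.comp (contDiff_id.smul contDiff_const)
  have h3 := (LinearMap.toContinuousLinearMap
    (Matrix.entryLinearMap ℝ ℝ i j : Matrix (Fin 3) (Fin 3) ℝ →ₗ[ℝ] ℝ)).contDiff (n := ∞)
  exact h3.comp h2

open scoped Matrix.Norms.Operator in
theorem hasDerivAt_expFlow (D : Matrix (Fin 3) (Fin 3) ℝ) (s : ℝ) (i j : Fin 3) :
    HasDerivAt (fun s => expFlow D s i j) ((D * expFlow D s) i j) s := by
  have h1 : HasDerivAt (fun s : ℝ => NormedSpace.exp (s • D)) (D * NormedSpace.exp (s • D)) s :=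
    hasDerivAt_exp_smul_const' (𝕂 := ℝ) D s
  have h3 := (LinearMap.toContinuousLinearMap
    (Matrix.entryLinearMap ℝ ℝ i j : Matrix (Fin 3) (Fin 3) ℝ →ₗ[ℝ] ℝ)).hasFDerivAt.comp_hasDerivAt
      s h1
  exact h3

/-- The matrix of the differential of a left translation of `ℝ ⋉_D ℝ³` by an element with last
coordinate `s`. -/
def translationMatrix (D : Matrix (Fin 3) (Fin 3) ℝ) (s : ℝ) : Matrix (Fin 4) (Fin 4) ℝ :=
  blockMatrix (expFlow D s) 0 1

theorem translationMatrix_zero (D : Matrix (Fin 3) (Fin 3) ℝ) : translationMatrix D 0 = 1 := by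
  rw [translationMatrix, expFlow_zero, blockMatrix_one]

theorem translationMatrix_add (D : Matrix (Fin 3) (Fin 3) ℝ) (s r : ℝ) :
    translationMatrix D (s + r) = translationMatrix D s * translationMatrix D r := by
  simp [translationMatrix, blockMatrix_mul, expFlow_add]

theorem isUnit_det_translationMatrix (D : Matrix (Fin 3) (Fin 3) ℝ) (s : ℝ) :
    IsUnit (translationMatrix D s).det :=
  Matrix.isUnit_det_of_left_inverse (B := translationMatrix D (-s)) (by
    rw [← translationMatrix_add, neg_add_cancel, translationMatrix_zero])

theorem semiMul_last (D : Matrix (Fin 3) (Fin 3) ℝ) (p q : R4) :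
    semiMul D p q (Fin.last 3) = p (Fin.last 3) + q (Fin.last 3) := by
  rw [semiMul, Fin.snoc_last]

theorem semiInv_last (D : Matrix (Fin 3) (Fin 3) ℝ) (p : R4) :
    semiInv D p (Fin.last 3) = -p (Fin.last 3) := by
  rw [semiInv, Fin.snoc_last]

theorem semiMul_eq_mulVec (D : Matrix (Fin 3) (Fin 3) ℝ) (p q : R4) :
    semiMul D p q = p + translationMatrix D (p (Fin.last 3)) *ᵥ q := by
  obtain ⟨L, hL, h⟩ := mul_eq_affine D p
  rw [h, hL, translationMatrix, blockMatrix_mulVec, smul_zero, add_zero, one_mul]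
  rfl

theorem jacobian_affine (M : Matrix (Fin 4) (Fin 4) ℝ) (p q : R4) :
    jacobian (fun x => p + M *ᵥ x) q = M := by
  have h : (fun x : R4 => p + M *ᵥ x) = fun x => p + (Matrix.toLin' M).toContinuousLinearMap x := rfl
  rw [jacobian, h, fderiv_const_add, ContinuousLinearMap.fderiv]
  exact LinearMap.toMatrix'_toLin' M

theorem jacobian_semiMul (D : Matrix (Fin 3) (Fin 3) ℝ) (p q : R4) :
    jacobian (semiMul D p) q = translationMatrix D (p (Fin.last 3)) := by
  rw [funext fun x => semiMul_eq_mulVec D p x, jacobian_affine]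

theorem isSmoothImmersion_semiMul (D : Matrix (Fin 3) (Fin 3) ℝ) (p : R4) :
    IsSmoothImmersion (semiMul D p) where
  smooth := by
    rw [funext fun x => semiMul_eq_mulVec D p x]
    exact contDiff_const.add
      (Matrix.toLin' (translationMatrix D (p (Fin.last 3)))).toContinuousLinearMap.contDiff
  isUnit_det q := by
    rw [jacobian_semiMul]; exact isUnit_det_translationMatrix _ _

theorem leftInvariantMetric_apply (D : Matrix (Fin 3) (Fin 3) ℝ) (Q : Matrix (Fin 4) (Fin 4) ℝ)
    (p : R4) : leftInvariantMetric D Q p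
      = (translationMatrix D (-p (Fin.last 3)))ᵀ * Q * translationMatrix D (-p (Fin.last 3)) := by
  rw [leftInvariantMetric, pullback_eq, jacobian_semiMul, semiInv_last]

theorem contDiff_translationMatrix (D : Matrix (Fin 3) (Fin 3) ℝ) (i j : Fin 4) :
    ContDiff ℝ ∞ fun p : R4 => translationMatrix D (-p (Fin.last 3)) i j := by
  have h : ContDiff ℝ ∞ fun p : R4 => -p (Fin.last 3) := (contDiff_apply ℝ ℝ (Fin.last 3)).neg
  refine Fin.lastCases ?_ (fun i => ?_) i <;> refine Fin.lastCases ?_ (fun j => ?_) j <;>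
  simp only [translationMatrix, blockMatrix_castSucc_castSucc, blockMatrix_castSucc_last,
    blockMatrix_last_castSucc, blockMatrix_last_last]
  · exact contDiff_const
  · exact contDiff_const
  · exact contDiff_const
  · exact (contDiff_expFlow D i j).comp h

theorem isSmoothMetric_leftInvariantMetric (D : Matrix (Fin 3) (Fin 3) ℝ)
    {Q : Matrix (Fin 4) (Fin 4) ℝ} (hQ : Q.PosDef) : IsSmoothMetric (leftInvariantMetric D Q) where
  smooth i j := by
    simp only [leftInvariantMetric_apply, Matrix.mul_apply, Matrix.transpose_apply]
    exact ContDiff.sum fun b _ => (ContDiff.sum fun a _ => (contDiff_translationMatrix D _ _).mul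
      contDiff_const).mul (contDiff_translationMatrix D _ _)
  symm x i j := by
    have hs : Qᵀ = Q := hQ.isHermitian
    have h : (leftInvariantMetric D Q x)ᵀ = leftInvariantMetric D Q x := by
      rw [leftInvariantMetric_apply]
      simp only [Matrix.transpose_mul, Matrix.transpose_transpose, hs, Matrix.mul_assoc]
    exact congrFun (congrFun h j) i
  isUnit_det x := by
    rw [leftInvariantMetric_apply, Matrix.det_mul, Matrix.det_mul, Matrix.det_transpose]
    exact ((isUnit_det_translationMatrix _ _).mul hQ.det_pos.ne'.isUnit).mul
      (isUnit_det_translationMatrix _ _)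

/-- A tensor field invariant under the left translations of `ℝ ⋉_D ℝ³`. -/
def IsLeftInvariant (D : Matrix (Fin 3) (Fin 3) ℝ) {k : ℕ} (T : TensorField k) : Prop :=
  ∀ p, tensorPullback (semiMul D p) T = T

/-- The left-invariant tensor field with value `T` at the identity. -/
def leftInvariantExtension (D : Matrix (Fin 3) (Fin 3) ℝ) {k : ℕ} (T : Tensor k) : TensorField k :=
  fun x => tensorAct (translationMatrix D (-x (Fin.last 3))) T

theorem isLeftInvariant_extension (D : Matrix (Fin 3) (Fin 3) ℝ) {k : ℕ} (T : Tensor k) :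
    IsLeftInvariant D (leftInvariantExtension D T) := by
  intro p
  funext x
  rw [tensorPullback, leftInvariantExtension, tensorAct_tensorAct, jacobian_semiMul, semiMul_last,
    ← translationMatrix_add, leftInvariantExtension]
  congr 2
  ring

theorem leftInvariantExtension_zero (D : Matrix (Fin 3) (Fin 3) ℝ) {k : ℕ} (T : Tensor k) :
    leftInvariantExtension D T 0 = T := by
  rw [leftInvariantExtension, Pi.zero_apply, neg_zero, translationMatrix_zero, tensorAct_one]

theorem isSmoothTensor_extension (D : Matrix (Fin 3) (Fin 3) ℝ) {k : ℕ} (T : Tensor k) :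
    IsSmoothTensor (leftInvariantExtension D T) := fun _ =>
  ContDiff.sum fun _ _ =>
    (contDiff_prod fun _ _ => contDiff_translationMatrix D _ _).mul contDiff_const

theorem IsLeftInvariant.eq_extension {D : Matrix (Fin 3) (Fin 3) ℝ} {k : ℕ} {T : TensorField k}
    (hT : IsLeftInvariant D T) : T = leftInvariantExtension D (T 0) := by
  funext x
  have h := congrFun (hT (semiInv D x)) x
  rw [tensorPullback, jacobian_semiMul, semiInv_last, semiInv_semiMul] at h
  exact h.symm

/-- A left-invariant tensor field vanishes if it vanishes at the identity. -/
theorem IsLeftInvariant.eq_zero_iff {D : Matrix (Fin 3) (Fin 3) ℝ} {k : ℕ} {T : TensorField k}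
    (hT : IsLeftInvariant D T) : (∀ x I, T x I = 0) ↔ ∀ I, T 0 I = 0 := by
  refine ⟨fun h => h 0, fun h x I => ?_⟩
  rw [hT.eq_extension, leftInvariantExtension, show T 0 = 0 from funext h, tensorAct_zero,
    Pi.zero_apply]

section
variable {D : Matrix (Fin 3) (Fin 3) ℝ} {Q : Matrix (Fin 4) (Fin 4) ℝ} (hQ : Q.PosDef)
include hQ

theorem isLeftInvariant_covDeriv {k : ℕ} {T : TensorField k} (hT : IsLeftInvariant D T)
    (hs : IsSmoothTensor T) : IsLeftInvariant D (covDeriv (leftInvariantMetric D Q) T) := by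
  intro p
  rw [← covDeriv_pullback (isSmoothImmersion_semiMul D p) (isSmoothMetric_leftInvariantMetric D hQ)
    hs, hT p, funext fun q => pullback_leftInvariantMetric D Q p q]

theorem isLeftInvariant_riemann : IsLeftInvariant D (riemann (leftInvariantMetric D Q)) := by
  intro p
  rw [← riemann_pullback (isSmoothImmersion_semiMul D p) (isSmoothMetric_leftInvariantMetric D hQ),
    funext fun q => pullback_leftInvariantMetric D Q p q]

theorem isLeftInvariant_ricci : IsLeftInvariant D (ricci (leftInvariantMetric D Q)) := by
  intro p
  rw [← ricci_pullback (isSmoothImmersion_semiMul D p) (isSmoothMetric_leftInvariantMetric D hQ),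
    funext fun q => pullback_leftInvariantMetric D Q p q]

theorem isLeftInvariant_eulerLagrange (t : ℝ) :
    IsLeftInvariant D (eulerLagrange t (leftInvariantMetric D Q)) := by
  intro p
  rw [← eulerLagrange_pullback t (isSmoothImmersion_semiMul D p)
    (isSmoothMetric_leftInvariantMetric D hQ),
    funext fun q => pullback_leftInvariantMetric D Q p q]

theorem scalarCurvature_leftInvariantMetric (x : R4) :
    scalarCurvature (leftInvariantMetric D Q) x = scalarCurvature (leftInvariantMetric D Q) 0 := by
  have h := scalarCurvature_pullback (isSmoothImmersion_semiMul D (semiInv D x))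
    (isSmoothMetric_leftInvariantMetric D hQ) x
  rwa [funext fun q => pullback_leftInvariantMetric D Q (semiInv D x) q, semiInv_semiMul] at h

theorem energy_leftInvariantMetric (t : ℝ) (x : R4) :
    energy t (leftInvariantMetric D Q) x = energy t (leftInvariantMetric D Q) 0 := by
  have h := energy_pullback t (isSmoothImmersion_semiMul D (semiInv D x))
    (isSmoothMetric_leftInvariantMetric D hQ) x
  rwa [funext fun q => pullback_leftInvariantMetric D Q (semiInv D x) q, semiInv_semiMul] at h

theorem isCritical_leftInvariantMetric_iff (t : ℝ) : IsCritical t (leftInvariantMetric D Q) ↔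
    ∀ I, eulerLagrange t (leftInvariantMetric D Q) 0 I = 0 :=
  (isLeftInvariant_eulerLagrange hQ t).eq_zero_iff

theorem isLocallySymmetric_leftInvariantMetric_iff : IsLocallySymmetric (leftInvariantMetric D Q) ↔
    ∀ I, covDeriv (leftInvariantMetric D Q) (riemann (leftInvariantMetric D Q)) 0 I = 0 :=
  (isLeftInvariant_covDeriv hQ (isLeftInvariant_riemann hQ)
    (isSmoothMetric_leftInvariantMetric D hQ).riemann).eq_zero_iff

end

/-- The derivation of the Lie algebra `ℝ ⋉_D ℝ³` given by the bracket with the last basis vector. -/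
def adLast (D : Matrix (Fin 3) (Fin 3) ℝ) : Matrix (Fin 4) (Fin 4) ℝ := blockMatrix D 0 0

theorem partialDeriv_translationMatrix (D : Matrix (Fin 3) (Fin 3) ℝ) (i a b : Fin 4) :
    partialDeriv i (fun p : R4 => translationMatrix D (-p (Fin.last 3)) a b) 0
      = if i = Fin.last 3 then -adLast D a b else 0 := by
  have hd : HasDerivAt (fun s => translationMatrix D s a b) (adLast D a b) 0 := by
    have hc := fun i j => hasDerivAt_expFlow D 0 i j
    rw [expFlow_zero, Matrix.mul_one] at hc
    refine Fin.lastCases ?_ (fun i => ?_) a <;> refine Fin.lastCases ?_ (fun j => ?_) b <;>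
    simp only [translationMatrix, adLast, blockMatrix_castSucc_castSucc, blockMatrix_castSucc_last,
      blockMatrix_last_castSucc, blockMatrix_last_last]
    · exact hasDerivAt_const _ _
    · exact hasDerivAt_const _ _
    · exact hasDerivAt_const _ _
    · exact hc i j
  have hl : HasFDerivAt (fun p : R4 => -p (Fin.last 3))
      (-(ContinuousLinearMap.proj (R := ℝ) (φ := fun _ : Fin 4 => ℝ) (Fin.last 3))) (0 : R4) :=
    (hasFDerivAt_apply (Fin.last 3) (0 : R4)).neg
  have h0 : -(0 : R4) (Fin.last 3) = 0 := neg_zero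
  have h := HasDerivAt.comp_hasFDerivAt (f := fun p : R4 => -p (Fin.last 3)) (0 : R4)
    (h₂ := fun s => translationMatrix D s a b) (h₂' := adLast D a b) (by rw [h0]; exact hd) hl
  have h2 : HasFDerivAt (fun p : R4 => translationMatrix D (-p (Fin.last 3)) a b) _ 0 := h
  rw [partialDeriv, h2.fderiv]
  by_cases hi : i = Fin.last 3
  · subst hi
    rw [if_pos rfl]
    simp [-Fin.reduceLast]
  · rw [if_neg hi]
    have : (Pi.single i 1 : R4) (Fin.last 3) = 0 := Pi.single_eq_of_ne (Ne.symm hi) _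
    simp [-Fin.reduceLast, this]

/-- A tensor of which all slots but the slot `b` are acted on by the identity. -/
theorem sum_prod_erase_one {k : ℕ} (I : Fin k → Fin 4) (b : Fin k) (F : (Fin k → Fin 4) → ℝ) :
    ∑ K : Fin k → Fin 4, (∏ a ∈ Finset.univ.erase b, (1 : Matrix (Fin 4) (Fin 4) ℝ) (K a) (I a)) * F K
      = ∑ m, F (Function.update I b m) := by
  have hinj : Function.Injective fun m => Function.update I b m := Function.update_injective I b
  rw [← Finset.sum_image (s := Finset.univ) (g := fun m => Function.update I b m)
    (f := F) hinj.injOn]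
  rw [← Finset.sum_subset (Finset.subset_univ (Finset.univ.image fun m => Function.update I b m))
    fun K _ hK => ?_]
  · refine Finset.sum_congr rfl fun K hK => ?_
    obtain ⟨m, -, rfl⟩ := Finset.mem_image.1 hK
    have h1 : ∏ a ∈ Finset.univ.erase b,
        (1 : Matrix (Fin 4) (Fin 4) ℝ) (Function.update I b m a) (I a) = 1 := by
      refine Finset.prod_eq_one fun a ha => ?_
      rw [Function.update_of_ne (Finset.ne_of_mem_erase ha), Matrix.one_apply_eq]
    rw [h1, one_mul]
  · have : ∃ a ∈ Finset.univ.erase b, K a ≠ I a := by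
      by_contra! h
      refine hK (Finset.mem_image.2 ⟨K b, Finset.mem_univ _, ?_⟩)
      funext a
      by_cases hab : a = b
      · subst hab; simp
      · simp [Function.update_of_ne hab, h a (Finset.mem_erase.2 ⟨hab, Finset.mem_univ _⟩)]
    obtain ⟨a, ha, hne⟩ := this
    have h0 : ∏ a ∈ Finset.univ.erase b, (1 : Matrix (Fin 4) (Fin 4) ℝ) (K a) (I a) = 0 :=
      Finset.prod_eq_zero ha (Matrix.one_apply_ne hne)
    rw [h0, zero_mul]

/-- A left-invariant tensor field does not depend on the coordinates of `ℝ³`, and its derivative in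
the last coordinate is the action of the derivation `-ad e₄` on each slot. -/
theorem partialDeriv_leftInvariant {D : Matrix (Fin 3) (Fin 3) ℝ} {k : ℕ} {T : TensorField k}
    (hT : IsLeftInvariant D T) (i : Fin 4) (I : Fin k → Fin 4) :
    partialDeriv i (fun x => T x I) 0 = if i = Fin.last 3 then
      -∑ b, ∑ m, adLast D m (I b) * T 0 (Function.update I b m) else 0 := by
  have hF := fun a b => contDiff_translationMatrix D a b
  have hs1 : ∀ K : Fin k → Fin 4,
      ContDiff ℝ ∞ fun x : R4 => ∏ a, translationMatrix D (-x (Fin.last 3)) (K a) (I a) :=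
    fun K => contDiff_prod fun a _ => hF _ _
  have h0 : translationMatrix D (-(0 : R4) (Fin.last 3)) = 1 := by
    rw [Pi.zero_apply, neg_zero, translationMatrix_zero]
  have e : (fun x => T x I) = fun x => ∑ K : Fin k → Fin 4,
      (∏ a, translationMatrix D (-x (Fin.last 3)) (K a) (I a)) * T 0 K := by
    funext x
    conv_lhs => rw [hT.eq_extension]
    rfl
  rw [e, partialDeriv_sum _ fun K _ =>
    ContDiff.differentiableAt' ((hs1 K).mul contDiff_const) 0]
  have h1 : ∀ K : Fin k → Fin 4, partialDeriv i (fun x : R4 =>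
      (∏ a, translationMatrix D (-x (Fin.last 3)) (K a) (I a)) * T 0 K) 0
      = ∑ b, (∏ a ∈ Finset.univ.erase b, (1 : Matrix (Fin 4) (Fin 4) ℝ) (K a) (I a)) *
        ((if i = Fin.last 3 then -adLast D (K b) (I b) else 0) * T 0 K) := by
    intro K
    rw [partialDeriv_mul (ContDiff.differentiableAt' (hs1 K) 0) (differentiableAt_const _),
      partialDeriv_const, mul_zero, add_zero,
      partialDeriv_prod fun a => ContDiff.differentiableAt' (hF _ _) 0, Finset.sum_mul]
    refine Finset.sum_congr rfl fun b _ => ?_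
    rw [partialDeriv_translationMatrix, h0]
    ring
  rw [Finset.sum_congr rfl fun K _ => h1 K, Finset.sum_comm,
    Finset.sum_congr rfl fun b _ => sum_prod_erase_one I b _]
  split_ifs with hi
  · simp only [Function.update_self, neg_mul, Finset.sum_neg_distrib]
  · simp

end

section
/-! ### The curvature of a left-invariant metric at the identity -/

theorem leftInvariantMetric_one_zero (D : Matrix (Fin 3) (Fin 3) ℝ) :
    leftInvariantMetric D 1 0 = 1 := by
  rw [leftInvariantMetric_apply, Pi.zero_apply, neg_zero, translationMatrix_zero]
  simp

/-- The coefficients of the Levi-Civita connection of the metric `leftInvariantMetric D 1` in the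
left-invariant frame which is standard at the identity: `∇_{eᵢ} eⱼ = ∑ₘ (frameConnection D m i j) eₘ`. -/
def frameConnection (D : Matrix (Fin 3) (Fin 3) ℝ) (m i j : Fin 4) : ℝ :=
  (1 / 2) * ((if i = Fin.last 3 then -(adLast D j m + adLast D m j) else 0)
    + (if j = Fin.last 3 then -(adLast D i m + adLast D m i) else 0)
    - (if m = Fin.last 3 then -(adLast D i j + adLast D j i) else 0))
  + if i = Fin.last 3 then adLast D m j else 0

theorem partialDeriv_leftInvariantMetric (D : Matrix (Fin 3) (Fin 3) ℝ) (i j l : Fin 4) :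
    partialDeriv i (fun y => leftInvariantMetric D 1 y j l) 0
      = if i = Fin.last 3 then -(adLast D j l + adLast D l j) else 0 := by
  have hF := fun a b => ContDiff.differentiableAt' (contDiff_translationMatrix D a b) 0
  have h0 : translationMatrix D (-(0 : R4) (Fin.last 3)) = 1 := by
    rw [Pi.zero_apply, neg_zero, translationMatrix_zero]
  have e : (fun y => leftInvariantMetric D 1 y j l) = fun y : R4 =>
      ∑ a, translationMatrix D (-y (Fin.last 3)) a j * translationMatrix D (-y (Fin.last 3)) a l := by
    funext y
    rw [leftInvariantMetric_apply, Matrix.mul_one]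
    simp only [Matrix.mul_apply, Matrix.transpose_apply]
  rw [e, partialDeriv_sum _ fun a _ => (hF a j).fun_mul (hF a l)]
  simp only [fun a => partialDeriv_mul (hF a j) (hF a l) i, partialDeriv_translationMatrix, h0,
    Matrix.one_apply]
  split_ifs with hi
  · simp [Finset.sum_add_distrib]
  · simp

theorem christoffel_leftInvariantMetric_zero (D : Matrix (Fin 3) (Fin 3) ℝ) (m i j : Fin 4) :
    christoffel (leftInvariantMetric D 1) m i j 0
      = frameConnection D m i j - if i = Fin.last 3 then adLast D m j else 0 := by
  rw [christoffel, leftInvariantMetric_one_zero, inv_one, Finset.sum_eq_single m]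
  · rw [Matrix.one_apply_eq, one_mul, partialDeriv_leftInvariantMetric,
      partialDeriv_leftInvariantMetric, partialDeriv_leftInvariantMetric, frameConnection]
    ring
  · intro l _ hl
    rw [Matrix.one_apply_ne hl.symm, zero_mul]
  · simp

/-- In a left-invariant frame the covariant derivative of a left-invariant tensor is algebraic. -/
theorem covDeriv_leftInvariant_zero {D : Matrix (Fin 3) (Fin 3) ℝ} {k : ℕ} {T : TensorField k}
    (hT : IsLeftInvariant D T) (i : Fin 4) (I : Fin k → Fin 4) :
    covDeriv (leftInvariantMetric D 1) T 0 (Matrix.vecCons i I)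
      = -∑ b, ∑ m, frameConnection D m i (I b) * T 0 (Function.update I b m) := by
  have ht : Fin.tail (Matrix.vecCons i I) = I := Fin.tail_cons (α := fun _ => Fin 4) i I
  have hsucc : ∀ a : Fin k, Matrix.vecCons i I a.succ = I a := fun a => rfl
  have h0 : Matrix.vecCons i I 0 = i := rfl
  simp only [covDeriv, ht, hsucc, h0, partialDeriv_leftInvariant hT,
    christoffel_leftInvariantMetric_zero, sub_mul, Finset.sum_sub_distrib]
  split_ifs with hi
  · ring
  · simp

theorem update_two_zero (j k m : Fin 4) : Function.update ![j, k] 0 m = ![m, k] := by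
  funext a; fin_cases a <;> simp
theorem update_two_one (j k m : Fin 4) : Function.update ![j, k] 1 m = ![j, m] := by
  funext a; fin_cases a <;> simp
theorem update_three_zero (j k l m : Fin 4) : Function.update ![j, k, l] 0 m = ![m, k, l] := by
  funext a; fin_cases a <;> simp
theorem update_three_one (j k l m : Fin 4) : Function.update ![j, k, l] 1 m = ![j, m, l] := by
  funext a; fin_cases a <;> simp
theorem update_three_two (j k l m : Fin 4) : Function.update ![j, k, l] 2 m = ![j, k, m] := by
  funext a; fin_cases a <;> simp
theorem update_four_zero (j k l p m : Fin 4) :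
    Function.update ![j, k, l, p] 0 m = ![m, k, l, p] := by
  funext a; fin_cases a <;> simp
theorem update_four_one (j k l p m : Fin 4) :
    Function.update ![j, k, l, p] 1 m = ![j, m, l, p] := by
  funext a; fin_cases a <;> simp
theorem update_four_two (j k l p m : Fin 4) :
    Function.update ![j, k, l, p] 2 m = ![j, k, m, p] := by
  funext a; fin_cases a <;> simp
theorem update_four_three (j k l p m : Fin 4) :
    Function.update ![j, k, l, p] 3 m = ![j, k, l, m] := by
  funext a; fin_cases a <;> simp

section
variable {D : Matrix (Fin 3) (Fin 3) ℝ}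

theorem covDeriv_one_zero {T : TensorField 1} (hT : IsLeftInvariant D T) (i j : Fin 4) :
    covDeriv (leftInvariantMetric D 1) T 0 ![i, j]
      = -∑ m, frameConnection D m i j * T 0 ![m] := by
  have hu : ∀ m, Function.update (![j] : Fin 1 → Fin 4) 0 m = ![m] := by
    intro m; funext a; fin_cases a; simp
  rw [covDeriv_leftInvariant_zero hT]
  simp [hu]

theorem covDeriv_two_zero {T : TensorField 2} (hT : IsLeftInvariant D T) (i j k : Fin 4) :
    covDeriv (leftInvariantMetric D 1) T 0 ![i, j, k]
      = -(∑ m, frameConnection D m i j * T 0 ![m, k]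
        + ∑ m, frameConnection D m i k * T 0 ![j, m]) := by
  rw [covDeriv_leftInvariant_zero hT, Fin.sum_univ_two]
  simp only [update_two_zero, update_two_one, Matrix.cons_val_zero, Matrix.cons_val_one]

theorem covDeriv_three_zero {T : TensorField 3} (hT : IsLeftInvariant D T) (i j k l : Fin 4) :
    covDeriv (leftInvariantMetric D 1) T 0 ![i, j, k, l]
      = -(∑ m, frameConnection D m i j * T 0 ![m, k, l]
        + ∑ m, frameConnection D m i k * T 0 ![j, m, l]
        + ∑ m, frameConnection D m i l * T 0 ![j, k, m]) := by
  rw [covDeriv_leftInvariant_zero hT, Fin.sum_univ_three]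
  simp only [update_three_zero, update_three_one, update_three_two, Matrix.cons_val_zero,
    Matrix.cons_val_one, Matrix.cons_val]

theorem covDeriv_four_zero {T : TensorField 4} (hT : IsLeftInvariant D T) (i j k l p : Fin 4) :
    covDeriv (leftInvariantMetric D 1) T 0 ![i, j, k, l, p]
      = -(∑ m, frameConnection D m i j * T 0 ![m, k, l, p]
        + ∑ m, frameConnection D m i k * T 0 ![j, m, l, p]
        + ∑ m, frameConnection D m i l * T 0 ![j, k, m, p]
        + ∑ m, frameConnection D m i p * T 0 ![j, k, l, m]) := by
  rw [covDeriv_leftInvariant_zero hT, Fin.sum_univ_four]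
  simp only [update_four_zero, update_four_one, update_four_two, update_four_three,
    Matrix.cons_val_zero, Matrix.cons_val_one, Matrix.cons_val]

/-- The curvature at the identity in terms of the connection coefficients of the left-invariant
frame, obtained from the Ricci identity for a left-invariant one-form. -/
theorem curvatureOp_leftInvariantMetric_zero (c i j k : Fin 4) :
    curvatureOp (leftInvariantMetric D 1) c i j k 0
      = ∑ m, (frameConnection D c i m * frameConnection D m j k
          - frameConnection D c j m * frameConnection D m i k
          - (frameConnection D m i j - frameConnection D m j i) * frameConnection D c m k) := by
  set η : TensorField 1 := leftInvariantExtension D fun I => if I 0 = c then 1 else 0 with hη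
  have hl : IsLeftInvariant D η := isLeftInvariant_extension D _
  have hs : IsSmoothTensor η := isSmoothTensor_extension D _
  have hQ : (1 : Matrix (Fin 4) (Fin 4) ℝ).PosDef := Matrix.PosDef.one
  have hg := isSmoothMetric_leftInvariantMetric D hQ
  have h := covDeriv_covDeriv_sub_swap hg hs 0 i j k
  have h1 : ∀ m, η 0 ![m] = if m = c then 1 else 0 := by
    intro m; rw [hη, leftInvariantExtension_zero]; rfl
  have hl2 := isLeftInvariant_covDeriv hQ hl hs
  simp only [covDeriv_two_zero hl2, covDeriv_one_zero hl, h1, mul_ite, mul_one, mul_zero,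
    Finset.sum_ite_eq', Finset.mem_univ, if_true] at h
  simp only [Finset.sum_sub_distrib, sub_mul]
  simp only [mul_neg, Finset.sum_neg_distrib] at h
  have e1 : ∀ i j, ∑ m, frameConnection D m i k * frameConnection D c j m
      = ∑ m, frameConnection D c j m * frameConnection D m i k :=
    fun i j => Finset.sum_congr rfl fun m _ => mul_comm _ _
  rw [e1, e1] at h
  linarith

/-- At the identity the standard basis is orthonormal, and the derivatives of the scalar curvature
vanish since it is constant. -/
theorem eulerLagrange_leftInvariantMetric_zero (t : ℝ) (i j : Fin 4) :
    eulerLagrange t (leftInvariantMetric D 1) 0 ![i, j]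
      = - ∑ h, covDeriv (leftInvariantMetric D 1) (covDeriv (leftInvariantMetric D 1)
          (ricci (leftInvariantMetric D 1))) 0 ![h, h, i, j]
        + (1 / 2) * energy t (leftInvariantMetric D 1) 0 * (1 : Matrix (Fin 4) (Fin 4) ℝ) i j
        - 2 * ∑ k, ∑ l, riemann (leftInvariantMetric D 1) 0 ![i, k, j, l] *
          ricci (leftInvariantMetric D 1) 0 ![k, l]
        - 2 * t * scalarCurvature (leftInvariantMetric D 1) 0 *
          ricci (leftInvariantMetric D 1) 0 ![i, j] := by
  have hQ : (1 : Matrix (Fin 4) (Fin 4) ℝ).PosDef := Matrix.PosDef.one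
  set g := leftInvariantMetric D 1 with hg
  have hg0 : g 0 = 1 := leftInvariantMetric_one_zero D
  have h1 : covDeriv g (ofFun (scalarCurvature g)) = 0 := by
    have e : scalarCurvature g = fun _ => scalarCurvature g 0 :=
      funext fun x => scalarCurvature_leftInvariantMetric hQ x
    funext x I
    rw [e]
    simp only [covDeriv, ofFun, partialDeriv_const, Finset.univ_eq_empty, Finset.sum_empty,
      sub_zero, Pi.zero_apply]
  have h2 : covDeriv g (0 : TensorField (0 + 1)) = 0 := by
    funext x I
    simp [covDeriv, partialDeriv_const]
  have h3 : ∀ I, laplacian g (ofFun (scalarCurvature g)) 0 I = 0 := by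
    intro I
    simp only [laplacian, h1, h2, Pi.zero_apply, mul_zero, Finset.sum_const_zero]
  have h4 : laplacian g (ricci g) 0 ![i, j]
      = ∑ h, covDeriv g (covDeriv g (ricci g)) 0 ![h, h, i, j] := by
    simp only [laplacian, hg0, inv_one, Matrix.one_apply, ite_mul, one_mul, zero_mul,
      Finset.sum_ite_eq, Finset.mem_univ, if_true]
  have h5 : curvatureRicci g 0 ![i, j]
      = ∑ k, ∑ l, riemann g 0 ![i, k, j, l] * ricci g 0 ![k, l] := by
    simp only [curvatureRicci, hg0, inv_one, Matrix.one_apply, ite_mul, one_mul, zero_mul,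
      mul_ite, mul_zero, Finset.sum_ite_eq, Finset.mem_univ, if_true]
    simp [Matrix.cons_val_zero]
  simp only [eulerLagrange, h1, h2, h3, h4, h5, hg0, energy, Pi.zero_apply, Matrix.cons_val_zero,
    Matrix.cons_val_one]
  ring

theorem riemann_leftInvariantMetric_zero (i j k l : Fin 4) :
    riemann (leftInvariantMetric D 1) 0 ![i, j, k, l]
      = curvatureOp (leftInvariantMetric D 1) k i j l 0 := by
  simp only [riemann, leftInvariantMetric_one_zero, Matrix.one_apply, ite_mul, one_mul, zero_mul,
    Finset.sum_ite_eq, Finset.mem_univ, if_true, Matrix.cons_val_zero, Matrix.cons_val_one,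
    Matrix.cons_val]

theorem ricci_leftInvariantMetric_zero (i j : Fin 4) :
    ricci (leftInvariantMetric D 1) 0 ![i, j]
      = ∑ k, riemann (leftInvariantMetric D 1) 0 ![i, k, j, k] := by
  simp only [ricci, leftInvariantMetric_one_zero, inv_one, Matrix.one_apply, ite_mul, one_mul,
    zero_mul, Finset.sum_ite_eq, Finset.mem_univ, if_true, Matrix.cons_val_zero,
    Matrix.cons_val_one]

theorem scalarCurvature_leftInvariantMetric_zero :
    scalarCurvature (leftInvariantMetric D 1) 0
      = ∑ k, ricci (leftInvariantMetric D 1) 0 ![k, k] := by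
  simp only [scalarCurvature, leftInvariantMetric_one_zero, inv_one, Matrix.one_apply, ite_mul,
    one_mul, zero_mul, Finset.sum_ite_eq, Finset.mem_univ, if_true]

theorem ricciNormSq_leftInvariantMetric_zero :
    ricciNormSq (leftInvariantMetric D 1) 0
      = ∑ i, ∑ j, ricci (leftInvariantMetric D 1) 0 ![i, j] ^ 2 := by
  simp only [ricciNormSq, leftInvariantMetric_one_zero, inv_one, Matrix.one_apply, ite_mul,
    one_mul, zero_mul, mul_ite, mul_one, mul_zero, Finset.sum_ite_eq, Finset.mem_univ, if_true]
  refine Finset.sum_congr rfl fun i _ => Finset.sum_congr rfl fun j _ => ?_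
  rw [sq]

end

end

section
/-! ### The normal form -/

/-- The brackets `[eᵢ, e₄]` in a basis which diagonalizes the symmetric part of the derivation. -/
def normalForm (a₁ a₂ a₃ x y z : ℝ) : Matrix (Fin 3) (Fin 3) ℝ :=
  !![a₁, z, -y; -z, a₂, x; y, -x, a₃]

variable (a₁ a₂ a₃ x y z : ℝ)

theorem adLast_normalForm : adLast (derivationOf (normalForm a₁ a₂ a₃ x y z))
    = !![-a₁, z, -y, 0; -z, -a₂, x, 0; y, -x, -a₃, 0; 0, 0, 0, 0] := by
  have h : derivationOf (normalForm a₁ a₂ a₃ x y z) = !![-a₁, z, -y; -z, -a₂, x; y, -x, -a₃] := by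
    ext i j; fin_cases i <;> fin_cases j <;> simp [derivationOf, normalForm]
  rw [adLast, h]
  ext i j
  fin_cases i <;> fin_cases j <;> rfl

/-- The matrices `(∇_{eᵢ} eⱼ, eₘ)` (row `m`, column `j`) of the connection in the normal form. -/
def normalConnection : Fin 4 → Matrix (Fin 4) (Fin 4) ℝ :=
  ![!![0, 0, 0, a₁; 0, 0, 0, 0; 0, 0, 0, 0; -a₁, 0, 0, 0],
    !![0, 0, 0, 0; 0, 0, 0, a₂; 0, 0, 0, 0; 0, -a₂, 0, 0],
    !![0, 0, 0, 0; 0, 0, 0, 0; 0, 0, 0, a₃; 0, 0, -a₃, 0],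
    !![0, z, -y, 0; -z, 0, x, 0; y, -x, 0, 0; 0, 0, 0, 0]]

theorem frameConnection_normalForm (m i j : Fin 4) :
    frameConnection (derivationOf (normalForm a₁ a₂ a₃ x y z)) m i j
      = normalConnection a₁ a₂ a₃ x y z i m j := by
  rw [frameConnection, adLast_normalForm]
  fin_cases i <;> fin_cases m <;> fin_cases j <;>
    simp [normalConnection, Fin.last] <;> ring

/-- The components `R(eᵢ, e₄, eⱼ, e₄)` in the normal form. -/
def normalRadial : Matrix (Fin 4) (Fin 4) ℝ :=
  !![-a₁ ^ 2, z * (a₁ - a₂), y * (a₃ - a₁), 0;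
     z * (a₁ - a₂), -a₂ ^ 2, x * (a₂ - a₃), 0;
     y * (a₃ - a₁), x * (a₂ - a₃), -a₃ ^ 2, 0;
     0, 0, 0, 0]

set_option maxHeartbeats 4000000 in
/-- The curvature tensor in the normal form: the hyperplanes orthogonal to `e₄` are flat with second
fundamental form `diag (a₁, a₂, a₃)`, and the remaining components are `R(eᵢ, e₄, eⱼ, e₄)`. -/
theorem riemann_normalForm (i j k l : Fin 4) :
    riemann (metricOf (normalForm a₁ a₂ a₃ x y z)) 0 ![i, j, k, l]
      = -(![a₁, a₂, a₃, 0] i * ![a₁, a₂, a₃, 0] j *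
          ((1 : Matrix (Fin 4) (Fin 4) ℝ) i k * (1 : Matrix (Fin 4) (Fin 4) ℝ) j l
            - (1 : Matrix (Fin 4) (Fin 4) ℝ) i l * (1 : Matrix (Fin 4) (Fin 4) ℝ) j k))
        + (normalRadial a₁ a₂ a₃ x y z i k * ![0, 0, 0, 1] j * ![0, 0, 0, 1] l
          + normalRadial a₁ a₂ a₃ x y z j l * ![0, 0, 0, 1] i * ![0, 0, 0, 1] k
          - normalRadial a₁ a₂ a₃ x y z i l * ![0, 0, 0, 1] j * ![0, 0, 0, 1] k
          - normalRadial a₁ a₂ a₃ x y z j k * ![0, 0, 0, 1] i * ![0, 0, 0, 1] l) := by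
  rw [metricOf, riemann_leftInvariantMetric_zero, curvatureOp_leftInvariantMetric_zero]
  simp only [frameConnection_normalForm]
  fin_cases i <;> fin_cases j <;> fin_cases k <;> fin_cases l <;>
    simp [normalConnection, normalRadial, Fin.sum_univ_four] <;> ring

end

section
variable (a₁ a₂ a₃ x y z : ℝ)

/-- The Ricci tensor in the normal form. -/
def normalRicci : Matrix (Fin 4) (Fin 4) ℝ :=
  !![-a₁ * (a₁ + a₂ + a₃), z * (a₁ - a₂), y * (a₃ - a₁), 0;
     z * (a₁ - a₂), -a₂ * (a₁ + a₂ + a₃), x * (a₂ - a₃), 0;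
     y * (a₃ - a₁), x * (a₂ - a₃), -a₃ * (a₁ + a₂ + a₃), 0;
     0, 0, 0, -(a₁ ^ 2 + a₂ ^ 2 + a₃ ^ 2)]

theorem ricci_normalForm (i j : Fin 4) :
    ricci (metricOf (normalForm a₁ a₂ a₃ x y z)) 0 ![i, j] = normalRicci a₁ a₂ a₃ x y z i j := by
  have h := ricci_leftInvariantMetric_zero (D := derivationOf (normalForm a₁ a₂ a₃ x y z)) i j
  rw [← metricOf] at h
  rw [h]
  simp only [riemann_normalForm]
  fin_cases i <;> fin_cases j <;>
    simp [normalRicci, normalRadial, Fin.sum_univ_four, Matrix.one_apply] <;> ring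

theorem scalarCurvature_normalForm :
    scalarCurvature (metricOf (normalForm a₁ a₂ a₃ x y z)) 0
      = -((a₁ + a₂ + a₃) ^ 2 + (a₁ ^ 2 + a₂ ^ 2 + a₃ ^ 2)) := by
  have h := scalarCurvature_leftInvariantMetric_zero
    (D := derivationOf (normalForm a₁ a₂ a₃ x y z))
  rw [← metricOf] at h
  rw [h]
  simp only [ricci_normalForm]
  simp [normalRicci, Fin.sum_univ_four]
  ring

/-- The squared norm of the commutator of the symmetric and the skew-symmetric part of the
derivation. -/
def commNormSq : ℝ :=
  2 * (z ^ 2 * (a₁ - a₂) ^ 2 + y ^ 2 * (a₃ - a₁) ^ 2 + x ^ 2 * (a₂ - a₃) ^ 2)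

theorem energy_normalForm (t : ℝ) :
    energy t (metricOf (normalForm a₁ a₂ a₃ x y z)) 0
      = (a₁ + a₂ + a₃) ^ 2 * (a₁ ^ 2 + a₂ ^ 2 + a₃ ^ 2) + commNormSq a₁ a₂ a₃ x y z
        + (a₁ ^ 2 + a₂ ^ 2 + a₃ ^ 2) ^ 2
        + t * ((a₁ + a₂ + a₃) ^ 2 + (a₁ ^ 2 + a₂ ^ 2 + a₃ ^ 2)) ^ 2 := by
  have h := ricciNormSq_leftInvariantMetric_zero
    (D := derivationOf (normalForm a₁ a₂ a₃ x y z))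
  rw [← metricOf] at h
  rw [energy, scalarCurvature_normalForm, h]
  simp only [ricci_normalForm]
  simp [normalRicci, commNormSq, Fin.sum_univ_four]
  ring

/-- The matrices `(∇ρ)(eₕ, eⱼ, eₖ)` (row `j`, column `k`) in the normal form. -/
def normalRicciDeriv : Fin 4 → Matrix (Fin 4) (Fin 4) ℝ :=
  let θ := a₁ + a₂ + a₃
  let s := a₁ ^ 2 + a₂ ^ 2 + a₃ ^ 2
  let r₁₂ := z * (a₁ - a₂)
  let r₁₃ := y * (a₃ - a₁)
  let r₂₃ := x * (a₂ - a₃)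
  let n₁₂ := z * (a₁ - a₂) * θ - y * r₂₃ + x * r₁₃
  let n₂₃ := x * (a₂ - a₃) * θ - z * r₁₃ + y * r₁₂
  let n₁₃ := y * (a₃ - a₁) * θ - x * r₁₂ + z * r₂₃
  ![!![0, 0, 0, -a₁ * (s - a₁ * θ); 0, 0, 0, -a₁ * r₁₂; 0, 0, 0, -a₁ * r₁₃;
       -a₁ * (s - a₁ * θ), -a₁ * r₁₂, -a₁ * r₁₃, 0],
    !![0, 0, 0, -a₂ * r₁₂; 0, 0, 0, -a₂ * (s - a₂ * θ); 0, 0, 0, -a₂ * r₂₃;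
       -a₂ * r₁₂, -a₂ * (s - a₂ * θ), -a₂ * r₂₃, 0],
    !![0, 0, 0, -a₃ * r₁₃; 0, 0, 0, -a₃ * r₂₃; 0, 0, 0, -a₃ * (s - a₃ * θ);
       -a₃ * r₁₃, -a₃ * r₂₃, -a₃ * (s - a₃ * θ), 0],
    !![2 * (z * r₁₂ - y * r₁₃), n₁₂, n₁₃, 0;
       n₁₂, 2 * (x * r₂₃ - z * r₁₂), n₂₃, 0;
       n₁₃, n₂₃, 2 * (y * r₁₃ - x * r₂₃), 0;
       0, 0, 0, 0]]

theorem covDeriv_ricci_normalForm (h j k : Fin 4) :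
    covDeriv (metricOf (normalForm a₁ a₂ a₃ x y z))
      (ricci (metricOf (normalForm a₁ a₂ a₃ x y z))) 0 ![h, j, k]
      = normalRicciDeriv a₁ a₂ a₃ x y z h j k := by
  have e := covDeriv_two_zero (D := derivationOf (normalForm a₁ a₂ a₃ x y z))
    (isLeftInvariant_ricci Matrix.PosDef.one) h j k
  rw [← metricOf] at e
  rw [e]
  simp only [ricci_normalForm, frameConnection_normalForm]
  fin_cases h <;> fin_cases j <;> fin_cases k <;>
    simp [normalRicci, normalRicciDeriv, normalConnection, Fin.sum_univ_four] <;> ring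

/-- The scalar `u = σ + t (θ² + σ)` of the normal form, where `θ` and `σ` are the trace and the
squared norm of the symmetric part of the derivation. -/
def defect (t : ℝ) : ℝ :=
  (a₁ ^ 2 + a₂ ^ 2 + a₃ ^ 2) + t * ((a₁ + a₂ + a₃) ^ 2 + (a₁ ^ 2 + a₂ ^ 2 + a₃ ^ 2))

/-- The component of the Euler–Lagrange tensor along `e₄`. -/
def radialEquation (t : ℝ) : ℝ :=
  -(3 / 2) * commNormSq a₁ a₂ a₃ x y z
    - (1 / 2) * (3 * (a₁ ^ 2 + a₂ ^ 2 + a₃ ^ 2) - (a₁ + a₂ + a₃) ^ 2) * defect a₁ a₂ a₃ t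

/-- The trace-free part of the first diagonal component of the Euler–Lagrange tensor on `ℝ³`. -/
def diagonalEquation (t : ℝ) : ℝ :=
  6 * (x * y * z) * (a₂ - a₃)
    - 4 * (a₁ + a₂ + a₃) * (z ^ 2 * (a₁ - a₂) + y ^ 2 * (a₁ - a₃))
    - 2 * (a₁ + a₂ + a₃) * defect a₁ a₂ a₃ t * (a₁ - (a₁ + a₂ + a₃) / 3)

/-- The component of the Euler–Lagrange tensor along `e₁, e₂`. -/
def mixedEquation (t : ℝ) : ℝ :=
  z * (4 * z ^ 2 * (a₁ - a₂) + y ^ 2 * (5 * a₁ - 2 * a₃ - (a₁ + a₂ + a₃))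
      - x ^ 2 * (5 * a₂ - 2 * a₃ - (a₁ + a₂ + a₃)))
    - 6 * (a₁ + a₂ + a₃) * (a₃ - (a₁ + a₂ + a₃) / 3) * (x * y)
    + ((a₁ + a₂ + a₃) ^ 2 - (a₁ - a₂) ^ 2 - 2 * defect a₁ a₂ a₃ t) * z * (a₂ - a₁)

/-- The components of the Euler–Lagrange tensor at the identity in the normal form. -/
def normalEulerLagrange (t : ℝ) : Matrix (Fin 4) (Fin 4) ℝ :=
  let e := radialEquation a₁ a₂ a₃ x y z t
  let m₁₂ := mixedEquation a₁ a₂ a₃ x y z t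
  let m₂₃ := mixedEquation a₂ a₃ a₁ y z x t
  let m₃₁ := mixedEquation a₃ a₁ a₂ z x y t
  !![diagonalEquation a₁ a₂ a₃ x y z t - e / 3, m₁₂, m₃₁, 0;
     m₁₂, diagonalEquation a₂ a₃ a₁ y z x t - e / 3, m₂₃, 0;
     m₃₁, m₂₃, diagonalEquation a₃ a₁ a₂ z x y t - e / 3, 0;
     0, 0, 0, e]

set_option maxHeartbeats 4000000 in
theorem eulerLagrange_normalForm (t : ℝ) (i j : Fin 4) :
    eulerLagrange t (metricOf (normalForm a₁ a₂ a₃ x y z)) 0 ![i, j]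
      = normalEulerLagrange a₁ a₂ a₃ x y z t i j := by
  have e := eulerLagrange_leftInvariantMetric_zero
    (D := derivationOf (normalForm a₁ a₂ a₃ x y z)) t i j
  have hQ : (1 : Matrix (Fin 4) (Fin 4) ℝ).PosDef := Matrix.PosDef.one
  have e3 := covDeriv_three_zero (D := derivationOf (normalForm a₁ a₂ a₃ x y z))
    (isLeftInvariant_covDeriv hQ (isLeftInvariant_ricci hQ)
      (isSmoothMetric_leftInvariantMetric _ hQ).ricci)
  have hm : leftInvariantMetric (derivationOf (normalForm a₁ a₂ a₃ x y z)) 1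
    = metricOf (normalForm a₁ a₂ a₃ x y z) := rfl
  rw [hm] at e e3
  rw [e]
  simp only [e3, covDeriv_ricci_normalForm, riemann_normalForm, ricci_normalForm,
    scalarCurvature_normalForm, energy_normalForm, frameConnection_normalForm]
  fin_cases i <;> fin_cases j <;>
    simp [normalRicci, normalRicciDeriv, normalConnection, normalRadial, normalEulerLagrange,
      diagonalEquation, mixedEquation, radialEquation, defect, commNormSq, Fin.sum_univ_four,
      Matrix.one_apply] <;>
    ring

end

section
/-- The Euler–Lagrange equation in the normal form. -/
structure CriticalEquations (a₁ a₂ a₃ x y z t : ℝ) : Prop where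
  radial : radialEquation a₁ a₂ a₃ x y z t = 0
  diag₁ : diagonalEquation a₁ a₂ a₃ x y z t = 0
  diag₂ : diagonalEquation a₂ a₃ a₁ y z x t = 0
  diag₃ : diagonalEquation a₃ a₁ a₂ z x y t = 0
  mixed₁₂ : mixedEquation a₁ a₂ a₃ x y z t = 0
  mixed₂₃ : mixedEquation a₂ a₃ a₁ y z x t = 0
  mixed₃₁ : mixedEquation a₃ a₁ a₂ z x y t = 0

variable {a₁ a₂ a₃ x y z : ℝ}

theorem isSmoothMetric_metricOf (B : Matrix (Fin 3) (Fin 3) ℝ) : IsSmoothMetric (metricOf B) :=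
  isSmoothMetric_leftInvariantMetric _ Matrix.PosDef.one

/-- The Euler–Lagrange equation of a metric in the normal form is a system of polynomial equations. -/
theorem isCritical_normalForm_iff (t : ℝ) :
    IsCritical t (metricOf (normalForm a₁ a₂ a₃ x y z)) ↔ CriticalEquations a₁ a₂ a₃ x y z t := by
  have h : IsCritical t (metricOf (normalForm a₁ a₂ a₃ x y z)) ↔
      ∀ i j, normalEulerLagrange a₁ a₂ a₃ x y z t i j = 0 := by
    have h1 : IsCritical t (metricOf (normalForm a₁ a₂ a₃ x y z)) ↔ _ :=
      isCritical_leftInvariantMetric_iff Matrix.PosDef.one t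
    rw [h1]
    constructor
    · intro h i j
      rw [← eulerLagrange_normalForm]
      exact h _
    · intro h I
      rw [vec_two_eta I]
      exact (eulerLagrange_normalForm a₁ a₂ a₃ x y z t _ _).trans (h _ _)
  rw [h]
  constructor
  · intro h
    have hr : radialEquation a₁ a₂ a₃ x y z t = 0 := h 3 3
    have h1 : diagonalEquation a₁ a₂ a₃ x y z t - radialEquation a₁ a₂ a₃ x y z t / 3 = 0 := h 0 0
    have h2 : diagonalEquation a₂ a₃ a₁ y z x t - radialEquation a₁ a₂ a₃ x y z t / 3 = 0 := h 1 1
    have h3 : diagonalEquation a₃ a₁ a₂ z x y t - radialEquation a₁ a₂ a₃ x y z t / 3 = 0 := h 2 2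
    exact ⟨hr, by linarith, by linarith, by linarith, h 0 1, h 1 2, h 0 2⟩
  · rintro ⟨hr, h1, h2, h3, h12, h23, h31⟩ i j
    fin_cases i <;> fin_cases j <;>
      simp [normalEulerLagrange, hr, h1, h2, h3, h12, h23, h31]

theorem CriticalEquations.rotate {t : ℝ} (h : CriticalEquations a₁ a₂ a₃ x y z t) :
    CriticalEquations a₂ a₃ a₁ y z x t where
  radial := by
    have := h.radial
    simp only [radialEquation, commNormSq, defect] at this ⊢
    linear_combination this
  diag₁ := h.diag₂
  diag₂ := h.diag₃
  diag₃ := h.diag₁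
  mixed₁₂ := h.mixed₂₃
  mixed₂₃ := h.mixed₃₁
  mixed₃₁ := h.mixed₁₂

/-- On a critical metric the energy is `(4/3) θ² u`. -/
theorem CriticalEquations.energy_eq {t : ℝ} (h : CriticalEquations a₁ a₂ a₃ x y z t) (p : R4) :
    energy t (metricOf (normalForm a₁ a₂ a₃ x y z)) p
      = 4 / 3 * (a₁ + a₂ + a₃) ^ 2 * defect a₁ a₂ a₃ t := by
  have e : energy t (metricOf (normalForm a₁ a₂ a₃ x y z)) p
      = energy t (metricOf (normalForm a₁ a₂ a₃ x y z)) 0 :=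
    energy_leftInvariantMetric Matrix.PosDef.one t p
  have := h.radial
  rw [e, energy_normalForm]
  simp only [radialEquation, defect] at this ⊢
  linear_combination (-2 / 3) * this

theorem covDeriv_riemann_normalForm (h j k l p : Fin 4) :
    covDeriv (metricOf (normalForm a₁ a₂ a₃ x y z))
      (riemann (metricOf (normalForm a₁ a₂ a₃ x y z))) 0 ![h, j, k, l, p]
      = -(∑ m, normalConnection a₁ a₂ a₃ x y z h m j *
            riemann (metricOf (normalForm a₁ a₂ a₃ x y z)) 0 ![m, k, l, p]
        + ∑ m, normalConnection a₁ a₂ a₃ x y z h m k *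
            riemann (metricOf (normalForm a₁ a₂ a₃ x y z)) 0 ![j, m, l, p]
        + ∑ m, normalConnection a₁ a₂ a₃ x y z h m l *
            riemann (metricOf (normalForm a₁ a₂ a₃ x y z)) 0 ![j, k, m, p]
        + ∑ m, normalConnection a₁ a₂ a₃ x y z h m p *
            riemann (metricOf (normalForm a₁ a₂ a₃ x y z)) 0 ![j, k, l, m]) := by
  have e := covDeriv_four_zero (D := derivationOf (normalForm a₁ a₂ a₃ x y z))
    (isLeftInvariant_riemann Matrix.PosDef.one) h j k l p
  have hm : leftInvariantMetric (derivationOf (normalForm a₁ a₂ a₃ x y z)) 1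
    = metricOf (normalForm a₁ a₂ a₃ x y z) := rfl
  rw [hm] at e
  rw [e]
  simp only [frameConnection_normalForm]

/-- On a symmetric space the symmetric and the skew-symmetric part of the derivation commute. -/
theorem commNormSq_eq_zero_of_isLocallySymmetric
    (h : IsLocallySymmetric (metricOf (normalForm a₁ a₂ a₃ x y z))) :
    commNormSq a₁ a₂ a₃ x y z = 0 := by
  have e : ∀ i j k l p, _ := fun h j k l p =>
    covDeriv_riemann_normalForm (a₁ := a₁) (a₂ := a₂) (a₃ := a₃) (x := x) (y := y) (z := z) h j k l p
  have key : ∀ a b c : ℝ, a * (c * (a - b)) = 0 → b * (c * (a - b)) = 0 → c ^ 2 * (a - b) ^ 2 = 0 := by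
    intro a b c h1 h2
    linear_combination c * h1 - c * h2
  have r01 := (e 0 0 1 0 3).symm.trans (h 0 _)
  have r10 := (e 1 1 0 1 3).symm.trans (h 0 _)
  have r02 := (e 0 0 2 0 3).symm.trans (h 0 _)
  have r20 := (e 2 2 0 2 3).symm.trans (h 0 _)
  have r12 := (e 1 1 2 1 3).symm.trans (h 0 _)
  have r21 := (e 2 2 1 2 3).symm.trans (h 0 _)
  simp only [riemann_normalForm] at r01 r10 r02 r20 r12 r21
  simp [normalConnection, normalRadial, Fin.sum_univ_four] at r01 r10 r02 r20 r12 r21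
  have k1 := key a₁ a₂ z (by simpa using r01) (by simpa using r10)
  have k2 := key a₃ a₁ y (by simpa using r20) (by simpa using r02)
  have k3 := key a₂ a₃ x (by simpa using r12) (by simpa using r21)
  rw [commNormSq, k1, k2, k3]
  ring

/-- On a symmetric space all the non-zero `aᵢ` are equal. -/
theorem mul_sub_eq_zero_of_isLocallySymmetric
    (h : IsLocallySymmetric (metricOf (normalForm a₁ a₂ a₃ x y z))) :
    a₁ * a₂ * (a₁ - a₂) = 0 ∧ a₁ * a₃ * (a₁ - a₃) = 0 ∧ a₂ * a₃ * (a₂ - a₃) = 0 := by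
  have e : ∀ i j k l p, _ := fun h j k l p =>
    covDeriv_riemann_normalForm (a₁ := a₁) (a₂ := a₂) (a₃ := a₃) (x := x) (y := y) (z := z) h j k l p
  have r01 := (e 0 0 1 1 3).symm.trans (h 0 _)
  have r02 := (e 0 0 2 2 3).symm.trans (h 0 _)
  have r12 := (e 1 1 2 2 3).symm.trans (h 0 _)
  simp only [riemann_normalForm] at r01 r02 r12
  simp [normalConnection, normalRadial, Fin.sum_univ_four, Matrix.one_apply] at r01 r02 r12
  exact ⟨by linear_combination -r01, by linear_combination -r02, by linear_combination -r12⟩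

set_option maxHeartbeats 8000000 in
/-- If all the non-zero `aᵢ` are equal, then the metric is the product of a hyperbolic and a flat
metric. -/
theorem isLocallySymmetric_normalForm (h₁₂ : a₁ * a₂ * (a₁ - a₂) = 0)
    (h₁₃ : a₁ * a₃ * (a₁ - a₃) = 0) (h₂₃ : a₂ * a₃ * (a₂ - a₃) = 0) :
    IsLocallySymmetric (metricOf (normalForm a₁ a₂ a₃ 0 0 0)) := by
  have h1 : IsLocallySymmetric (metricOf (normalForm a₁ a₂ a₃ 0 0 0)) ↔ _ :=
    isLocallySymmetric_leftInvariantMetric_iff Matrix.PosDef.one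
  rw [h1]
  intro I
  obtain ⟨h, j, k, l, p, rfl⟩ : ∃ h j k l p, I = ![h, j, k, l, p] :=
    ⟨I 0, I 1, I 2, I 3, I 4, by funext a; fin_cases a <;> rfl⟩
  refine (covDeriv_riemann_normalForm h j k l p).trans ?_
  have h3 : normalConnection a₁ a₂ a₃ 0 0 0 3 = 0 := by
    ext i j; fin_cases i <;> fin_cases j <;> simp [normalConnection]
  have h0 : ∀ m j, normalConnection a₁ a₂ a₃ 0 0 0 0 m j
      = if m = 0 ∧ j = 3 then a₁ else if m = 3 ∧ j = 0 then -a₁ else 0 := by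
    intro i j; fin_cases i <;> fin_cases j <;> simp [normalConnection]
  have h1 : ∀ m j, normalConnection a₁ a₂ a₃ 0 0 0 1 m j
      = if m = 1 ∧ j = 3 then a₂ else if m = 3 ∧ j = 1 then -a₂ else 0 := by
    intro i j; fin_cases i <;> fin_cases j <;> simp [normalConnection]
  have h2 : ∀ m j, normalConnection a₁ a₂ a₃ 0 0 0 2 m j
      = if m = 2 ∧ j = 3 then a₃ else if m = 3 ∧ j = 2 then -a₃ else 0 := by
    intro i j; fin_cases i <;> fin_cases j <;> simp [normalConnection]
  have hR : ∀ j k l p, riemann (metricOf (normalForm a₁ a₂ a₃ 0 0 0)) 0 ![j, k, l, p]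
      = !![0, -(a₁ * a₂), -(a₁ * a₃), -a₁ ^ 2; -(a₁ * a₂), 0, -(a₂ * a₃), -a₂ ^ 2;
           -(a₁ * a₃), -(a₂ * a₃), 0, -a₃ ^ 2; -a₁ ^ 2, -a₂ ^ 2, -a₃ ^ 2, 0] j k *
        ((if j = l ∧ k = p then 1 else 0) - if j = p ∧ k = l then 1 else 0) := by
    intro j k l p
    rw [riemann_normalForm]
    fin_cases j <;> fin_cases k <;> fin_cases l <;> fin_cases p <;>
      simp [normalRadial] <;> ring
  simp only [hR]
  fin_cases h
  · simp only [Fin.zero_eta, h0]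
    fin_cases j <;> fin_cases k <;> fin_cases l <;> fin_cases p <;>
      simp <;> linarith
  · simp only [Fin.mk_one, h1]
    fin_cases j <;> fin_cases k <;> fin_cases l <;> fin_cases p <;>
      simp <;> linarith
  · simp only [Fin.reduceFinMk, h2]
    fin_cases j <;> fin_cases k <;> fin_cases l <;> fin_cases p <;>
      simp <;> linarith
  · simp [h3]

end

/-! ### Homotheties between left-invariant metrics -/

theorem expFlow_conj {D D' P : Matrix (Fin 3) (Fin 3) ℝ} {a : ℝ} (hP : IsUnit P)
    (h : a • (D' * P) = P * D) (s : ℝ) : expFlow D' (a * s) * P = P * expFlow D s := by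
  have hd : IsUnit P.det := (Matrix.isUnit_iff_isUnit_det P).1 hP
  have e : (a * s) • D' = P * (s • D) * P⁻¹ := by
    rw [Matrix.mul_smul, ← h, smul_smul, Matrix.smul_mul, Matrix.mul_assoc,
      Matrix.mul_nonsing_inv _ hd, Matrix.mul_one, mul_comm s a]
  rw [expFlow, e, Matrix.exp_conj _ _ hP, Matrix.mul_assoc, Matrix.nonsing_inv_mul _ hd,
    Matrix.mul_one, expFlow]

/-- The translational part of the automorphism with differential `blockMatrix P v a`. -/
def shear (D : Matrix (Fin 3) (Fin 3) ℝ) (v : Fin 3 → ℝ) (a s : ℝ) : Fin 3 → ℝ :=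
  fun i => ∫ u in (0 : ℝ)..s, (expFlow D (a * u) *ᵥ v) i

theorem contDiff_expFlow_mulVec (D : Matrix (Fin 3) (Fin 3) ℝ) (v : Fin 3 → ℝ) (a : ℝ)
    (i : Fin 3) : ContDiff ℝ ∞ fun u => (expFlow D (a * u) *ᵥ v) i := by
  simp only [Matrix.mulVec, dotProduct]
  exact ContDiff.sum fun j _ => ((contDiff_expFlow D i j).comp
    (contDiff_const.mul contDiff_id)).mul contDiff_const

theorem hasDerivAt_shear (D : Matrix (Fin 3) (Fin 3) ℝ) (v : Fin 3 → ℝ) (a s : ℝ) (i : Fin 3) :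
    HasDerivAt (fun s => shear D v a s i) ((expFlow D (a * s) *ᵥ v) i) s := by
  have hc := (contDiff_expFlow_mulVec D v a i).continuous
  exact intervalIntegral.integral_hasDerivAt_right (hc.intervalIntegrable _ _)
    (hc.stronglyMeasurableAtFilter _ _) hc.continuousAt

theorem contDiff_shear (D : Matrix (Fin 3) (Fin 3) ℝ) (v : Fin 3 → ℝ) (a : ℝ) (i : Fin 3) :
    ContDiff ℝ ∞ fun s => shear D v a s i := by
  rw [contDiff_infty_iff_deriv]
  refine ⟨fun s => (hasDerivAt_shear D v a s i).differentiableAt, ?_⟩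
  have : deriv (fun s => shear D v a s i) = fun s => (expFlow D (a * s) *ᵥ v) i :=
    funext fun s => (hasDerivAt_shear D v a s i).deriv
  rw [this]
  exact contDiff_expFlow_mulVec D v a i

/-- The isomorphism of groups with differential `blockMatrix P v a` at the identity. -/
def groupIso (D : Matrix (Fin 3) (Fin 3) ℝ) (P : Matrix (Fin 3) (Fin 3) ℝ) (v : Fin 3 → ℝ)
    (a : ℝ) (x : R4) : R4 :=
  Fin.snoc (α := fun _ => ℝ) (P *ᵥ Fin.init x + shear D v a (x (Fin.last 3))) (a * x (Fin.last 3))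

theorem contDiff_groupIso (D P : Matrix (Fin 3) (Fin 3) ℝ) (v : Fin 3 → ℝ) (a : ℝ) :
    ContDiff ℝ ∞ (groupIso D P v a) := by
  rw [contDiff_pi]
  intro i
  have hl : ContDiff ℝ ∞ fun x : R4 => x (Fin.last 3) := contDiff_apply ℝ ℝ _
  refine Fin.lastCases ?_ (fun i => ?_) i
  · simp only [groupIso, Fin.snoc_last]
    exact contDiff_const.mul hl
  · simp only [groupIso, Fin.snoc_castSucc, Pi.add_apply, Matrix.mulVec, dotProduct]
    exact (ContDiff.sum fun j _ => contDiff_const.mul (contDiff_apply ℝ ℝ _)).add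
      ((contDiff_shear D v a i).comp hl)

theorem jacobian_groupIso (D P : Matrix (Fin 3) (Fin 3) ℝ) (v : Fin 3 → ℝ) (a : ℝ) (x : R4) :
    jacobian (groupIso D P v a) x
      = blockMatrix P (expFlow D (a * x (Fin.last 3)) *ᵥ v) a := by
  have hpi : ∀ i, HasFDerivAt (fun y => groupIso D P v a y i)
      ((ContinuousLinearMap.proj i).comp (Matrix.toLin'
        (blockMatrix P (expFlow D (a * x (Fin.last 3)) *ᵥ v) a)).toContinuousLinearMap) x := by
    have hl : HasFDerivAt (fun y : R4 => y (Fin.last 3))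
      (ContinuousLinearMap.proj (R := ℝ) (φ := fun _ : Fin 4 => ℝ) (Fin.last 3)) x :=
        hasFDerivAt_apply _ _
    intro i
    refine Fin.lastCases ?_ (fun i => ?_) i
    · have e : (fun y => groupIso D P v a y (Fin.last 3)) = fun y : R4 => a * y (Fin.last 3) := by
        funext y; simp only [groupIso, Fin.snoc_last]
      rw [e]
      refine (hl.const_mul a).congr_fderiv ?_
      ext u
      simp only [_root_.smul_apply, ContinuousLinearMap.proj_apply, smul_eq_mul,
        ContinuousLinearMap.comp_apply, LinearMap.coe_toContinuousLinearMap', Matrix.toLin'_apply,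
        blockMatrix_mulVec, Fin.snoc_last]
    · have e : (fun y => groupIso D P v a y i.castSucc)
          = fun y : R4 => ∑ j, P i j * y j.castSucc + shear D v a (y (Fin.last 3)) i := by
        funext y
        simp only [groupIso, Fin.snoc_castSucc, Pi.add_apply, Matrix.mulVec, dotProduct, Fin.init]
      rw [e]
      have h1 : HasFDerivAt (fun y : R4 => ∑ j, P i j * y j.castSucc)
          (∑ j, P i j • ContinuousLinearMap.proj (R := ℝ) (φ := fun _ : Fin 4 => ℝ) j.castSucc) x :=
        HasFDerivAt.fun_sum fun j _ => (hasFDerivAt_apply _ _).const_mul _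
      have h2 := HasDerivAt.comp_hasFDerivAt (f := fun y : R4 => y (Fin.last 3)) x
        (h₂ := fun s => shear D v a s i) (hasDerivAt_shear D v a _ i) hl
      refine (h1.add h2).congr_fderiv ?_
      ext u
      simp only [_root_.add_apply, _root_.sum_apply,
        _root_.smul_apply, ContinuousLinearMap.proj_apply, smul_eq_mul,
        ContinuousLinearMap.comp_apply, LinearMap.coe_toContinuousLinearMap', Matrix.toLin'_apply,
        blockMatrix_mulVec, Fin.snoc_castSucc, Pi.add_apply, Pi.smul_apply, Matrix.mulVec,
        dotProduct, Fin.init]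
      ring
  have h : HasFDerivAt (groupIso D P v a) (Matrix.toLin'
        (blockMatrix P (expFlow D (a * x (Fin.last 3)) *ᵥ v) a)).toContinuousLinearMap x :=
    hasFDerivAt_pi'.2 hpi
  rw [jacobian, h.fderiv]
  exact LinearMap.toMatrix'_toLin' _

/-- The inverse of `groupIso`. -/
def groupIsoInv (D : Matrix (Fin 3) (Fin 3) ℝ) (P : Matrix (Fin 3) (Fin 3) ℝ) (v : Fin 3 → ℝ)
    (a : ℝ) (y : R4) : R4 :=
  Fin.snoc (α := fun _ => ℝ)
    (P⁻¹ *ᵥ (Fin.init y - shear D v a (a⁻¹ * y (Fin.last 3)))) (a⁻¹ * y (Fin.last 3))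

theorem contDiff_groupIsoInv (D P : Matrix (Fin 3) (Fin 3) ℝ) (v : Fin 3 → ℝ) (a : ℝ) :
    ContDiff ℝ ∞ (groupIsoInv D P v a) := by
  rw [contDiff_pi]
  intro i
  have hl : ContDiff ℝ ∞ fun y : R4 => a⁻¹ * y (Fin.last 3) :=
    contDiff_const.mul (contDiff_apply ℝ ℝ _)
  refine Fin.lastCases ?_ (fun i => ?_) i
  · simp only [groupIsoInv, Fin.snoc_last]
    exact hl
  · simp only [groupIsoInv, Fin.snoc_castSucc, Matrix.mulVec, dotProduct]
    exact ContDiff.sum fun j _ => contDiff_const.mul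
      ((contDiff_apply ℝ ℝ _).sub ((contDiff_shear D v a j).comp hl))

/-- The isomorphism of groups with differential `blockMatrix P v a` at the identity, as a
diffeomorphism. -/
def groupDiffeo (D P : Matrix (Fin 3) (Fin 3) ℝ) (hP : IsUnit P.det) (v : Fin 3 → ℝ) (a : ℝ)
    (ha : a ≠ 0) : R4 ≃ₘ^∞⟮𝓘(ℝ, R4), 𝓘(ℝ, R4)⟯ R4 where
  toFun := groupIso D P v a
  invFun := groupIsoInv D P v a
  left_inv x := by
    have h : ∀ y : R4, y (Fin.last 3) = a * x (Fin.last 3) →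
        a⁻¹ * y (Fin.last 3) = x (Fin.last 3) := by
      intro y hy; rw [hy]; field_simp
    have h0 : groupIso D P v a x (Fin.last 3) = a * x (Fin.last 3) := by
      rw [groupIso, Fin.snoc_last]
    have h1 : Fin.init (α := fun _ : Fin 4 => ℝ) (groupIso D P v a x)
        = P *ᵥ Fin.init x + shear D v a (x (Fin.last 3)) := by
      rw [groupIso, Fin.init_snoc]
    rw [groupIsoInv, h _ h0, h1, add_sub_cancel_right, Matrix.mulVec_mulVec, Matrix.nonsing_inv_mul _ hP,
      Matrix.one_mulVec]
    exact Fin.snoc_init_self x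
  right_inv y := by
    have h : a * (a⁻¹ * y (Fin.last 3)) = y (Fin.last 3) := by field_simp
    rw [groupIso, groupIsoInv, Fin.snoc_last, Fin.init_snoc, Matrix.mulVec_mulVec, Matrix.mul_nonsing_inv _ hP,
      Matrix.one_mulVec, sub_add_cancel, h]
    exact Fin.snoc_init_self y
  contMDiff_toFun := (contDiff_groupIso D P v a).contMDiff
  contMDiff_invFun := (contDiff_groupIsoInv D P v a).contMDiff

/-- An isomorphism of Lie algebras which is a homothety of the inner products induces a homothety
of the left-invariant metrics. -/
theorem homothetic_of_blockMatrix {D D' P : Matrix (Fin 3) (Fin 3) ℝ}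
    {Q : Matrix (Fin 4) (Fin 4) ℝ} {v : Fin 3 → ℝ} {a c : ℝ} (hP : IsUnit P.det) (ha : a ≠ 0)
    (hc : 0 < c) (hD : a • (D' * P) = P * D)
    (hQ : (blockMatrix P v a)ᵀ * blockMatrix P v a = c • Q) :
    Homothetic (leftInvariantMetric D Q) (leftInvariantMetric D' 1) := by
  refine ⟨c, hc, groupDiffeo D' P hP v a ha, fun x => ?_⟩
  have hj : jacobian (groupDiffeo D' P hP v a ha) x
      = blockMatrix P (expFlow D' (a * x (Fin.last 3)) *ᵥ v) a := jacobian_groupIso D' P v a x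
  have hl : groupDiffeo D' P hP v a ha x (Fin.last 3) = a * x (Fin.last 3) := by
    change groupIso D' P v a x (Fin.last 3) = _
    rw [groupIso, Fin.snoc_last]
  set s := x (Fin.last 3) with hs
  have key : translationMatrix D' (-(a * s)) * blockMatrix P (expFlow D' (a * s) *ᵥ v) a
      = blockMatrix P v a * translationMatrix D (-s) := by
    rw [translationMatrix, blockMatrix_mul, translationMatrix, blockMatrix_mul,
      Matrix.mulVec_mulVec, expFlow_neg_mul, ← mul_neg,
      expFlow_conj ((Matrix.isUnit_iff_isUnit_det P).2 hP) hD]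
    simp
  rw [pullback_eq, leftInvariantMetric_apply, leftInvariantMetric_apply, hj, hl, Matrix.mul_one,
    ← hs]
  calc _ = (translationMatrix D' (-(a * s)) * blockMatrix P (expFlow D' (a * s) *ᵥ v) a)ᵀ *
        (translationMatrix D' (-(a * s)) * blockMatrix P (expFlow D' (a * s) *ᵥ v) a) := by
        rw [Matrix.transpose_mul]
        simp only [Matrix.mul_assoc]
    _ = (translationMatrix D (-s))ᵀ * ((blockMatrix P v a)ᵀ * blockMatrix P v a) *
        translationMatrix D (-s) := by
        rw [key, Matrix.transpose_mul]
        simp only [Matrix.mul_assoc]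
    _ = _ := by
        rw [hQ, Matrix.mul_smul, Matrix.smul_mul]

/-- Rotating the orthonormal basis and rescaling changes the metric by a homothety only. -/
theorem homothetic_conj {O : Matrix (Fin 3) (Fin 3) ℝ} (hO : Oᵀ * O = 1) {c : ℝ} (hc : c ≠ 0)
    (B : Matrix (Fin 3) (Fin 3) ℝ) : Homothetic (metricOf B) (metricOf (c • (O * B * Oᵀ))) := by
  have hu : IsUnit O.det := Matrix.isUnit_det_of_left_inverse hO
  refine homothetic_of_blockMatrix (P := c⁻¹ • O) (v := 0) (a := c⁻¹) (c := (c⁻¹) ^ 2) ?_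
    (inv_ne_zero hc) (by positivity) ?_ ?_
  · rw [Matrix.det_smul]
    exact ((isUnit_iff_ne_zero.2 (inv_ne_zero hc)).pow _).mul hu
  · simp only [derivationOf, Matrix.transpose_smul, Matrix.transpose_mul, Matrix.transpose_transpose,
      Matrix.neg_mul, Matrix.mul_neg, Matrix.smul_mul, Matrix.mul_smul, Matrix.mul_assoc, hO,
      Matrix.mul_one, smul_neg, smul_smul]
    congr 2
    field_simp
  · rw [blockMatrix_transpose, blockMatrix_mul, Matrix.transpose_smul, Matrix.smul_mul,
      Matrix.mul_smul, hO, smul_smul, ← sq]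
    ext i j
    refine Fin.lastCases ?_ (fun i => ?_) i <;> refine Fin.lastCases ?_ (fun j => ?_) j
    · rw [blockMatrix_last_last, Matrix.smul_apply, Matrix.one_apply_eq, smul_eq_mul, mul_one, sq]
    · rw [blockMatrix_last_castSucc, Matrix.smul_apply,
        Matrix.one_apply_ne (Fin.castSucc_ne_last _).symm, smul_zero]
    · rw [blockMatrix_castSucc_last, Matrix.smul_apply,
        Matrix.one_apply_ne (Fin.castSucc_ne_last _), smul_zero]
      simp
    · rw [blockMatrix_castSucc_castSucc, Matrix.smul_apply, Matrix.smul_apply, Matrix.one_apply,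
        Matrix.one_apply]
      simp only [Fin.castSucc_inj]

/-- If the symmetric and the skew-symmetric part of the derivation commute, then the metric does
not depend on the skew-symmetric part. -/
theorem metricOf_add_of_commute {S A : Matrix (Fin 3) (Fin 3) ℝ} (hS : Sᵀ = S) (hA : Aᵀ = -A)
    (h : Commute S A) : metricOf (S + A) = metricOf S := by
  funext p
  rw [metricOf, metricOf, leftInvariantMetric_apply, leftInvariantMetric_apply]
  have key : ∀ s : ℝ, (expFlow (derivationOf (S + A)) s)ᵀ * expFlow (derivationOf (S + A)) s
      = (expFlow (derivationOf S) s)ᵀ * expFlow (derivationOf S) s := by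
    intro s
    have e1 : derivationOf (S + A) = -S + A := by
      rw [derivationOf, Matrix.transpose_add, hS, hA]; abel
    have e2 : derivationOf S = -S := by rw [derivationOf, hS]
    have hc : Commute (s • -S) (s • A) := ((h.neg_left).smul_left s).smul_right s
    have e3 : expFlow (-S + A) s = expFlow A s * expFlow (-S) s := by
      rw [expFlow, smul_add, add_comm, Matrix.exp_add_of_commute _ _ hc.symm, expFlow, expFlow]
    have e4 : (expFlow A s)ᵀ = expFlow A (-s) := by
      rw [expFlow, ← Matrix.exp_transpose, Matrix.transpose_smul, hA, expFlow, smul_neg, neg_smul]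
    rw [e1, e2, e3, Matrix.transpose_mul, e4, Matrix.mul_assoc, ← Matrix.mul_assoc (expFlow A (-s)),
      expFlow_neg_mul, Matrix.one_mul]
  simp only [Matrix.mul_one, translationMatrix, blockMatrix_transpose, blockMatrix_mul, key]
  simp

open scoped MatrixOrder Matrix.Norms.L2Operator in
theorem exists_transpose_mul_self {R : Matrix (Fin 3) (Fin 3) ℝ} (hR : R.PosSemidef) :
    ∃ P : Matrix (Fin 3) (Fin 3) ℝ, R = Pᵀ * P := by
  obtain ⟨P, hP⟩ := CStarAlgebra.nonneg_iff_eq_star_mul_self.mp hR.nonneg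
  refine ⟨P, ?_⟩
  rwa [Matrix.star_eq_conjTranspose, Matrix.conjTranspose_eq_transpose_of_trivial] at hP

/-- The Cholesky factorization of `Q` into blocks: an orthonormal basis of the Lie algebra of which
three vectors lie in the ideal `ℝ³`. -/
theorem exists_blockMatrix_transpose_mul_self {Q : Matrix (Fin 4) (Fin 4) ℝ} (hQ : Q.PosDef) :
    ∃ (P : Matrix (Fin 3) (Fin 3) ℝ) (v : Fin 3 → ℝ) (a : ℝ), IsUnit P.det ∧ a ≠ 0 ∧
      (blockMatrix P v a)ᵀ * blockMatrix P v a = Q := by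
  have hR : (Q.submatrix Fin.castSucc Fin.castSucc).PosDef :=
    hQ.submatrix (Fin.castSucc_injective 3)
  obtain ⟨P, hP⟩ := exists_transpose_mul_self hR.posSemidef
  have hu : IsUnit P.det := by
    have := hR.det_pos.ne'
    rw [hP, Matrix.det_mul, Matrix.det_transpose] at this
    exact isUnit_iff_ne_zero.2 (left_ne_zero_of_mul this)
  have sum4 : ∀ f : Fin 4 → ℝ, ∑ i, f i = ∑ i : Fin 3, f i.castSucc + f (Fin.last 3) :=
    Fin.sum_univ_castSucc
  have huT : IsUnit (Pᵀ).det := by rwa [Matrix.det_transpose]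
  have hs : ∀ i j, Q i j = Q j i := fun i j => (congrFun (congrFun hQ.isHermitian i) j).symm
  set q : Fin 3 → ℝ := fun i => Q i.castSucc (Fin.last 3) with hq
  set v : Fin 3 → ℝ := (Pᵀ)⁻¹ *ᵥ q with hv
  have hPv : Pᵀ *ᵥ v = q := by
    rw [hv, Matrix.mulVec_mulVec, Matrix.mul_nonsing_inv _ huT, Matrix.one_mulVec]
  -- the Schur complement of the upper left block
  have hpos : 0 < Q (Fin.last 3) (Fin.last 3) - v ⬝ᵥ v := by
    set w : Fin 3 → ℝ := P⁻¹ *ᵥ v with hw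
    have hPw : P *ᵥ w = v := by
      rw [hw, Matrix.mulVec_mulVec, Matrix.mul_nonsing_inv _ hu, Matrix.one_mulVec]
    have hne : (Fin.snoc (α := fun _ => ℝ) (-w) 1 : R4) ≠ 0 := by
      intro h
      have := congrFun h (Fin.last 3)
      rw [Fin.snoc_last] at this
      exact one_ne_zero this
    have h := hQ.dotProduct_mulVec_pos hne
    have hRw : ∀ i, ∑ j, Q (Fin.castSucc i) (Fin.castSucc j) * w j = q i := by
      intro i
      have : (Q.submatrix Fin.castSucc Fin.castSucc) *ᵥ w = q := by
        rw [hP, ← Matrix.mulVec_mulVec, hPw, hPv]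
      exact congrFun this i
    have hqw : ∑ j, q j * w j = v ⬝ᵥ v := by
      change q ⬝ᵥ w = _
      rw [← hPv, Matrix.mulVec_transpose, ← Matrix.dotProduct_mulVec, hPw]
    simp only [star_trivial, dotProduct, Matrix.mulVec, sum4, Fin.snoc_castSucc,
      Fin.snoc_last, Pi.neg_apply, mul_neg, mul_one, neg_mul, Finset.sum_neg_distrib, hRw,
      one_mul] at h
    simp only [fun i => hs (Fin.last 3) (Fin.castSucc i)] at h
    change 0 < -∑ i, w i * (-q i + q i) + (-∑ j, q j * w j + Q (Fin.last 3) (Fin.last 3)) at h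
    rw [hqw] at h
    simp only [neg_add_cancel, mul_zero, Finset.sum_const_zero] at h
    linarith
  refine ⟨P, v, √(Q (Fin.last 3) (Fin.last 3) - v ⬝ᵥ v), hu, (Real.sqrt_pos.2 hpos).ne', ?_⟩
  ext i j
  have hPP : ∀ i j : Fin 3, ∑ k, P k i * P k j = Q i.castSucc j.castSucc := fun i j =>
    (congrFun (congrFun hP i) j).symm
  have hPq : ∀ i : Fin 3, ∑ k, P k i * v k = Q i.castSucc (Fin.last 3) := fun i =>
    congrFun hPv i
  refine Fin.lastCases ?_ (fun i => ?_) i <;> refine Fin.lastCases ?_ (fun j => ?_) j <;>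
  simp only [Matrix.mul_apply, Matrix.transpose_apply, sum4,
    blockMatrix_castSucc_castSucc, blockMatrix_castSucc_last, blockMatrix_last_castSucc,
    blockMatrix_last_last, mul_zero, zero_mul, add_zero, hPP, hPq]
  · rw [Real.mul_self_sqrt hpos.le]
    simp only [dotProduct]
    ring
  · rw [hs, ← hPq]
    exact Finset.sum_congr rfl fun k _ => mul_comm _ _

/-- Every left-invariant metric is, up to homothety, determined by brackets in an orthonormal basis. -/
theorem exists_homothetic_metricOf (D : Matrix (Fin 3) (Fin 3) ℝ) {Q : Matrix (Fin 4) (Fin 4) ℝ}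
    (hQ : Q.PosDef) : ∃ B, Homothetic (leftInvariantMetric D Q) (metricOf B) := by
  obtain ⟨P, v, a, hP, ha, h⟩ := exists_blockMatrix_transpose_mul_self hQ
  refine ⟨-(a⁻¹ • (P * D * P⁻¹))ᵀ, ?_⟩
  have e : derivationOf (-(a⁻¹ • (P * D * P⁻¹))ᵀ) = a⁻¹ • (P * D * P⁻¹) := by
    rw [derivationOf, Matrix.transpose_neg, neg_neg, Matrix.transpose_transpose]
  rw [metricOf, e]
  refine homothetic_of_blockMatrix hP ha one_pos ?_ (by rw [h, one_smul])
  rw [Matrix.smul_mul, smul_smul, mul_inv_cancel₀ ha, one_smul, Matrix.mul_assoc,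
    Matrix.nonsing_inv_mul _ hP, Matrix.mul_one]

theorem eq_normalForm {B : Matrix (Fin 3) (Fin 3) ℝ} (h : ∀ i j, i ≠ j → B i j + B j i = 0) :
    B = normalForm (B 0 0) (B 1 1) (B 2 2) (B 1 2) (B 2 0) (B 0 1) := by
  ext i j
  have h1 := h 0 1 (by decide)
  have h2 := h 0 2 (by decide)
  have h3 := h 1 2 (by decide)
  fin_cases i <;> fin_cases j <;> simp [normalForm] <;> linarith

/-- The spectral theorem for the symmetric part of `B`. -/
theorem exists_conj_eq_normalForm (B : Matrix (Fin 3) (Fin 3) ℝ) :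
    ∃ O : Matrix (Fin 3) (Fin 3) ℝ, Oᵀ * O = 1 ∧
      ∃ a₁ a₂ a₃ x y z, O * B * Oᵀ = normalForm a₁ a₂ a₃ x y z := by
  have hS : (B + Bᵀ).IsHermitian := by
    rw [Matrix.IsHermitian, Matrix.conjTranspose_eq_transpose_of_trivial, Matrix.transpose_add,
      Matrix.transpose_transpose, add_comm]
  set U : Matrix (Fin 3) (Fin 3) ℝ := (hS.eigenvectorUnitary).1 with hU
  have hUU : U * Uᵀ = 1 := by
    have := Unitary.coe_mul_star_self hS.eigenvectorUnitary
    rwa [Unitary.coe_star, Matrix.star_eq_conjTranspose,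
      Matrix.conjTranspose_eq_transpose_of_trivial] at this
  have hd := hS.conjStarAlgAut_star_eigenvectorUnitary
  rw [Unitary.conjStarAlgAut_star_apply, Matrix.star_eq_conjTranspose,
    Matrix.conjTranspose_eq_transpose_of_trivial, ← hU] at hd
  refine ⟨Uᵀ, by rwa [Matrix.transpose_transpose], _, _, _, _, _, _,
    eq_normalForm fun i j hij => ?_⟩
  rw [Matrix.transpose_transpose]
  have e : (Uᵀ * B * U) j i = (Uᵀ * Bᵀ * U) i j := by
    have : (Uᵀ * B * U)ᵀ = Uᵀ * Bᵀ * U := by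
      simp only [Matrix.transpose_mul, Matrix.transpose_transpose, Matrix.mul_assoc]
    rw [← this, Matrix.transpose_apply]
  rw [e, ← Matrix.add_apply, ← Matrix.add_mul, ← Matrix.mul_add, hd,
    Matrix.diagonal_apply_ne _ hij]

theorem exists_homothetic_normalForm (D : Matrix (Fin 3) (Fin 3) ℝ)
    {Q : Matrix (Fin 4) (Fin 4) ℝ} (hQ : Q.PosDef) : ∃ a₁ a₂ a₃ x y z,
    Homothetic (leftInvariantMetric D Q) (metricOf (normalForm a₁ a₂ a₃ x y z)) := by
  obtain ⟨B, hB⟩ := exists_homothetic_metricOf D hQ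
  obtain ⟨O, hO, a₁, a₂, a₃, x, y, z, h⟩ := exists_conj_eq_normalForm B
  refine ⟨a₁, a₂, a₃, x, y, z, hB.trans ?_⟩
  have := homothetic_conj hO one_ne_zero B
  rwa [h, one_smul] at this

section
/-! ### Symmetries of the normal form -/

/-- The metric in the normal form with the given parameters is homothetic to a metric of one of the
seven families, with parameter `t`. -/
def IsListed (a₁ a₂ a₃ x y z t : ℝ) : Prop :=
  ∃ B, (ZeroEnergyFamily B t ∨ ∃ E, NonzeroEnergyFamily B t E) ∧
    Homothetic (metricOf (normalForm a₁ a₂ a₃ x y z)) (metricOf B)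

variable {a₁ a₂ a₃ x y z t : ℝ}

theorem IsListed.of_homothetic {b₁ b₂ b₃ x' y' z' : ℝ}
    (h : Homothetic (metricOf (normalForm a₁ a₂ a₃ x y z)) (metricOf (normalForm b₁ b₂ b₃ x' y' z')))
    (h' : IsListed b₁ b₂ b₃ x' y' z' t) : IsListed a₁ a₂ a₃ x y z t := by
  obtain ⟨B, hB, hh⟩ := h'
  exact ⟨B, hB, h.trans hh⟩

theorem CriticalEquations.of_homothetic {b₁ b₂ b₃ x' y' z' : ℝ}
    (h' : CriticalEquations a₁ a₂ a₃ x y z t)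
    (h : Homothetic (metricOf (normalForm a₁ a₂ a₃ x y z))
      (metricOf (normalForm b₁ b₂ b₃ x' y' z'))) : CriticalEquations b₁ b₂ b₃ x' y' z' t := by
  rw [← isCritical_normalForm_iff] at h' ⊢
  exact (h.isCritical_iff (isSmoothMetric_metricOf _) (isSmoothMetric_metricOf _) t).1 h'

theorem homothetic_normalForm_of_conj {b₁ b₂ b₃ x' y' z' : ℝ} {O : Matrix (Fin 3) (Fin 3) ℝ}
    (hO : Oᵀ * O = 1) {c : ℝ} (hc : c ≠ 0)
    (h : c • (O * normalForm a₁ a₂ a₃ x y z * Oᵀ) = normalForm b₁ b₂ b₃ x' y' z') :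
    Homothetic (metricOf (normalForm a₁ a₂ a₃ x y z))
      (metricOf (normalForm b₁ b₂ b₃ x' y' z')) :=
  h ▸ homothetic_conj hO hc _

/-- The constant `c` may be negative, as `e₄` may be replaced by `-e₄`. -/
theorem homothetic_normalForm_smul (a₁ a₂ a₃ x y z : ℝ) {c : ℝ} (hc : c ≠ 0) :
    Homothetic (metricOf (normalForm a₁ a₂ a₃ x y z))
      (metricOf (normalForm (c * a₁) (c * a₂) (c * a₃) (c * x) (c * y) (c * z))) := by
  refine homothetic_normalForm_of_conj (O := 1) (by simp) hc ?_
  ext i j; fin_cases i <;> fin_cases j <;> simp [normalForm]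

/-- The cyclic permutation of `e₁, e₂, e₃`. -/
theorem homothetic_normalForm_rotate (a₁ a₂ a₃ x y z : ℝ) :
    Homothetic (metricOf (normalForm a₁ a₂ a₃ x y z))
      (metricOf (normalForm a₂ a₃ a₁ y z x)) := by
  refine homothetic_normalForm_of_conj (O := !![0, 1, 0; 0, 0, 1; 1, 0, 0]) ?_ one_ne_zero ?_
  · ext i j; fin_cases i <;> fin_cases j <;> simp [Matrix.mul_apply, Fin.sum_univ_three]
  · ext i j; fin_cases i <;> fin_cases j <;>
      simp [normalForm, Matrix.vecMul, dotProduct, Fin.sum_univ_three]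

/-- The exchange of `e₁` and `e₂`. -/
theorem homothetic_normalForm_swap (a₁ a₂ a₃ x y z : ℝ) :
    Homothetic (metricOf (normalForm a₁ a₂ a₃ x y z))
      (metricOf (normalForm a₂ a₁ a₃ (-y) (-x) (-z))) := by
  refine homothetic_normalForm_of_conj (O := !![0, 1, 0; 1, 0, 0; 0, 0, 1]) ?_ one_ne_zero ?_
  · ext i j; fin_cases i <;> fin_cases j <;> simp [Matrix.mul_apply, Fin.sum_univ_three]
  · ext i j; fin_cases i <;> fin_cases j <;>
      simp [normalForm, Matrix.vecMul, dotProduct, Fin.sum_univ_three]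

/-- The change of sign of `e₁`. -/
theorem homothetic_normalForm_neg (a₁ a₂ a₃ x y z : ℝ) :
    Homothetic (metricOf (normalForm a₁ a₂ a₃ x y z))
      (metricOf (normalForm a₁ a₂ a₃ x (-y) (-z))) := by
  refine homothetic_normalForm_of_conj (O := !![-1, 0, 0; 0, 1, 0; 0, 0, 1]) ?_ one_ne_zero ?_
  · ext i j; fin_cases i <;> fin_cases j <;> simp [Matrix.mul_apply, Fin.sum_univ_three]
  · ext i j; fin_cases i <;> fin_cases j <;>
      simp [normalForm, Matrix.vecMul, dotProduct, Fin.sum_univ_three]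

/-- The exchange of `e₂` and `e₃`. -/
theorem homothetic_normalForm_swap' (a₁ a₂ a₃ x y z : ℝ) :
    Homothetic (metricOf (normalForm a₁ a₂ a₃ x y z))
      (metricOf (normalForm a₁ a₃ a₂ (-x) (-z) (-y))) :=
  (homothetic_normalForm_rotate _ _ _ _ _ _).trans ((homothetic_normalForm_swap _ _ _ _ _ _).trans
    ((homothetic_normalForm_rotate _ _ _ _ _ _).trans (homothetic_normalForm_rotate _ _ _ _ _ _)))

/-- The change of sign of `e₂`. -/
theorem homothetic_normalForm_neg' (a₁ a₂ a₃ x y z : ℝ) :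
    Homothetic (metricOf (normalForm a₁ a₂ a₃ x y z))
      (metricOf (normalForm a₁ a₂ a₃ (-x) y (-z))) :=
  (homothetic_normalForm_rotate _ _ _ _ _ _).trans ((homothetic_normalForm_neg _ _ _ _ _ _).trans
    ((homothetic_normalForm_rotate _ _ _ _ _ _).trans (homothetic_normalForm_rotate _ _ _ _ _ _)))

/-- A rotation in the plane of a double eigenvalue makes one of the skew-symmetric entries
vanish. -/
theorem homothetic_normalForm_rotatePlane (a b x y : ℝ) (h : 0 < x ^ 2 + y ^ 2) :
    Homothetic (metricOf (normalForm a a b x y 0))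
      (metricOf (normalForm a a b (√(x ^ 2 + y ^ 2)) 0 0)) := by
  set r := √(x ^ 2 + y ^ 2) with hr
  have hr0 : 0 < r := Real.sqrt_pos.2 h
  have hr2 : r ^ 2 = x ^ 2 + y ^ 2 := Real.sq_sqrt h.le
  refine homothetic_normalForm_of_conj
    (O := !![x / r, y / r, 0; -(y / r), x / r, 0; 0, 0, 1]) ?_ one_ne_zero ?_
  all_goals
    have e : (x / r) ^ 2 + (y / r) ^ 2 = 1 := by
      rw [div_pow, div_pow, ← add_div, hr2, div_self h.ne']
    have e1 : x / r * x + y / r * y = r := by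
      field_simp; linear_combination -hr2
  · ext i j; fin_cases i <;> fin_cases j <;> simp [Matrix.mul_apply, Fin.sum_univ_three] <;>
      first
        | ring1
        | linear_combination e
  · ext i j; fin_cases i <;> fin_cases j <;>
      simp [normalForm, Matrix.vecMul, dotProduct, Fin.sum_univ_three] <;>
      first
        | ring1
        | linear_combination a * e
        | linear_combination e1
        | linear_combination -e1

/-- If the symmetric part commutes with the skew-symmetric part, then the latter may be dropped. -/
theorem metricOf_normalForm_of_commNormSq_eq_zero (h : commNormSq a₁ a₂ a₃ x y z = 0) :
    metricOf (normalForm a₁ a₂ a₃ x y z) = metricOf (normalForm a₁ a₂ a₃ 0 0 0) := by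
  have key : z * (a₁ - a₂) = 0 ∧ y * (a₃ - a₁) = 0 ∧ x * (a₂ - a₃) = 0 := by
    rw [commNormSq] at h
    refine ⟨?_, ?_, ?_⟩ <;> rw [← sq_eq_zero_iff] <;>
      nlinarith [sq_nonneg (z * (a₁ - a₂)), sq_nonneg (y * (a₃ - a₁)), sq_nonneg (x * (a₂ - a₃))]
  obtain ⟨h1, h2, h3⟩ := key
  have e : normalForm a₁ a₂ a₃ x y z = normalForm a₁ a₂ a₃ 0 0 0 + normalForm 0 0 0 x y z := by
    ext i j; fin_cases i <;> fin_cases j <;> simp [normalForm]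
  rw [e]
  refine metricOf_add_of_commute ?_ ?_ ?_
  · ext i j; fin_cases i <;> fin_cases j <;> simp [normalForm]
  · ext i j; fin_cases i <;> fin_cases j <;> simp [normalForm]
  · rw [Commute, SemiconjBy]
    ext i j
    fin_cases i <;> fin_cases j <;> simp [normalForm] <;>
      first
        | ring1
        | linear_combination h1
        | linear_combination h2
        | linear_combination h3
        | linear_combination -h1
        | linear_combination -h2
        | linear_combination -h3

end

section
/-! ### Critical metrics with self-adjoint derivation -/

variable {a₁ a₂ a₃ x y z t : ℝ}

theorem isListed_one_of_not {f p : ℝ} (hf : -1 ≤ f) (hfp : f ≤ p) (hp : p ≤ 1)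
    (hn : ¬ (f = -1 ∧ p < 0)) (hu : defect 1 f p t = 0)
    (hs : ¬ (1 * f * (1 - f) = 0 ∧ 1 * p * (1 - p) = 0 ∧ f * p * (f - p) = 0)) :
    IsListed 1 f p 0 0 0 t := by
  refine ⟨!![1, 0, 0; 0, f, 0; 0, 0, p], Or.inl (Or.inr (Or.inr (Or.inl
    ⟨f, p, hf, hfp, hp, fun h => hn ⟨h.1, h.2.2⟩, ?_, ?_, ?_, rfl, ?_⟩))), ?_⟩
  · rintro ⟨rfl, rfl⟩; norm_num at hs
  · rintro ⟨rfl, rfl⟩; norm_num at hs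
  · rintro ⟨rfl, rfl⟩; norm_num at hs
  · have h0 : 0 < f ^ 2 + p ^ 2 + f * p + f + p + 1 := by
      nlinarith [sq_nonneg (f + p + 1), sq_nonneg f, sq_nonneg p]
    rw [defect] at hu
    rw [eq_neg_iff_add_eq_zero]
    field_simp
    linear_combination hu
  · have e : normalForm 1 f p 0 0 0 = !![1, 0, 0; 0, f, 0; 0, 0, p] := by
      ext i j; fin_cases i <;> fin_cases j <;> simp [normalForm]
    rw [← e]
    simpa [normalForm] using homothetic_normalForm_smul 1 f p 0 0 0 one_ne_zero

/-- If `f = -1` and `p < 0`, then the opposite derivation has the eigenvalues `1, -1, -p` in the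
range of the third family. -/
theorem isListed_one_of_le {f p : ℝ} (hf : -1 ≤ f) (hfp : f ≤ p) (hp : p ≤ 1)
    (hu : defect 1 f p t = 0)
    (hs : ¬ (1 * f * (1 - f) = 0 ∧ 1 * p * (1 - p) = 0 ∧ f * p * (f - p) = 0)) :
    IsListed 1 f p 0 0 0 t := by
  by_cases hn : f = -1 ∧ p < 0
  · obtain ⟨rfl, hp0⟩ := hn
    have h1 := homothetic_normalForm_smul 1 (-1) p 0 0 0 (c := -1) (by norm_num)
    have h2 := homothetic_normalForm_swap (-1 * 1) (-1 * -1) (-1 * p) (-1 * 0) (-1 * 0) (-1 * 0)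
    refine IsListed.of_homothetic (b₁ := 1) (b₂ := -1) (b₃ := -p) (x' := 0) (y' := 0) (z' := 0)
      (by simpa using h1.trans h2)
      (isListed_one_of_not le_rfl (by linarith) (by linarith) (fun h => by linarith [h.2]) ?_ ?_)
    · rw [defect] at hu ⊢
      linear_combination hu
    · rintro ⟨h3, -, -⟩; norm_num at h3
  · exact isListed_one_of_not hf hfp hp hn hu hs

/-- Dividing by the eigenvalue of largest modulus and ordering the two others normalizes a diagonal
derivation. -/
theorem isListed_diagonal_of_abs_le (h1 : a₁ ≠ 0) (h2 : |a₂| ≤ |a₁|) (h3 : |a₃| ≤ |a₁|)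
    (hu : defect a₁ a₂ a₃ t = 0)
    (hs : ¬ (a₁ * a₂ * (a₁ - a₂) = 0 ∧ a₁ * a₃ * (a₁ - a₃) = 0 ∧ a₂ * a₃ * (a₂ - a₃) = 0)) :
    IsListed a₁ a₂ a₃ 0 0 0 t := by
  have hle : ∀ a : ℝ, |a| ≤ |a₁| → -1 ≤ a₁⁻¹ * a ∧ a₁⁻¹ * a ≤ 1 := by
    intro a ha
    rw [← abs_le, abs_mul, abs_inv]
    exact inv_mul_le_one_of_le₀ ha (abs_nonneg _)
  obtain ⟨l2, r2⟩ := hle _ h2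
  obtain ⟨l3, r3⟩ := hle _ h3
  have hh := homothetic_normalForm_smul a₁ a₂ a₃ 0 0 0 (inv_ne_zero h1)
  simp only [inv_mul_cancel₀ h1, mul_zero] at hh
  refine IsListed.of_homothetic hh ?_
  set f := a₁⁻¹ * a₂ with hf
  set p := a₁⁻¹ * a₃ with hp
  have ef : a₂ = a₁ * f := by rw [hf]; field_simp
  have ep : a₃ = a₁ * p := by rw [hp]; field_simp
  have hu' : defect 1 f p t = 0 := by
    rw [ef, ep, defect] at hu
    have : a₁ ^ 2 * defect 1 f p t = 0 := by
      rw [defect]; linear_combination hu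
    exact (mul_eq_zero.1 this).resolve_left (pow_ne_zero 2 h1)
  have hs' : ¬ (1 * f * (1 - f) = 0 ∧ 1 * p * (1 - p) = 0 ∧ f * p * (f - p) = 0) := by
    rintro ⟨k1, k2, k3⟩
    refine hs ⟨?_, ?_, ?_⟩
    · rw [ef]; linear_combination a₁ ^ 3 * k1
    · rw [ep]; linear_combination a₁ ^ 3 * k2
    · rw [ef, ep]; linear_combination a₁ ^ 3 * k3
  rcases le_total f p with h | h
  · exact isListed_one_of_le l2 h r3 hu' hs'
  · have h4 := homothetic_normalForm_swap' 1 f p 0 0 0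
    simp only [neg_zero] at h4
    refine IsListed.of_homothetic h4 (isListed_one_of_le l3 h r2 ?_ ?_)
    · rw [defect] at hu' ⊢
      linear_combination hu'
    · rintro ⟨k1, k2, k3⟩
      exact hs' ⟨k2, k1, by linear_combination -k3⟩

/-- The diagonal derivations: they are critical exactly if the defect vanishes. -/
theorem isListed_diagonal (hu : defect a₁ a₂ a₃ t = 0)
    (hs : ¬ (a₁ * a₂ * (a₁ - a₂) = 0 ∧ a₁ * a₃ * (a₁ - a₃) = 0 ∧ a₂ * a₃ * (a₂ - a₃) = 0)) :
    IsListed a₁ a₂ a₃ 0 0 0 t := by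
  have aux : ∀ a₁ a₂ a₃ : ℝ, |a₂| ≤ |a₁| → |a₃| ≤ |a₁| → defect a₁ a₂ a₃ t = 0 →
      ¬ (a₁ * a₂ * (a₁ - a₂) = 0 ∧ a₁ * a₃ * (a₁ - a₃) = 0 ∧ a₂ * a₃ * (a₂ - a₃) = 0) →
      IsListed a₁ a₂ a₃ 0 0 0 t := by
    intro a₁ a₂ a₃ h2 h3 hu hs
    refine isListed_diagonal_of_abs_le ?_ h2 h3 hu hs
    rintro rfl
    rw [abs_zero] at h2
    have := abs_nonpos_iff.1 h2
    subst this
    simp at hs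
  have hr := fun a₁ a₂ a₃ : ℝ => homothetic_normalForm_rotate a₁ a₂ a₃ 0 0 0
  by_cases h : |a₂| ≤ |a₁| ∧ |a₃| ≤ |a₁|
  · exact aux _ _ _ h.1 h.2 hu hs
  by_cases h' : |a₃| ≤ |a₂|
  · refine IsListed.of_homothetic (hr _ _ _) (aux _ _ _ h' ?_ ?_ ?_)
    · by_contra hc
      exact h ⟨by linarith, by linarith⟩
    · rw [defect] at hu ⊢; linear_combination hu
    · rintro ⟨k1, k2, k3⟩
      exact hs ⟨by linear_combination -k2, by linear_combination -k3, k1⟩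
  · refine IsListed.of_homothetic ((hr _ _ _).trans (hr _ _ _)) (aux _ _ _ ?_ ?_ ?_ ?_)
    · by_contra hc
      exact h ⟨by linarith, by linarith⟩
    · linarith
    · rw [defect] at hu ⊢; linear_combination hu
    · rintro ⟨k1, k2, k3⟩
      exact hs ⟨k3, by linear_combination -k1, by linear_combination -k2⟩

/-- If `S` and `A` commute, then the equation along `e₄` gives `u = 0`, as `S` is not a multiple of
the identity. -/
theorem isListed_of_commNormSq_eq_zero (h : CriticalEquations a₁ a₂ a₃ x y z t)
    (hc : commNormSq a₁ a₂ a₃ x y z = 0)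
    (hs : ¬ IsLocallySymmetric (metricOf (normalForm a₁ a₂ a₃ x y z))) :
    IsListed a₁ a₂ a₃ x y z t := by
  rw [metricOf_normalForm_of_commNormSq_eq_zero hc] at hs
  have hs' : ¬ (a₁ * a₂ * (a₁ - a₂) = 0 ∧ a₁ * a₃ * (a₁ - a₃) = 0 ∧ a₂ * a₃ * (a₂ - a₃) = 0) :=
    fun h => hs (isLocallySymmetric_normalForm h.1 h.2.1 h.2.2)
  have hr := h.radial
  rw [radialEquation, hc] at hr
  have hne : (a₁ - a₂) ^ 2 + (a₁ - a₃) ^ 2 + (a₂ - a₃) ^ 2 ≠ 0 := by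
    intro h0
    have e1 : a₁ - a₂ = 0 := by
      rw [← sq_eq_zero_iff]; nlinarith [sq_nonneg (a₁ - a₂), sq_nonneg (a₁ - a₃), sq_nonneg (a₂ - a₃)]
    have e2 : a₁ - a₃ = 0 := by
      rw [← sq_eq_zero_iff]; nlinarith [sq_nonneg (a₁ - a₂), sq_nonneg (a₁ - a₃), sq_nonneg (a₂ - a₃)]
    refine hs' ⟨by rw [e1, mul_zero], by rw [e2, mul_zero], ?_⟩
    linear_combination a₂ * a₃ * (e2 - e1)
  have hu : defect a₁ a₂ a₃ t = 0 := by
    refine (mul_eq_zero.1 (?_ : ((a₁ - a₂) ^ 2 + (a₁ - a₃) ^ 2 + (a₂ - a₃) ^ 2) * _ = 0)).resolve_left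
      hne
    linear_combination -2 * hr
  obtain ⟨B, hB, hh⟩ := isListed_diagonal hu hs'
  refine ⟨B, hB, ?_⟩
  rwa [metricOf_normalForm_of_commNormSq_eq_zero hc]

end

section
/-! ### Critical metrics of non-zero energy -/

variable {a₁ a₂ a₃ x y z t : ℝ}

theorem eq_zero_of_sq_add_eq_zero {a b c d e f : ℝ}
    (h : a ^ 2 + b ^ 2 + c ^ 2 + 18 * (d ^ 2 + e ^ 2 + f ^ 2) = 0) :
    d = 0 ∧ e = 0 ∧ f = 0 ∧ a = 0 ∧ b = 0 ∧ c = 0 := by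
  refine ⟨?_, ?_, ?_, ?_, ?_, ?_⟩ <;> rw [← sq_eq_zero_iff] <;>
    linarith [sq_nonneg a, sq_nonneg b, sq_nonneg c, sq_nonneg d, sq_nonneg e, sq_nonneg f]

/-- The identity `M = u S₀` for the double commutator `M` of the symmetric part `S` with the
skew-symmetric part: pairing the Euler–Lagrange equation with `M` and using the equation along `e₄`
one finds `θ |M - u S₀|² = 0`. -/
theorem CriticalEquations.doubleCommutator (h : CriticalEquations a₁ a₂ a₃ x y z t)
    (hθ : a₁ + a₂ + a₃ ≠ 0) :
    (a₃ - (a₁ + a₂ + a₃) / 3) * (x * y) = 0 ∧ (a₁ - (a₁ + a₂ + a₃) / 3) * (y * z) = 0 ∧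
    (a₂ - (a₁ + a₂ + a₃) / 3) * (z * x) = 0 ∧
    2 * (z ^ 2 * (a₁ - a₂) + y ^ 2 * (a₁ - a₃))
      + defect a₁ a₂ a₃ t * (a₁ - (a₁ + a₂ + a₃) / 3) = 0 ∧
    2 * (x ^ 2 * (a₂ - a₃) + z ^ 2 * (a₂ - a₁))
      + defect a₁ a₂ a₃ t * (a₂ - (a₁ + a₂ + a₃) / 3) = 0 ∧
    2 * (y ^ 2 * (a₃ - a₁) + x ^ 2 * (a₃ - a₂))
      + defect a₁ a₂ a₃ t * (a₃ - (a₁ + a₂ + a₃) / 3) = 0 := by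
  obtain ⟨h0, h1, h2, h3, h12, h23, h31⟩ := h
  have e1 : defect a₂ a₃ a₁ t = defect a₁ a₂ a₃ t := by simp only [defect]; ring
  have e2 : defect a₃ a₁ a₂ t = defect a₁ a₂ a₃ t := by simp only [defect]; ring
  simp only [radialEquation, commNormSq, diagonalEquation, mixedEquation, e1, e2]
    at h0 h1 h2 h3 h12 h23 h31
  generalize defect a₁ a₂ a₃ t = u at *
  refine eq_zero_of_sq_add_eq_zero ((mul_eq_zero.1 (?_ : (a₁ + a₂ + a₃) * _ = 0)).resolve_left hθ)
  linear_combination -(z ^ 2 * (a₁ - a₂) + y ^ 2 * (a₁ - a₃)) * h1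
    - (x ^ 2 * (a₂ - a₃) + z ^ 2 * (a₂ - a₁)) * h2
    - (y ^ 2 * (a₃ - a₁) + x ^ 2 * (a₃ - a₂)) * h3
    - 3 * (a₃ - (a₁ + a₂ + a₃) / 3) * (x * y) * h12
    - 3 * (a₁ - (a₁ + a₂ + a₃) / 3) * (y * z) * h23
    - 3 * (a₂ - (a₁ + a₂ + a₃) / 3) * (z * x) * h31
    - (2 / 3) * u * (a₁ + a₂ + a₃) * h0

/-- One non-zero skew-symmetric entry and trace one: `M = u S₀` gives `a₁ = 1 / 3` and `u = -4 x²`. -/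
theorem isListed_family6 (h : CriticalEquations a₁ a₂ a₃ x 0 0 t) (hθ : a₁ + a₂ + a₃ = 1)
    (hx : 0 < x) (hd : a₃ < a₂) : IsListed a₁ a₂ a₃ x 0 0 t := by
  obtain ⟨-, -, -, k1, k2, -⟩ := h.doubleCommutator (by rw [hθ]; exact one_ne_zero)
  have h0 := h.radial
  have h23 := h.mixed₂₃
  have e1 : defect a₂ a₃ a₁ t = defect a₁ a₂ a₃ t := by simp only [defect]; ring
  simp only [mixedEquation, e1] at h23
  simp only [radialEquation, commNormSq] at h0
  obtain ⟨u, hu⟩ : ∃ u, u = defect a₁ a₂ a₃ t := ⟨_, rfl⟩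
  rw [← hu] at h0 h23 k1 k2
  have hd' : 0 < a₂ - a₃ := sub_pos.2 hd
  -- the equation along `e₄` reads `|[S, A]|² = -u |S₀|²`
  have hu0 : u ≠ 0 := by
    rintro rfl
    have : 0 < x ^ 2 * (a₂ - a₃) ^ 2 := by positivity
    linarith
  have hb : a₁ = 1 / 3 := by
    have : u * (a₁ - 1 / 3) = 0 := by rw [hθ] at k1; linear_combination k1
    linarith [(mul_eq_zero.1 this).resolve_left hu0]
  subst hb
  have ha : a₃ = 2 / 3 - a₂ := by linarith
  subst ha
  have hd'' : a₂ - 1 / 3 ≠ 0 := by intro h; linarith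
  have hux : u = -4 * x ^ 2 := by
    have : (a₂ - 1 / 3) * (u + 4 * x ^ 2) = 0 := by linear_combination k2
    linarith [(mul_eq_zero.1 this).resolve_left hd'']
  rw [hux] at h23
  have hq : (a₂ - 1 / 3) ^ 2 = x ^ 2 + 1 / 4 := by
    have : (a₂ - 1 / 3) * x * ((a₂ - 1 / 3) ^ 2 - (x ^ 2 + 1 / 4)) = 0 := by
      linear_combination (1 / 8) * h23
    linarith [(mul_eq_zero.1 this).resolve_left (mul_ne_zero hd'' hx.ne')]
  refine ⟨!![1 / 3, 0, 0; 0, a₂, x; 0, -x, -(a₂ - 2 / 3)], Or.inr ⟨-(16 / 3) * x ^ 2,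
    Or.inl ⟨x, a₂, hx, by linarith, ?_, rfl, ?_, rfl⟩⟩, ?_⟩
  · rw [Eq6]; linear_combination 36 * hq
  · have : 0 < 12 * x ^ 2 + 11 := by positivity
    rw [hux, defect] at hu
    rw [eq_neg_iff_add_eq_zero]
    field_simp
    linear_combination (-6) * hu - 12 * (1 + t) * hq
  · have e : normalForm (1 / 3) a₂ (2 / 3 - a₂) x 0 0
        = !![1 / 3, 0, 0; 0, a₂, x; 0, -x, -(a₂ - 2 / 3)] := by
      ext i j; fin_cases i <;> fin_cases j <;> simp [normalForm]
    rw [← e]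
    simpa using homothetic_normalForm_smul (1 / 3) a₂ (2 / 3 - a₂) x 0 0 one_ne_zero

/-- Two non-zero skew-symmetric entries and trace one: `M = u S₀` gives `a₂ = 1 / 3`, `x² = z²` and
`u = -2 x²`. -/
theorem isListed_family7 (h : CriticalEquations a₁ a₂ a₃ x 0 z t) (hθ : a₁ + a₂ + a₃ = 1)
    (hx : 0 < x) (hz : 0 < z) (hd : a₃ < a₁) : IsListed a₁ a₂ a₃ x 0 z t := by
  obtain ⟨-, -, l, k1, -, k3⟩ := h.doubleCommutator (by rw [hθ]; exact one_ne_zero)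
  have h12 := h.mixed₁₂
  simp only [mixedEquation] at h12
  obtain ⟨u, hu⟩ : ∃ u, u = defect a₁ a₂ a₃ t := ⟨_, rfl⟩
  rw [← hu] at h12 k1 k3
  have hb : a₂ = 1 / 3 := by
    rw [hθ] at l
    linarith [(mul_eq_zero.1 l).resolve_right (mul_ne_zero hz.ne' hx.ne')]
  subst hb
  have ha : a₃ = 2 / 3 - a₁ := by linarith
  subst ha
  have hd' : a₁ - 1 / 3 ≠ 0 := by intro h; linarith
  have huz : u = -2 * z ^ 2 := by
    have : (a₁ - 1 / 3) * (u + 2 * z ^ 2) = 0 := by linear_combination k1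
    linarith [(mul_eq_zero.1 this).resolve_left hd']
  have hux : u = -2 * x ^ 2 := by
    have : (a₁ - 1 / 3) * (u + 2 * x ^ 2) = 0 := by linear_combination -k3
    linarith [(mul_eq_zero.1 this).resolve_left hd']
  have hxz : z = x := by
    have : z ^ 2 = x ^ 2 := by linarith
    exact (sq_eq_sq₀ hz.le hx.le).1 this
  subst hxz
  rw [hux] at h12
  have hq : (a₁ - 1 / 3) ^ 2 = 1 + 2 * z ^ 2 := by
    have : (a₁ - 1 / 3) * z * ((a₁ - 1 / 3) ^ 2 - (1 + 2 * z ^ 2)) = 0 := by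
      linear_combination h12
    linarith [(mul_eq_zero.1 this).resolve_left (mul_ne_zero hd' hx.ne')]
  refine ⟨!![a₁, z, 0; -z, 1 / 3, z; 0, -z, -(a₁ - 2 / 3)], Or.inr ⟨-(8 / 3) * z ^ 2,
    Or.inr ⟨z, a₁, hx, by linarith, ?_, rfl, ?_, rfl⟩⟩, ?_⟩
  · rw [Eq7]; linear_combination 9 * hq
  · have : 0 < 12 * z ^ 2 + 10 := by positivity
    rw [hux, defect] at hu
    rw [eq_neg_iff_add_eq_zero]
    field_simp
    linear_combination (-3) * hu - 6 * (1 + t) * hq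
  · have e : normalForm a₁ (1 / 3) (2 / 3 - a₁) z 0 z
        = !![a₁, z, 0; -z, 1 / 3, z; 0, -z, -(a₁ - 2 / 3)] := by
      ext i j; fin_cases i <;> fin_cases j <;> simp [normalForm]
    rw [← e]
    simpa using homothetic_normalForm_smul a₁ (1 / 3) (2 / 3 - a₁) z 0 z one_ne_zero

/-- The signs of `x` and of `a₂ - a₃` can be prescribed by changing the sign of `e₂` and exchanging
`e₂` and `e₃`. -/
theorem isListed_of_one_entry (h : CriticalEquations a₁ a₂ a₃ x 0 0 t) (hθ : a₁ + a₂ + a₃ = 1)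
    (hx : x ≠ 0) (hd : a₂ ≠ a₃) : IsListed a₁ a₂ a₃ x 0 0 t := by
  have pos : ∀ a₁ a₂ a₃ x, CriticalEquations a₁ a₂ a₃ x 0 0 t → a₁ + a₂ + a₃ = 1 → x ≠ 0 →
      a₃ < a₂ → IsListed a₁ a₂ a₃ x 0 0 t := by
    intro a₁ a₂ a₃ x h hθ hx hd
    rcases lt_or_gt_of_ne hx with hx | hx
    · have hh := homothetic_normalForm_neg' a₁ a₂ a₃ x 0 0
      rw [neg_zero] at hh
      exact .of_homothetic hh (isListed_family6 (h.of_homothetic hh) hθ (by linarith) hd)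
    · exact isListed_family6 h hθ hx hd
  rcases lt_or_gt_of_ne hd with hd | hd
  · have hh := homothetic_normalForm_swap' a₁ a₂ a₃ x 0 0
    rw [neg_zero] at hh
    exact .of_homothetic hh
      (pos _ _ _ _ (h.of_homothetic hh) (by linarith) (neg_ne_zero.2 hx) hd)
  · exact pos _ _ _ _ h hθ hx hd

/-- The exchange of `e₁` and `e₃`. -/
theorem homothetic_normalForm_reverse (a₁ a₂ a₃ x y z : ℝ) :
    Homothetic (metricOf (normalForm a₁ a₂ a₃ x y z))
      (metricOf (normalForm a₃ a₂ a₁ (-z) (-y) (-x))) :=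
  (homothetic_normalForm_rotate _ _ _ _ _ _).trans (homothetic_normalForm_swap' _ _ _ _ _ _) |>.trans
    ((homothetic_normalForm_rotate _ _ _ _ _ _).trans (homothetic_normalForm_rotate _ _ _ _ _ _))

/-- The signs of `x`, `z` and `a₁ - a₃` can be prescribed by changing signs of basis vectors and
exchanging `e₁` and `e₃`. -/
theorem isListed_of_two_entries (h : CriticalEquations a₁ a₂ a₃ x 0 z t) (hθ : a₁ + a₂ + a₃ = 1)
    (hx : x ≠ 0) (hz : z ≠ 0) (hd : a₁ ≠ a₃) : IsListed a₁ a₂ a₃ x 0 z t := by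
  have pos₁ : ∀ a₁ a₂ a₃ x z, CriticalEquations a₁ a₂ a₃ x 0 z t → a₁ + a₂ + a₃ = 1 → x ≠ 0 →
      0 < z → a₃ < a₁ → IsListed a₁ a₂ a₃ x 0 z t := by
    intro a₁ a₂ a₃ x z h hθ hx hz hd
    rcases lt_or_gt_of_ne hx with hx | hx
    · have hh := (homothetic_normalForm_neg' a₁ a₂ a₃ x 0 z).trans
        (homothetic_normalForm_neg _ _ _ _ _ _)
      rw [neg_zero, neg_neg] at hh
      exact .of_homothetic hh (isListed_family7 (h.of_homothetic hh) hθ (by linarith) hz hd)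
    · exact isListed_family7 h hθ hx hz hd
  have pos₂ : ∀ a₁ a₂ a₃ x z, CriticalEquations a₁ a₂ a₃ x 0 z t → a₁ + a₂ + a₃ = 1 → x ≠ 0 →
      z ≠ 0 → a₃ < a₁ → IsListed a₁ a₂ a₃ x 0 z t := by
    intro a₁ a₂ a₃ x z h hθ hx hz hd
    rcases lt_or_gt_of_ne hz with hz | hz
    · have hh := homothetic_normalForm_neg a₁ a₂ a₃ x 0 z
      rw [neg_zero] at hh
      exact .of_homothetic hh (pos₁ _ _ _ _ _ (h.of_homothetic hh) hθ hx (by linarith) hd)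
    · exact pos₁ _ _ _ _ _ h hθ hx hz hd
  rcases lt_or_gt_of_ne hd with hd | hd
  · have hh := homothetic_normalForm_reverse a₁ a₂ a₃ x 0 z
    rw [neg_zero] at hh
    exact .of_homothetic hh
      (pos₂ _ _ _ _ _ (h.of_homothetic hh) (by linarith) (neg_ne_zero.2 hz) (neg_ne_zero.2 hx) hd)
  · exact pos₂ _ _ _ _ _ h hθ hx hz hd

/-- If all of `x, y, z` were non-zero, then `M = u S₀` would give `a₁ = a₂ = a₃`. -/
theorem isListed_of_trace_eq_one (h : CriticalEquations a₁ a₂ a₃ x y z t)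
    (hθ : a₁ + a₂ + a₃ = 1) (hc : commNormSq a₁ a₂ a₃ x y z ≠ 0) :
    IsListed a₁ a₂ a₃ x y z t := by
  obtain ⟨l12, l23, l31, k1, k2, k3⟩ := h.doubleCommutator (by rw [hθ]; exact one_ne_zero)
  rw [hθ] at l12 l23 l31 k1 k2 k3
  have rot := homothetic_normalForm_rotate a₁ a₂ a₃ x y z
  have rot' := rot.trans (homothetic_normalForm_rotate _ _ _ _ _ _)
  by_cases hx : x = 0 <;> by_cases hy : y = 0 <;> by_cases hz : z = 0
  · subst hx hy hz
    exact absurd (by rw [commNormSq]; ring) hc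
  · subst hx hy
    refine .of_homothetic rot' (isListed_of_one_entry h.rotate.rotate (by linarith) hz ?_)
    rintro rfl
    exact hc (by rw [commNormSq]; ring)
  · subst hx hz
    refine .of_homothetic rot (isListed_of_one_entry h.rotate (by linarith) hy ?_)
    rintro rfl
    exact hc (by rw [commNormSq]; ring)
  · subst hx
    refine .of_homothetic rot' (isListed_of_two_entries h.rotate.rotate (by linarith) hz hy ?_)
    rintro rfl
    have h1 := (mul_eq_zero.1 l23).resolve_right (mul_ne_zero hy hz)
    exact hc (by
      rw [commNormSq, show a₃ = a₁ by linarith]; ring)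
  · subst hy hz
    refine isListed_of_one_entry h hθ hx ?_
    rintro rfl
    exact hc (by rw [commNormSq]; ring)
  · subst hy
    refine isListed_of_two_entries h hθ hx hz ?_
    rintro rfl
    have h1 := (mul_eq_zero.1 l31).resolve_right (mul_ne_zero hz hx)
    exact hc (by
      rw [commNormSq, show a₂ = a₁ by linarith]; ring)
  · subst hz
    refine .of_homothetic rot (isListed_of_two_entries h.rotate (by linarith) hy hx ?_)
    rintro rfl
    have h1 := (mul_eq_zero.1 l12).resolve_right (mul_ne_zero hx hy)
    exact hc (by
      rw [commNormSq, show a₃ = a₂ by linarith]; ring)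
  · have h1 := (mul_eq_zero.1 l12).resolve_right (mul_ne_zero hx hy)
    have h2 := (mul_eq_zero.1 l23).resolve_right (mul_ne_zero hy hz)
    have h3 := (mul_eq_zero.1 l31).resolve_right (mul_ne_zero hz hx)
    exact absurd (by
      rw [commNormSq, show a₁ = 1 / 3 by linarith, show a₂ = 1 / 3 by linarith,
        show a₃ = 1 / 3 by linarith]; ring) hc

theorem isListed_of_trace_ne_zero (h : CriticalEquations a₁ a₂ a₃ x y z t)
    (hθ : a₁ + a₂ + a₃ ≠ 0) (hc : commNormSq a₁ a₂ a₃ x y z ≠ 0) :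
    IsListed a₁ a₂ a₃ x y z t := by
  have hh := homothetic_normalForm_smul a₁ a₂ a₃ x y z (inv_ne_zero hθ)
  refine .of_homothetic hh (isListed_of_trace_eq_one (h.of_homothetic hh) ?_ fun h0 => hc ?_)
  · rw [← mul_add, ← mul_add, inv_mul_cancel₀ hθ]
  · have : ((a₁ + a₂ + a₃)⁻¹) ^ 4 * commNormSq a₁ a₂ a₃ x y z = 0 := by
      simp only [commNormSq] at h0 ⊢
      linear_combination h0
    exact (mul_eq_zero.1 this).resolve_left (pow_ne_zero 4 (inv_ne_zero hθ))

end

section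
/-! ### Critical metrics of zero energy with trace-free derivation -/

variable {a₁ a₂ a₃ x y z t : ℝ}

/-- The Euler–Lagrange equation for a trace-free derivation with one non-zero skew-symmetric entry. -/
theorem CriticalEquations.of_one_entry (h : CriticalEquations a₁ a₂ a₃ x 0 0 t)
    (hθ : a₁ + a₂ + a₃ = 0) (hx : x ≠ 0) (hd : a₂ ≠ a₃) :
    4 * x ^ 2 + (a₂ - a₃) ^ 2 + 2 * defect a₁ a₂ a₃ t = 0 ∧
    2 * x ^ 2 * (a₂ - a₃) ^ 2 + (a₁ ^ 2 + a₂ ^ 2 + a₃ ^ 2) * defect a₁ a₂ a₃ t = 0 := by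
  have h0 := h.radial
  have h23 := h.mixed₂₃
  have e1 : defect a₂ a₃ a₁ t = defect a₁ a₂ a₃ t := by simp only [defect]; ring
  have hθ' : a₂ + a₃ + a₁ = 0 := by linarith
  simp only [mixedEquation, e1, hθ'] at h23
  simp only [radialEquation, commNormSq, hθ] at h0
  generalize defect a₁ a₂ a₃ t = u at *
  refine ⟨?_, by linear_combination (-2 / 3) * h0⟩
  refine (mul_eq_zero.1 (?_ : x * (a₂ - a₃) * _ = 0)).resolve_left
    (mul_ne_zero hx (sub_ne_zero.2 hd))
  linear_combination h23

theorem matrix_eq_normalForm_family4 (k h : ℝ) :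
    !![1, 0, 0; 0, -(k + 1 / 2), h; 0, -h, k - 1 / 2]
      = normalForm 1 (-(k + 1 / 2)) (k - 1 / 2) h 0 0 := by
  ext i j; fin_cases i <;> fin_cases j <;> simp [normalForm]

theorem isListed_family4 (h : CriticalEquations 1 a₂ a₃ x 0 0 t) (hθ : 1 + a₂ + a₃ = 0)
    (hx : 0 < x) (hd : a₂ < a₃) : IsListed 1 a₂ a₃ x 0 0 t := by
  obtain ⟨h1, h2⟩ := h.of_one_entry hθ hx.ne' hd.ne
  obtain ⟨k, rfl⟩ : ∃ k, a₃ = k - 1 / 2 := ⟨a₃ + 1 / 2, by ring⟩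
  obtain rfl : a₂ = -(k + 1 / 2) := by linarith
  obtain ⟨u, hu⟩ : ∃ u, u = defect 1 (-(k + 1 / 2)) (k - 1 / 2) t := ⟨_, rfl⟩
  rw [← hu] at h1 h2
  have hk : 0 < k := by linarith
  have hux : u = -(2 * x ^ 2 + 2 * k ^ 2) := by linear_combination (1 / 2) * h1
  rw [hux] at h2
  have h4 : Eq4 k x := by rw [Eq4]; linear_combination h2
  have hk2 : 3 < 4 * k ^ 2 := by
    have h5 : 0 < x ^ 2 * (4 * k ^ 2 - 3) := by
      rw [Eq4] at h4
      have : 0 < k ^ 2 * (4 * k ^ 2 + 3) := by positivity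
      linarith
    linarith [pos_of_mul_pos_right h5 (sq_nonneg x)]
  have hk3 : √3 / 2 < k := by
    rw [div_lt_iff₀ two_pos]
    exact (Real.sqrt_lt' (by positivity)).2 (by linarith)
  refine ⟨!![1, 0, 0; 0, -(k + 1 / 2), x; 0, -x, k - 1 / 2], Or.inl (Or.inr (Or.inr (Or.inr
    (Or.inl ⟨k, x, hk3, hx, h4, rfl, ?_⟩)))), ?_⟩
  · have p1 : 4 * k ^ 2 - 3 ≠ 0 := by linarith
    have p2 : 4 * k ^ 2 + 3 ≠ 0 := by positivity
    have p3 : 16 * k ^ 4 - 9 ≠ 0 := by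
      have : (4 * k ^ 2 - 3) * (4 * k ^ 2 + 3) ≠ 0 := mul_ne_zero p1 p2
      intro h; exact this (by linear_combination h)
    rw [eq_neg_iff_add_eq_zero, ← mul_left_inj' p3, add_mul, div_mul_cancel₀ _ p3, zero_mul]
    rw [hux, defect] at hu
    rw [Eq4] at h4
    linear_combination (-2) * (4 * k ^ 2 - 3) * hu - 4 * h4
  · rw [matrix_eq_normalForm_family4]
    have := homothetic_normalForm_smul 1 (-(k + 1 / 2)) (k - 1 / 2) x 0 0 one_ne_zero
    simpa only [one_mul] using this

theorem isListed_family1 (h : CriticalEquations 0 a₂ a₃ x 0 0 t) (hθ : a₂ + a₃ = 0)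
    (hx : x ≠ 0) (hd : a₂ ≠ a₃) : IsListed 0 a₂ a₃ x 0 0 t := by
  obtain ⟨h1, h2⟩ := h.of_one_entry (by linarith) hx hd
  obtain rfl : a₃ = -a₂ := by linarith
  have ha : a₂ ≠ 0 := by rintro rfl; simp at hd
  obtain ⟨u, hu⟩ : ∃ u, u = defect 0 a₂ (-a₂) t := ⟨_, rfl⟩
  rw [← hu] at h1 h2
  have hux : u = -4 * x ^ 2 := by
    have : a₂ ^ 2 * (u + 4 * x ^ 2) = 0 := by linear_combination (1 / 2) * h2
    linarith [(mul_eq_zero.1 this).resolve_left (pow_ne_zero 2 ha)]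
  have hq : x ^ 2 = a₂ ^ 2 := by rw [hux] at h1; linear_combination (-1 / 4) * h1
  have ht : t = -3 := by
    rw [hux, hq, defect] at hu
    have : a₂ ^ 2 * (t + 3) = 0 := by linear_combination (-1 / 2) * hu
    linarith [(mul_eq_zero.1 this).resolve_left (pow_ne_zero 2 ha)]
  have e : normalForm 1 0 (-1) 0 (-1) 0 = !![1, 0, 1; 0, 0, 0; -1, 0, -1] := by
    ext i j; fin_cases i <;> fin_cases j <;> simp [normalForm]
  refine ⟨!![1, 0, 1; 0, 0, 0; -1, 0, -1], Or.inl (Or.inl ⟨rfl, ht⟩), ?_⟩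
  rw [← e]
  rcases sq_eq_sq_iff_eq_or_eq_neg.1 hq with rfl | rfl
  · have hh := ((homothetic_normalForm_rotate 0 x (-x) x 0 0).trans
      (homothetic_normalForm_rotate _ _ _ _ _ _)).trans
      (homothetic_normalForm_smul _ _ _ _ _ _ (neg_ne_zero.2 (inv_ne_zero ha)))
    simpa [ha] using hh
  · have hh := ((homothetic_normalForm_rotate 0 a₂ (-a₂) (-a₂) 0 0).trans
      (homothetic_normalForm_rotate _ _ _ _ _ _)).trans
      ((homothetic_normalForm_smul _ _ _ _ _ _ (neg_ne_zero.2 (inv_ne_zero ha))).trans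
        (homothetic_normalForm_neg _ _ _ _ _ _))
    simpa [ha] using hh

theorem isListed_of_one_entry_of_trace_eq_zero (h : CriticalEquations a₁ a₂ a₃ x 0 0 t)
    (hθ : a₁ + a₂ + a₃ = 0) (hx : x ≠ 0) (hd : a₂ ≠ a₃) : IsListed a₁ a₂ a₃ x 0 0 t := by
  by_cases h1 : a₁ = 0
  · subst h1
    exact isListed_family1 h (by linarith) hx hd
  have pos₁ : ∀ a₂ a₃ x, CriticalEquations 1 a₂ a₃ x 0 0 t → 1 + a₂ + a₃ = 0 → x ≠ 0 →
      a₂ < a₃ → IsListed 1 a₂ a₃ x 0 0 t := by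
    intro a₂ a₃ x h hθ hx hd
    rcases lt_or_gt_of_ne hx with hx | hx
    · have hh := homothetic_normalForm_neg' 1 a₂ a₃ x 0 0
      rw [neg_zero] at hh
      exact .of_homothetic hh (isListed_family4 (h.of_homothetic hh) hθ (by linarith) hd)
    · exact isListed_family4 h hθ hx hd
  have pos₂ : ∀ a₂ a₃ x, CriticalEquations 1 a₂ a₃ x 0 0 t → 1 + a₂ + a₃ = 0 → x ≠ 0 →
      a₂ ≠ a₃ → IsListed 1 a₂ a₃ x 0 0 t := by
    intro a₂ a₃ x h hθ hx hd
    rcases lt_or_gt_of_ne hd with hd | hd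
    · exact pos₁ _ _ _ h hθ hx hd
    · have hh := homothetic_normalForm_swap' 1 a₂ a₃ x 0 0
      rw [neg_zero] at hh
      exact .of_homothetic hh
        (pos₁ _ _ _ (h.of_homothetic hh) (by linarith) (neg_ne_zero.2 hx) hd)
  have hh := homothetic_normalForm_smul a₁ a₂ a₃ x 0 0 (inv_ne_zero h1)
  rw [mul_zero, inv_mul_cancel₀ h1] at hh
  refine .of_homothetic hh (pos₂ _ _ _ (h.of_homothetic hh) ?_
    (mul_ne_zero (inv_ne_zero h1) hx) ?_)
  · rw [← inv_mul_cancel₀ h1, ← mul_add, ← mul_add, hθ, mul_zero]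
  · exact fun e => hd (mul_left_cancel₀ (inv_ne_zero h1) e)

/-- The Euler–Lagrange equation for a trace-free derivation with two non-zero skew-symmetric
entries. -/
theorem CriticalEquations.of_two_entries (h : CriticalEquations a₁ a₂ a₃ x y 0 t)
    (hθ : a₁ + a₂ + a₃ = 0) (hx : x ≠ 0) (hy : y ≠ 0) :
    4 * x ^ 2 * (a₂ - a₃) - y ^ 2 * (5 * a₃ - 2 * a₁)
      + ((a₂ - a₃) ^ 2 + 2 * defect a₁ a₂ a₃ t) * (a₂ - a₃) = 0 ∧
    4 * y ^ 2 * (a₃ - a₁) + x ^ 2 * (5 * a₃ - 2 * a₂)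
      + ((a₃ - a₁) ^ 2 + 2 * defect a₁ a₂ a₃ t) * (a₃ - a₁) = 0 ∧
    2 * (y ^ 2 * (a₃ - a₁) ^ 2 + x ^ 2 * (a₂ - a₃) ^ 2)
      + (a₁ ^ 2 + a₂ ^ 2 + a₃ ^ 2) * defect a₁ a₂ a₃ t = 0 := by
  have h0 := h.radial
  have h23 := h.mixed₂₃
  have h31 := h.mixed₃₁
  have e1 : defect a₂ a₃ a₁ t = defect a₁ a₂ a₃ t := by simp only [defect]; ring
  have e2 : defect a₃ a₁ a₂ t = defect a₁ a₂ a₃ t := by simp only [defect]; ring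
  have hθ' : a₂ + a₃ + a₁ = 0 := by linarith
  have hθ'' : a₃ + a₁ + a₂ = 0 := by linarith
  simp only [mixedEquation, e1, hθ'] at h23
  simp only [mixedEquation, e2, hθ''] at h31
  simp only [radialEquation, commNormSq, hθ] at h0
  generalize defect a₁ a₂ a₃ t = u at *
  refine ⟨?_, ?_, by linear_combination (-2 / 3) * h0⟩
  · refine (mul_eq_zero.1 (?_ : x * _ = 0)).resolve_left hx
    linear_combination h23
  · refine (mul_eq_zero.1 (?_ : y * _ = 0)).resolve_left hy
    linear_combination h31

theorem one_div_sqrt_two_sq : (1 / √2) ^ 2 = (1 / 2 : ℝ) := by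
  rw [div_pow, Real.sq_sqrt (by norm_num)]; norm_num

theorem isListed_family2 (h : CriticalEquations a₁ a₂ 0 x y 0 t) (hθ : a₁ + a₂ = 0)
    (ha : a₁ ≠ 0) (hx : x ≠ 0) (hy : y ≠ 0) : IsListed a₁ a₂ 0 x y 0 t := by
  obtain ⟨h1, h2, h3⟩ := h.of_two_entries (by linarith) hx hy
  obtain rfl : a₂ = -a₁ := by linarith
  obtain ⟨u, hu⟩ : ∃ u, u = defect a₁ (-a₁) 0 t := ⟨_, rfl⟩
  rw [← hu] at h1 h2 h3
  have k1 : 4 * x ^ 2 - 2 * y ^ 2 + a₁ ^ 2 + 2 * u = 0 :=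
    (mul_eq_zero.1 (by linear_combination -h1 : a₁ * _ = 0)).resolve_left ha
  have k2 : 4 * y ^ 2 - 2 * x ^ 2 + a₁ ^ 2 + 2 * u = 0 :=
    (mul_eq_zero.1 (by linear_combination -h2 : a₁ * _ = 0)).resolve_left ha
  have k3 : x ^ 2 + y ^ 2 + u = 0 :=
    (mul_eq_zero.1 (by linear_combination (1 / 2) * h3 : a₁ ^ 2 * _ = 0)).resolve_left
      (pow_ne_zero 2 ha)
  have ex : x ^ 2 = a₁ ^ 2 / 2 := by linarith
  have ey : y ^ 2 = a₁ ^ 2 / 2 := by linarith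
  have ht : t = -(3 / 2) := by
    have eu : u = -a₁ ^ 2 := by linarith
    rw [eu, defect] at hu
    have : a₁ ^ 2 * (t + 3 / 2) = 0 := by linear_combination (-1 / 2) * hu
    linarith [(mul_eq_zero.1 this).resolve_left (pow_ne_zero 2 ha)]
  have hval : ∀ b : ℝ, b ^ 2 = a₁ ^ 2 / 2 → a₁⁻¹ * b = 1 / √2 ∨ a₁⁻¹ * b = -(1 / √2) := by
    intro b hb
    rw [← sq_eq_sq_iff_eq_or_eq_neg, one_div_sqrt_two_sq, mul_pow, hb]
    field_simp
  have e : normalForm 1 (-1) 0 (1 / √2) (-(1 / √2)) 0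
      = !![1, 0, 1 / √2; 0, -1, 1 / √2; -(1 / √2), -(1 / √2), 0] := by
    ext i j; fin_cases i <;> fin_cases j <;> simp [normalForm]
  refine ⟨_, Or.inl (Or.inr (Or.inl ⟨rfl, ht⟩)), ?_⟩
  rw [← e]
  have hh := homothetic_normalForm_smul a₁ (-a₁) 0 x y 0 (inv_ne_zero ha)
  rw [mul_neg, inv_mul_cancel₀ ha, mul_zero] at hh
  have hn := homothetic_normalForm_neg 1 (-1) 0
  have hn' := homothetic_normalForm_neg' 1 (-1) 0
  rcases hval x ex with h4 | h4 <;> rcases hval y ey with h5 | h5 <;> rw [h4, h5] at hh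
  · simpa only [neg_zero] using hh.trans (hn _ _ _)
  · exact hh
  · simpa only [neg_zero, neg_neg] using hh.trans ((hn _ _ _).trans (hn' _ _ _))
  · simpa only [neg_zero, neg_neg] using hh.trans (hn' _ _ _)

theorem exists_eqZeta {p : ℝ} (hp : -2 < p) (h : 0 < 8 * p ^ 3 + 15 * p ^ 2 + 3 * p + 1) :
    ∃ r, EqZeta r ∧ r < p := by
  have hc : ContinuousOn (fun s : ℝ => 8 * s ^ 3 + 15 * s ^ 2 + 3 * s + 1) (Set.Icc (-2) p) := by
    fun_prop
  obtain ⟨r, hr, hr'⟩ := intermediate_value_Ioo hp.le hc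
    (show (0 : ℝ) ∈ Set.Ioo _ _ from ⟨by norm_num, h⟩)
  exact ⟨r, hr', hr.2⟩

theorem matrix_eq_normalForm_family5 (p c h : ℝ) :
    !![1, 0, c; 0, -(p + 1), h; -c, -h, p] = normalForm 1 (-(p + 1)) p h (-c) 0 := by
  ext i j; fin_cases i <;> fin_cases j <;> simp [normalForm]

/-- Two non-zero skew-symmetric entries and eigenvalues `1, -(p + 1), p`: the equations determine
`x²` and `y²` as rational functions of `p`, whose positivity restricts `p` to the range of the fifth
family. -/
theorem isListed_family5 {p : ℝ} (h : CriticalEquations 1 (-(p + 1)) p x y 0 t)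
    (hx : x ≠ 0) (hy : y ≠ 0) (hp : -2 < p) (hp' : p < 0) :
    IsListed 1 (-(p + 1)) p x y 0 t := by
  obtain ⟨h1, h2, h3⟩ := h.of_two_entries (by ring) hx hy
  obtain ⟨u, hu⟩ : ∃ u, u = defect 1 (-(p + 1)) p t := ⟨_, rfl⟩
  rw [← hu] at h1 h2 h3
  have hX : 0 < x ^ 2 := by positivity
  have hY : 0 < y ^ 2 := by positivity
  have hm : 0 < p ^ 2 + p + 1 := by nlinarith [sq_nonneg (2 * p + 1)]
  have q1 : p - 1 ≠ 0 := by linarith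
  have q2 : p + 2 ≠ 0 := by linarith
  have q3 : 2 * p + 1 ≠ 0 := by
    intro h0
    have e : p = -1 / 2 := by linarith
    rw [e] at h1
    nlinarith
  -- eliminating the defect from the two mixed equations
  have k : x ^ 2 * (2 * p + 1) + y ^ 2 * (p - 1) = p * (2 * p + 1) * (p - 1) := by
    have : (p + 2) * (x ^ 2 * (2 * p + 1) + y ^ 2 * (p - 1) - p * (2 * p + 1) * (p - 1)) = 0 := by
      linear_combination (1 / 3) * (p - 1) * h1 + (1 / 3) * (2 * p + 1) * h2
    linarith [(mul_eq_zero.1 this).resolve_left q2]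
  have ku : (p ^ 2 + p + 1) * u = -(2 * p + 1) * (p * (p - 1) ^ 2 + x ^ 2 * (p + 2)) := by
    linear_combination (1 / 2) * h3 - (p - 1) * k
  -- the two remaining linear equations for `x²` and `y²`
  have hh5 : x ^ 2 * (p + 2) * (5 * p ^ 2 - p - 1)
      - (p + 1) * (p - 1) * (5 * p ^ 3 + 12 * p ^ 2 + 1) = 0 := by
    linear_combination -(p ^ 2 + p + 1) * h2 + 2 * (p - 1) * ku + 4 * (p ^ 2 + p + 1) * k
  have hc5 : y ^ 2 * (p + 2) * (5 * p ^ 2 - p - 1)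
      + (2 * p + 1) * (8 * p ^ 3 + 15 * p ^ 2 + 3 * p + 1) = 0 := by
    have : (p - 1) * (y ^ 2 * (p + 2) * (5 * p ^ 2 - p - 1)
      + (2 * p + 1) * (8 * p ^ 3 + 15 * p ^ 2 + 3 * p + 1)) = 0 := by
      linear_combination (p + 2) * (5 * p ^ 2 - p - 1) * k - (2 * p + 1) * hh5
    exact (mul_eq_zero.1 this).resolve_left q1
  have hpos : 0 < 5 * p ^ 3 + 12 * p ^ 2 + 1 := by nlinarith [sq_nonneg p]
  have hp1 : p ≠ -1 := by
    rintro rfl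
    norm_num at hh5
    exact hx hh5
  have q4 : 5 * p ^ 2 - p - 1 ≠ 0 := by
    intro h0
    rw [h0] at hh5
    have h6 : (p + 1) * (p - 1) * (5 * p ^ 3 + 12 * p ^ 2 + 1) ≠ 0 :=
      mul_ne_zero (mul_ne_zero (by intro h; apply hp1; linarith) q1) hpos.ne'
    exact h6 (by linarith)
  -- for `p < -1` the sign of `y²` decides, for `p > -1` that of `x²`
  have hr : Range5 p := by
    rcases lt_or_gt_of_ne hp1 with hlt | hgt
    · left
      have h6 : 0 < y ^ 2 * (p + 2) * (5 * p ^ 2 - p - 1) :=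
        mul_pos (mul_pos hY (by linarith)) (by nlinarith)
      have h7 : 0 < 8 * p ^ 3 + 15 * p ^ 2 + 3 * p + 1 := by
        by_contra hneg
        have : 0 ≤ (2 * p + 1) * (8 * p ^ 3 + 15 * p ^ 2 + 3 * p + 1) :=
          mul_nonneg_of_nonpos_of_nonpos (by linarith) (not_lt.1 hneg)
        linarith
      obtain ⟨r, hr, hr'⟩ := exists_eqZeta hp h7
      exact ⟨r, hr, hr', hlt⟩
    · right
      refine ⟨?_, hp'⟩
      have h7 : 5 * p ^ 2 - p - 1 < 0 := by
        by_contra hneg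
        have h8 : 0 ≤ x ^ 2 * (p + 2) * (5 * p ^ 2 - p - 1) :=
          mul_nonneg (mul_nonneg hX.le (by linarith)) (not_lt.1 hneg)
        have h9 : (p + 1) * (p - 1) * (5 * p ^ 3 + 12 * p ^ 2 + 1) < 0 :=
          mul_neg_of_neg_of_pos (mul_neg_of_pos_of_neg (by linarith) (by linarith)) hpos
        linarith
      have h8 : 1 - 10 * p < √21 := Real.lt_sqrt_of_sq_lt (by nlinarith)
      linarith
  have hsq : ∀ b : ℝ, |b| ^ 2 = b ^ 2 := sq_abs
  refine ⟨_, Or.inl (Or.inr (Or.inr (Or.inr (Or.inr ⟨p, |y|, |x|, hr, abs_pos.2 hy, ?_,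
    abs_pos.2 hx, ?_, rfl, ?_⟩)))), ?_⟩
  · rw [Eq5c, hsq]; exact hc5
  · rw [Eq5h, hsq]; exact hh5
  · have q5 : 2 * (p ^ 2 + p + 1) * (5 * p ^ 2 - p - 1) ≠ 0 :=
      mul_ne_zero (mul_ne_zero two_ne_zero hm.ne') q4
    rw [eq_neg_iff_add_eq_zero, ← mul_left_inj' q5, add_mul, div_mul_cancel₀ _ q5, zero_mul]
    rw [defect] at hu
    refine (mul_eq_zero.1 (?_ : (p ^ 2 + p + 1) * _ = 0)).resolve_left hm.ne'
    linear_combination -(p ^ 2 + p + 1) * (5 * p ^ 2 - p - 1) * hu + (5 * p ^ 2 - p - 1) * ku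
      - (2 * p + 1) * hh5
  · rw [matrix_eq_normalForm_family5]
    have hn := homothetic_normalForm_neg 1 (-(p + 1)) p
    have hn' := homothetic_normalForm_neg' 1 (-(p + 1)) p
    rcases abs_choice x with h4 | h4 <;> rcases abs_choice y with h5 | h5 <;> rw [h4, h5]
    · simpa only [neg_zero] using hn x y 0
    · simpa only [neg_zero, neg_neg] using (hn x y 0).trans (hn _ _ _)
    · simpa only [neg_zero] using (hn x y 0).trans (hn' _ _ _)
    · simpa only [neg_zero, neg_neg] using hn' x y 0

/-- The trace-free derivations with two non-zero skew-symmetric entries. A double eigenvalue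
`a₁ = a₂` allows for a rotation which removes one of them, and `a₃ = 0` gives the second family. -/
theorem isListed_of_two_entries_of_trace_eq_zero (h : CriticalEquations a₁ a₂ a₃ x y 0 t)
    (hθ : a₁ + a₂ + a₃ = 0) (hx : x ≠ 0) (hy : y ≠ 0) (hn : ¬ (a₁ = a₂ ∧ a₂ = a₃)) :
    IsListed a₁ a₂ a₃ x y 0 t := by
  by_cases h12 : a₁ = a₂
  · subst h12
    have hpos : 0 < x ^ 2 + y ^ 2 := by positivity
    have hh := homothetic_normalForm_rotatePlane a₁ a₃ x y hpos
    exact .of_homothetic hh (isListed_of_one_entry_of_trace_eq_zero (h.of_homothetic hh) hθ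
      (Real.sqrt_pos.2 hpos).ne' fun e => hn ⟨rfl, e⟩)
  by_cases h3 : a₃ = 0
  · subst h3
    refine isListed_family2 h (by linarith) ?_ hx hy
    rintro rfl
    exact h12 (by linarith)
  -- the ratio `p = a₃ / a₁` lies in `(-2, 0)`, or else does so after exchanging `e₁` and `e₂`
  have aux : ∀ a₁ a₂ x y, CriticalEquations a₁ a₂ a₃ x y 0 t → a₁ + a₂ + a₃ = 0 → x ≠ 0 → y ≠ 0 →
      a₁ ≠ 0 → -2 < a₁⁻¹ * a₃ → a₁⁻¹ * a₃ < 0 → IsListed a₁ a₂ a₃ x y 0 t := by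
    intro a₁ a₂ x y h hθ hx hy h1 hp hp'
    have hh := homothetic_normalForm_smul a₁ a₂ a₃ x y 0 (inv_ne_zero h1)
    have e2 : a₁⁻¹ * a₂ = -(a₁⁻¹ * a₃ + 1) := by
      rw [show a₂ = -(a₃ + a₁) by linarith, mul_neg, mul_add, inv_mul_cancel₀ h1]
    rw [inv_mul_cancel₀ h1, e2, mul_zero] at hh
    exact .of_homothetic hh (isListed_family5 (h.of_homothetic hh)
      (mul_ne_zero (inv_ne_zero h1) hx) (mul_ne_zero (inv_ne_zero h1) hy) hp hp')
  by_cases hg : a₁ ≠ 0 ∧ -2 < a₁⁻¹ * a₃ ∧ a₁⁻¹ * a₃ < 0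
  · exact aux _ _ _ _ h hθ hx hy hg.1 hg.2.1 hg.2.2
  have hh := homothetic_normalForm_swap a₁ a₂ a₃ x y 0
  rw [neg_zero] at hh
  have key : a₂ ≠ 0 ∧ -2 < a₂⁻¹ * a₃ ∧ a₂⁻¹ * a₃ < 0 := by
    by_cases h1 : a₁ = 0
    · subst h1
      have h2 : a₂ ≠ 0 := fun e => h12 e.symm
      have e : a₂⁻¹ * a₃ = -1 := by
        rw [show a₃ = -a₂ by linarith, mul_neg, inv_mul_cancel₀ h2]
      rw [e]
      exact ⟨h2, by norm_num, by norm_num⟩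
    obtain ⟨p, hp⟩ : ∃ p, p = a₁⁻¹ * a₃ := ⟨_, rfl⟩
    obtain rfl : a₃ = a₁ * p := by rw [hp]; field_simp
    obtain rfl : a₂ = a₁ * -(p + 1) := by linarith
    have hp0 : p ≠ 0 := fun e => h3 (by rw [e, mul_zero])
    have hp2 : p ≠ -2 := fun e => h12 (by rw [e]; ring)
    have hpp : p < -2 ∨ 0 < p := by
      by_contra hc
      rw [not_or, not_lt, not_lt] at hc
      exact hg ⟨h1, by rw [← hp]; exact lt_of_le_of_ne hc.1 hp2.symm,
        by rw [← hp]; exact lt_of_le_of_ne hc.2 hp0⟩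
    have hp1 : p + 1 ≠ 0 := by rcases hpp with h | h <;> intro h' <;> linarith
    have e : (a₁ * -(p + 1))⁻¹ * (a₁ * p) = -(p / (p + 1)) := by field_simp
    rw [e]
    refine ⟨mul_ne_zero h1 (neg_ne_zero.2 hp1), ?_, ?_⟩
    · rw [neg_lt_neg_iff]
      rcases hpp with h | h
      · rw [div_lt_iff_of_neg (by linarith)]; linarith
      · rw [div_lt_iff₀ (by linarith)]; linarith
    · rw [neg_lt_zero]
      rcases hpp with h | h
      · exact div_pos_of_neg_of_neg (by linarith) (by linarith)
      · exact div_pos h (by linarith)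
  exact .of_homothetic hh (aux _ _ _ _ (h.of_homothetic hh) (by linarith) (neg_ne_zero.2 hy)
    (neg_ne_zero.2 hx) key.1 key.2.1 key.2.2)

theorem isListed_of_trace_eq_zero (h : CriticalEquations a₁ a₂ a₃ x y z t)
    (hθ : a₁ + a₂ + a₃ = 0) (hc : commNormSq a₁ a₂ a₃ x y z ≠ 0) :
    IsListed a₁ a₂ a₃ x y z t := by
  have hn : ¬ (a₁ = a₂ ∧ a₂ = a₃) := by
    rintro ⟨rfl, rfl⟩
    exact hc (by rw [commNormSq]; ring)
  have rot := homothetic_normalForm_rotate a₁ a₂ a₃ x y z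
  have rot' := rot.trans (homothetic_normalForm_rotate _ _ _ _ _ _)
  by_cases hx : x = 0 <;> by_cases hy : y = 0 <;> by_cases hz : z = 0
  · subst hx hy hz
    exact absurd (by rw [commNormSq]; ring) hc
  · subst hx hy
    refine .of_homothetic rot' (isListed_of_one_entry_of_trace_eq_zero h.rotate.rotate
      (by linarith) hz ?_)
    rintro rfl
    exact hc (by rw [commNormSq]; ring)
  · subst hx hz
    refine .of_homothetic rot (isListed_of_one_entry_of_trace_eq_zero h.rotate
      (by linarith) hy ?_)
    rintro rfl
    exact hc (by rw [commNormSq]; ring)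
  · subst hx
    exact .of_homothetic rot (isListed_of_two_entries_of_trace_eq_zero h.rotate (by linarith) hy hz
      fun e => hn ⟨by rw [e.1, e.2], e.1⟩)
  · subst hy hz
    refine isListed_of_one_entry_of_trace_eq_zero h hθ hx ?_
    rintro rfl
    exact hc (by rw [commNormSq]; ring)
  · subst hy
    exact .of_homothetic rot' (isListed_of_two_entries_of_trace_eq_zero h.rotate.rotate
      (by linarith) hz hx fun e => hn ⟨e.2, by rw [← e.2, e.1]⟩)
  · subst hz
    exact isListed_of_two_entries_of_trace_eq_zero h hθ hx hy hn
  -- the diagonal equations read `x y z (a₂ - a₃) = 0` and cyclically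
  · have hxyz : x * y * z ≠ 0 := mul_ne_zero (mul_ne_zero hx hy) hz
    have h1 := h.diag₁
    have h2 := h.diag₃
    rw [diagonalEquation] at h1 h2
    rw [hθ] at h1
    rw [show a₃ + a₁ + a₂ = 0 by linarith] at h2
    have e1 : x * y * z * (a₂ - a₃) = 0 := by linear_combination (1 / 6) * h1
    have e2 : x * y * z * (a₁ - a₂) = 0 := by linear_combination (1 / 6) * h2
    exact absurd ⟨sub_eq_zero.1 ((mul_eq_zero.1 e2).resolve_left hxyz),
      sub_eq_zero.1 ((mul_eq_zero.1 e1).resolve_left hxyz)⟩ hn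

/-- The classification of the critical metrics in the normal form. -/
theorem CriticalEquations.isListed (h : CriticalEquations a₁ a₂ a₃ x y z t)
    (hs : ¬ IsLocallySymmetric (metricOf (normalForm a₁ a₂ a₃ x y z))) :
    IsListed a₁ a₂ a₃ x y z t := by
  by_cases hc : commNormSq a₁ a₂ a₃ x y z = 0
  · exact isListed_of_commNormSq_eq_zero h hc hs
  by_cases hθ : a₁ + a₂ + a₃ = 0
  · exact isListed_of_trace_eq_zero h hθ hc
  · exact isListed_of_trace_ne_zero h hθ hc

end

/-! ### The equations defining the parameters -/

theorem existsUnique_pos_sq_mul_eq {a b : ℝ} (h : 0 < b / a) : ∃! s : ℝ, 0 < s ∧ s ^ 2 * a = b := by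
  have ha : a ≠ 0 := by rintro rfl; simp at h
  refine ⟨√(b / a), ⟨Real.sqrt_pos.2 h, ?_⟩, ?_⟩
  · rw [Real.sq_sqrt h.le, div_mul_cancel₀ _ ha]
  · rintro s ⟨hs, e⟩
    rw [eq_comm, Real.sqrt_eq_iff_mul_self_eq_of_pos hs, ← sq, ← e, mul_div_cancel_right₀ _ ha]

/-- The cubic of `EqZeta` is positive to the right of its root. -/
theorem pos_of_lt_of_eqZeta_poly {s : ℝ} (h : -1.697464 ≤ s) :
    0 < 8 * s ^ 3 + 15 * s ^ 2 + 3 * s + 1 := by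
  -- division by `s + 1.697464` leaves `8 (s + 0.088768)²` plus a positive constant
  nlinarith [mul_nonneg (sub_nonneg.2 h) (sq_nonneg (s + 0.088768)), sub_nonneg.2 h]

theorem EqZeta.mem_Ioo {r : ℝ} (h : EqZeta r) : -1.697465 < r ∧ r < -1.697464 := by
  rw [EqZeta] at h
  constructor
  · by_contra hc
    rw [not_lt] at hc
    nlinarith [mul_nonneg (sub_nonneg.2 hc) (sq_nonneg (r + 0.088768)), sub_nonneg.2 hc]
  · by_contra hc
    rw [not_lt] at hc
    linarith [pos_of_lt_of_eqZeta_poly hc]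

theorem existsUnique_eqZeta : ∃! r : ℝ, EqZeta r := by
  obtain ⟨r, hr, -⟩ := exists_eqZeta (p := 0) (by norm_num) (by norm_num)
  refine ⟨r, hr, fun s hs => ?_⟩
  obtain ⟨r1, r2⟩ := hr.mem_Ioo
  obtain ⟨s1, s2⟩ := hs.mem_Ioo
  rw [EqZeta] at hr hs
  have h1 : (s - r) * (8 * (s ^ 2 + s * r + r ^ 2) + 15 * (s + r) + 3) = 0 := by
    linear_combination hs - hr
  refine sub_eq_zero.1 ((mul_eq_zero.1 h1).resolve_right ?_)
  have : 0 < 8 * (s ^ 2 + s * r + r ^ 2) + 15 * (s + r) + 3 := by nlinarith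
  exact this.ne'

theorem Range5.bounds {p : ℝ} (h : Range5 p) : -2 < p ∧ p < 0 ∧ p ≠ -1 := by
  rcases h with ⟨r, hr, h1, h2⟩ | ⟨h1, h2⟩
  · exact ⟨by linarith [hr.mem_Ioo.1], by linarith, h2.ne⟩
  · have h3 : √21 < 5 := (Real.sqrt_lt' (by norm_num)).2 (by norm_num)
    exact ⟨by linarith, h2, by intro h; linarith⟩

/-- The values of `c²` and `h²` in the fifth family are positive. -/
theorem Range5.signs {p : ℝ} (h : Range5 p) :
    0 < -((2 * p + 1) * (8 * p ^ 3 + 15 * p ^ 2 + 3 * p + 1)) / ((p + 2) * (5 * p ^ 2 - p - 1)) ∧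
    0 < (p + 1) * (p - 1) * (5 * p ^ 3 + 12 * p ^ 2 + 1) / ((p + 2) * (5 * p ^ 2 - p - 1)) := by
  obtain ⟨b1, b2, -⟩ := h.bounds
  have hpos : 0 < 5 * p ^ 3 + 12 * p ^ 2 + 1 := by nlinarith [sq_nonneg p]
  rcases h with ⟨r, hr, h1, h2⟩ | ⟨h1, h2⟩
  · have h4 : 0 < 8 * p ^ 3 + 15 * p ^ 2 + 3 * p + 1 := by
      rcases le_or_gt (-1.697464) p with hp | hp
      · exact pos_of_lt_of_eqZeta_poly hp
      · have := hr.mem_Ioo.1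
        rw [EqZeta] at hr
        have h5 : 0 < (p - r) * (8 * (p ^ 2 + p * r + r ^ 2) + 15 * (p + r) + 3) :=
          mul_pos (by linarith) (by nlinarith)
        linarith
    have h5 : 0 < (p + 2) * (5 * p ^ 2 - p - 1) := mul_pos (by linarith) (by nlinarith)
    refine ⟨div_pos ?_ h5, div_pos ?_ h5⟩
    · rw [neg_pos]
      exact mul_neg_of_neg_of_pos (by linarith) h4
    · exact mul_pos (mul_pos_of_neg_of_neg (by linarith) (by linarith)) hpos
  · have h3 : √21 < 5 := (Real.sqrt_lt' (by norm_num)).2 (by norm_num)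
    have h3' : √21 ^ 2 = 21 := Real.sq_sqrt (by norm_num)
    have h4 : 0 < 8 * p ^ 3 + 15 * p ^ 2 + 3 * p + 1 :=
      pos_of_lt_of_eqZeta_poly (by linarith)
    have h5 : (p + 2) * (5 * p ^ 2 - p - 1) < 0 := by
      refine mul_neg_of_pos_of_neg (by linarith) ?_
      have h6 : 0 < √21 + 1 - 10 * p := by linarith [Real.sqrt_nonneg 21]
      nlinarith [mul_pos (show 0 < √21 - (1 - 10 * p) by linarith) h6]
    refine ⟨div_pos_of_neg_of_neg ?_ h5, div_pos_of_neg_of_neg ?_ h5⟩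
    · rw [neg_lt_zero]
      exact mul_pos (by linarith) h4
    · exact mul_neg_of_neg_of_pos (mul_neg_of_pos_of_neg (by linarith) (by linarith)) hpos

theorem Range5.ne_zero {p : ℝ} (h : Range5 p) : (p + 2) * (5 * p ^ 2 - p - 1) ≠ 0 := by
  intro h0
  have := h.signs.1
  rw [h0, div_zero] at this
  exact lt_irrefl _ this

theorem three_lt_of_sqrt_lt {k : ℝ} (hk : √3 / 2 < k) : 3 < 4 * k ^ 2 := by
  rw [div_lt_iff₀ two_pos] at hk
  have h0 : 0 < k * 2 := (Real.sqrt_nonneg 3).trans_lt hk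
  have := (Real.sqrt_lt' h0).1 hk
  linarith

theorem existsUnique_eq4 {k : ℝ} (hk : √3 / 2 < k) : ∃! h : ℝ, 0 < h ∧ Eq4 k h := by
  have h1 := three_lt_of_sqrt_lt hk
  have h2 : 0 < k ^ 2 * (4 * k ^ 2 + 3) / (4 * k ^ 2 - 3) :=
    div_pos (by nlinarith) (by linarith)
  simpa only [Eq4, sub_eq_zero] using existsUnique_pos_sq_mul_eq h2

theorem existsUnique_eq5c {p : ℝ} (hp : Range5 p) : ∃! c : ℝ, 0 < c ∧ Eq5c p c := by
  simpa only [Eq5c, mul_assoc, ← eq_neg_iff_add_eq_zero] using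
    existsUnique_pos_sq_mul_eq hp.signs.1

theorem existsUnique_eq5h {p : ℝ} (hp : Range5 p) : ∃! h : ℝ, 0 < h ∧ Eq5h p h := by
  simpa only [Eq5h, mul_assoc, sub_eq_zero] using existsUnique_pos_sq_mul_eq hp.signs.2

/-- Of the two roots `m ± √d` only one is positive if `m ^ 2 < d`. -/
theorem existsUnique_pos_sub_sq_eq {m d : ℝ} (hm : 0 ≤ m) (hd : m ^ 2 < d) :
    ∃! s : ℝ, 0 < s ∧ (s - m) ^ 2 = d := by
  have h0 : m < √d := Real.lt_sqrt_of_sq_lt hd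
  have h1 : √d ^ 2 = d := Real.sq_sqrt ((sq_nonneg m).trans hd.le)
  refine ⟨m + √d, ⟨by linarith, by rw [add_sub_cancel_left, h1]⟩, ?_⟩
  rintro s ⟨hs, e⟩
  rw [← h1] at e
  rcases sq_eq_sq_iff_eq_or_eq_neg.1 e with h | h <;> linarith

theorem eq6_iff (h f : ℝ) : Eq6 h f ↔ (f - 1 / 3) ^ 2 = h ^ 2 + 1 / 4 := by
  rw [Eq6]
  constructor <;> intro e
  · linear_combination (1 / 36) * e
  · linear_combination 36 * e

theorem eq7_iff (b a : ℝ) : Eq7 b a ↔ (a - 1 / 3) ^ 2 = 1 + 2 * b ^ 2 := by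
  rw [Eq7]
  constructor <;> intro e
  · linear_combination (1 / 9) * e
  · linear_combination 9 * e

theorem existsUnique_eq6 (h : ℝ) : ∃! f : ℝ, 0 < f ∧ Eq6 h f := by
  simp only [eq6_iff]
  exact existsUnique_pos_sub_sq_eq (by norm_num) (by nlinarith [sq_nonneg h])

theorem existsUnique_eq7 (b : ℝ) : ∃! a : ℝ, 0 < a ∧ Eq7 b a := by
  simp only [eq7_iff]
  exact existsUnique_pos_sub_sq_eq (by norm_num) (by nlinarith [sq_nonneg b])

section
/-! ### The metrics of the families are critical -/

variable {a₁ a₂ a₃ x y z t : ℝ}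

theorem not_isLocallySymmetric_of_commNormSq (h : 0 < commNormSq a₁ a₂ a₃ x y z) :
    ¬ IsLocallySymmetric (metricOf (normalForm a₁ a₂ a₃ x y z)) :=
  fun hs => h.ne' (commNormSq_eq_zero_of_isLocallySymmetric hs)

theorem criticalEquations_of_defect_eq_zero (h : defect a₁ a₂ a₃ t = 0) :
    CriticalEquations a₁ a₂ a₃ 0 0 0 t := by
  have e1 : defect a₂ a₃ a₁ t = 0 := by rw [← h]; simp only [defect]; ring
  have e2 : defect a₃ a₁ a₂ t = 0 := by rw [← h]; simp only [defect]; ring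
  constructor <;> simp only [radialEquation, commNormSq, diagonalEquation, mixedEquation, h, e1, e2]
    <;> ring

/-- The converse of `CriticalEquations.of_two_entries`. -/
theorem criticalEquations_of_two_entries (hθ : a₁ + a₂ + a₃ = 0)
    (h1 : 4 * x ^ 2 * (a₂ - a₃) - y ^ 2 * (5 * a₃ - 2 * a₁)
      + ((a₂ - a₃) ^ 2 + 2 * defect a₁ a₂ a₃ t) * (a₂ - a₃) = 0)
    (h2 : 4 * y ^ 2 * (a₃ - a₁) + x ^ 2 * (5 * a₃ - 2 * a₂)
      + ((a₃ - a₁) ^ 2 + 2 * defect a₁ a₂ a₃ t) * (a₃ - a₁) = 0)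
    (h3 : 2 * (y ^ 2 * (a₃ - a₁) ^ 2 + x ^ 2 * (a₂ - a₃) ^ 2)
      + (a₁ ^ 2 + a₂ ^ 2 + a₃ ^ 2) * defect a₁ a₂ a₃ t = 0) :
    CriticalEquations a₁ a₂ a₃ x y 0 t := by
  have e1 : defect a₂ a₃ a₁ t = defect a₁ a₂ a₃ t := by simp only [defect]; ring
  have e2 : defect a₃ a₁ a₂ t = defect a₁ a₂ a₃ t := by simp only [defect]; ring
  have hθ' : a₂ + a₃ + a₁ = 0 := by linarith
  have hθ'' : a₃ + a₁ + a₂ = 0 := by linarith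
  constructor <;> simp only [radialEquation, commNormSq, diagonalEquation, mixedEquation, e1, e2,
    hθ, hθ', hθ''] <;> generalize defect a₁ a₂ a₃ t = u at *
  · linear_combination (-3 / 2) * h3
  · ring
  · ring
  · ring
  · ring
  · linear_combination x * h1
  · linear_combination y * h2

/-- The converse of `CriticalEquations.of_one_entry`. -/
theorem criticalEquations_of_one_entry (hθ : a₁ + a₂ + a₃ = 0)
    (h1 : 4 * x ^ 2 + (a₂ - a₃) ^ 2 + 2 * defect a₁ a₂ a₃ t = 0)
    (h2 : 2 * x ^ 2 * (a₂ - a₃) ^ 2 + (a₁ ^ 2 + a₂ ^ 2 + a₃ ^ 2) * defect a₁ a₂ a₃ t = 0) :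
    CriticalEquations a₁ a₂ a₃ x 0 0 t := by
  have e1 : defect a₂ a₃ a₁ t = defect a₁ a₂ a₃ t := by simp only [defect]; ring
  have e2 : defect a₃ a₁ a₂ t = defect a₁ a₂ a₃ t := by simp only [defect]; ring
  have hθ' : a₂ + a₃ + a₁ = 0 := by linarith
  have hθ'' : a₃ + a₁ + a₂ = 0 := by linarith
  constructor <;> simp only [radialEquation, commNormSq, diagonalEquation, mixedEquation, e1, e2,
    hθ, hθ', hθ''] <;> generalize defect a₁ a₂ a₃ t = u at *
  · linear_combination (-3 / 2) * h2
  · ring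
  · ring
  · ring
  · ring
  · linear_combination x * (a₂ - a₃) * h1
  · ring

theorem Family1.eq_normalForm {B : Matrix (Fin 3) (Fin 3) ℝ} (h : Family1 B t) :
    B = normalForm 1 0 (-1) 0 (-1) 0 := by
  rw [h.1]
  ext i j; fin_cases i <;> fin_cases j <;> simp [normalForm]

theorem Family2.eq_normalForm {B : Matrix (Fin 3) (Fin 3) ℝ} (h : Family2 B t) :
    B = normalForm 1 (-1) 0 (1 / √2) (-(1 / √2)) 0 := by
  rw [h.1]
  ext i j; fin_cases i <;> fin_cases j <;> simp [normalForm]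

theorem Family3.eq_normalForm {B : Matrix (Fin 3) (Fin 3) ℝ} (h : Family3 B t) :
    ∃ f p, B = normalForm 1 f p 0 0 0 ∧ defect 1 f p t = 0 ∧
      ¬ (f * (1 - f) = 0 ∧ p * (1 - p) = 0 ∧ f * p * (f - p) = 0) := by
  obtain ⟨f, p, h1, h2, h3, h4, h5, h6, h7, rfl, ht⟩ := h
  refine ⟨f, p, ?_, ?_, ?_⟩
  · ext i j; fin_cases i <;> fin_cases j <;> simp [normalForm]
  · have h0 : 2 * (f ^ 2 + p ^ 2 + f * p + f + p + 1) ≠ 0 := by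
      nlinarith [sq_nonneg (f + p + 1), sq_nonneg f, sq_nonneg p]
    rw [eq_neg_iff_add_eq_zero, ← mul_left_inj' h0, add_mul, div_mul_cancel₀ _ h0, zero_mul] at ht
    rw [defect]
    linear_combination ht
  · rintro ⟨k1, k2, -⟩
    rcases mul_eq_zero.1 k1 with e1 | e1 <;> rcases mul_eq_zero.1 k2 with e2 | e2
    · exact h5 ⟨e1, e2⟩
    · exact h6 ⟨e1, by linarith⟩
    · linarith
    · exact h7 ⟨by linarith, by linarith⟩

theorem Family3.not_isLocallySymmetric {B : Matrix (Fin 3) (Fin 3) ℝ} (h : Family3 B t) :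
    ¬ IsLocallySymmetric (metricOf B) := by
  obtain ⟨f, p, rfl, -, h⟩ := h.eq_normalForm
  intro hs
  obtain ⟨h1, h2, h3⟩ := mul_sub_eq_zero_of_isLocallySymmetric hs
  rw [one_mul] at h1 h2
  exact h ⟨h1, h2, h3⟩

theorem Family4.eq_normalForm {B : Matrix (Fin 3) (Fin 3) ℝ} (h : Family4 B t) :
    ∃ k x, B = normalForm 1 (-(k + 1 / 2)) (k - 1 / 2) x 0 0 ∧ 0 < k ∧ 0 < x ∧
      CriticalEquations 1 (-(k + 1 / 2)) (k - 1 / 2) x 0 0 t := by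
  obtain ⟨k, x, hk, hx, h4, rfl, ht⟩ := h
  have hk0 : 0 < k := lt_of_le_of_lt (by positivity) hk
  have hk2 := three_lt_of_sqrt_lt hk
  have p1 : 4 * k ^ 2 - 3 ≠ 0 := by linarith
  have p2 : 4 * k ^ 2 + 3 ≠ 0 := by positivity
  have p3 : 16 * k ^ 4 - 9 ≠ 0 := by
    have : (4 * k ^ 2 - 3) * (4 * k ^ 2 + 3) ≠ 0 := mul_ne_zero p1 p2
    intro h; exact this (by linear_combination h)
  rw [eq_neg_iff_add_eq_zero, ← mul_left_inj' p3, add_mul, div_mul_cancel₀ _ p3, zero_mul] at ht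
  rw [Eq4] at h4
  have hu : defect 1 (-(k + 1 / 2)) (k - 1 / 2) t = -(2 * x ^ 2 + 2 * k ^ 2) := by
    refine sub_eq_zero.1 ((mul_eq_zero.1 (?_ : (4 * k ^ 2 - 3) * _ = 0)).resolve_left p1)
    rw [defect]
    linear_combination (1 / 2) * ht + 2 * h4
  refine ⟨k, x, matrix_eq_normalForm_family4 k x, hk0, hx,
    criticalEquations_of_one_entry (by ring) ?_ ?_⟩
  · rw [hu]; ring
  · rw [hu]; linear_combination h4

theorem Family5.eq_normalForm {B : Matrix (Fin 3) (Fin 3) ℝ} (h : Family5 B t) :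
    ∃ p x y, B = normalForm 1 (-(p + 1)) p x y 0 ∧ -2 < p ∧ p < 0 ∧ x ≠ 0 ∧ y ≠ 0 ∧
      CriticalEquations 1 (-(p + 1)) p x y 0 t := by
  obtain ⟨p, c, x, hp, hc, hc5, hx, hh5, rfl, ht⟩ := h
  obtain ⟨b1, b2, -⟩ := hp.bounds
  refine ⟨p, x, -c, matrix_eq_normalForm_family5 p c x, b1, b2, hx.ne', (neg_neg_of_pos hc).ne, ?_⟩
  have hA := hp.ne_zero
  have q4 := right_ne_zero_of_mul hA
  have q1 : p - 1 ≠ 0 := by linarith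
  have hm : 0 < p ^ 2 + p + 1 := by nlinarith [sq_nonneg (2 * p + 1)]
  have q5 : 2 * (p ^ 2 + p + 1) * (5 * p ^ 2 - p - 1) ≠ 0 :=
    mul_ne_zero (mul_ne_zero two_ne_zero hm.ne') q4
  rw [eq_neg_iff_add_eq_zero, ← mul_left_inj' q5, add_mul, div_mul_cancel₀ _ q5, zero_mul] at ht
  rw [Eq5c] at hc5
  rw [Eq5h] at hh5
  obtain ⟨u, hu⟩ : ∃ u, u = defect 1 (-(p + 1)) p t := ⟨_, rfl⟩
  have k : x ^ 2 * (2 * p + 1) + c ^ 2 * (p - 1) - p * (2 * p + 1) * (p - 1) = 0 := by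
    refine (mul_eq_zero.1 (?_ : (p + 2) * (5 * p ^ 2 - p - 1) * _ = 0)).resolve_left hA
    linear_combination (2 * p + 1) * hh5 + (p - 1) * hc5
  have ku : (p ^ 2 + p + 1) * u + (2 * p + 1) * (p * (p - 1) ^ 2 + x ^ 2 * (p + 2)) = 0 := by
    refine (mul_eq_zero.1 (?_ : (5 * p ^ 2 - p - 1) * _ = 0)).resolve_left q4
    rw [defect] at hu
    linear_combination (p ^ 2 + p + 1) * ht
      + (p ^ 2 + p + 1) * (5 * p ^ 2 - p - 1) * hu + (2 * p + 1) * hh5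
  have h2 : 4 * c ^ 2 * (p - 1) + x ^ 2 * (7 * p + 2) + ((p - 1) ^ 2 + 2 * u) * (p - 1) = 0 := by
    refine (mul_eq_zero.1 (?_ : (p ^ 2 + p + 1) * _ = 0)).resolve_left hm.ne'
    linear_combination -hh5 + 2 * (p - 1) * ku + 4 * (p ^ 2 + p + 1) * k
  have h1 : 4 * x ^ 2 * (2 * p + 1) + c ^ 2 * (5 * p - 2)
      + ((2 * p + 1) ^ 2 + 2 * u) * (2 * p + 1) = 0 := by
    refine (mul_eq_zero.1 (?_ : (p - 1) * _ = 0)).resolve_left q1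
    linear_combination -3 * (p + 2) * k + (2 * p + 1) * h2
  refine criticalEquations_of_two_entries (by ring) ?_ ?_ ?_ <;> rw [← hu]
  · linear_combination -h1
  · linear_combination h2
  · linear_combination 2 * (p - 1) * k + 2 * ku

theorem Family6.eq_normalForm {B : Matrix (Fin 3) (Fin 3) ℝ} {E : ℝ} (h : Family6 B t E) :
    ∃ f x, B = normalForm (1 / 3) f (2 / 3 - f) x 0 0 ∧ 0 < x ∧ 1 / 3 < f ∧
      CriticalEquations (1 / 3) f (2 / 3 - f) x 0 0 t ∧
      4 / 3 * (1 / 3 + f + (2 / 3 - f)) ^ 2 * defect (1 / 3) f (2 / 3 - f) t = E ∧ E < 0 := by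
  obtain ⟨x, f, hx, hf, h6, rfl, ht, rfl⟩ := h
  rw [eq6_iff] at h6
  have hf' : 1 / 3 < f := by
    have : (1 / 3) ^ 2 < (f - 1 / 3) ^ 2 := by rw [h6]; nlinarith
    by_contra hc
    nlinarith
  have hd : 12 * x ^ 2 + 11 ≠ 0 := by positivity
  rw [eq_neg_iff_add_eq_zero, ← mul_left_inj' hd, add_mul, div_mul_cancel₀ _ hd, zero_mul] at ht
  have hu : defect (1 / 3) f (2 / 3 - f) t = -4 * x ^ 2 := by
    rw [defect]
    linear_combination (1 / 6) * ht + 2 * (1 + t) * h6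
  have hu1 : defect f (2 / 3 - f) (1 / 3) t = -4 * x ^ 2 := by
    rw [← hu]; simp only [defect]; ring
  have hu2 : defect (2 / 3 - f) (1 / 3) f t = -4 * x ^ 2 := by
    rw [← hu]; simp only [defect]; ring
  refine ⟨f, x, ?_, hx, hf', ?_, ?_, ?_⟩
  · ext i j; fin_cases i <;> fin_cases j <;> simp [normalForm]
  · constructor <;> simp only [radialEquation, commNormSq, diagonalEquation, mixedEquation, hu, hu1,
      hu2]
    · ring
    · ring
    · ring
    · ring
    · ring
    · linear_combination 8 * (f - 1 / 3) * x * h6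
    · ring
  · rw [hu]; ring
  · have : 0 < x ^ 2 := by positivity
    linarith

theorem Family7.eq_normalForm {B : Matrix (Fin 3) (Fin 3) ℝ} {E : ℝ} (h : Family7 B t E) :
    ∃ a b, B = normalForm a (1 / 3) (2 / 3 - a) b 0 b ∧ 0 < b ∧ 1 / 3 < a ∧
      CriticalEquations a (1 / 3) (2 / 3 - a) b 0 b t ∧
      4 / 3 * (a + 1 / 3 + (2 / 3 - a)) ^ 2 * defect a (1 / 3) (2 / 3 - a) t = E ∧ E < 0 := by
  obtain ⟨b, a, hb, ha, h7, rfl, ht, rfl⟩ := h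
  rw [eq7_iff] at h7
  have ha' : 1 / 3 < a := by
    have : (1 / 3) ^ 2 < (a - 1 / 3) ^ 2 := by rw [h7]; nlinarith
    by_contra hc
    nlinarith
  have hd : 12 * b ^ 2 + 10 ≠ 0 := by positivity
  rw [eq_neg_iff_add_eq_zero, ← mul_left_inj' hd, add_mul, div_mul_cancel₀ _ hd, zero_mul] at ht
  have hu : defect a (1 / 3) (2 / 3 - a) t = -2 * b ^ 2 := by
    rw [defect]
    linear_combination (1 / 3) * ht + 2 * (1 + t) * h7
  have hu1 : defect (1 / 3) (2 / 3 - a) a t = -2 * b ^ 2 := by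
    rw [← hu]; simp only [defect]; ring
  have hu2 : defect (2 / 3 - a) a (1 / 3) t = -2 * b ^ 2 := by
    rw [← hu]; simp only [defect]; ring
  refine ⟨a, b, ?_, hb, ha', ?_, ?_, ?_⟩
  · ext i j; fin_cases i <;> fin_cases j <;> simp [normalForm]
  · constructor <;> simp only [radialEquation, commNormSq, diagonalEquation, mixedEquation, hu, hu1,
      hu2]
    · ring
    · ring
    · ring
    · ring
    · linear_combination (a - 1 / 3) * b * h7
    · linear_combination (a - 1 / 3) * b * h7
    · ring
  · rw [hu]; ring
  · have : 0 < b ^ 2 := by positivity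
    linarith

end

section
variable {a₁ a₂ a₃ x y z t : ℝ}

theorem Family1.criticalEquations {B : Matrix (Fin 3) (Fin 3) ℝ} (h : Family1 B t) :
    CriticalEquations 1 0 (-1) 0 (-1) 0 t := by
  obtain ⟨-, rfl⟩ := h
  constructor <;> norm_num [radialEquation, commNormSq, diagonalEquation, mixedEquation, defect]

theorem Family2.criticalEquations {B : Matrix (Fin 3) (Fin 3) ℝ} (h : Family2 B t) :
    CriticalEquations 1 (-1) 0 (1 / √2) (-(1 / √2)) 0 t := by
  obtain ⟨-, rfl⟩ := h
  refine criticalEquations_of_two_entries (by norm_num) ?_ ?_ ?_ <;>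
    simp only [neg_sq, one_div_sqrt_two_sq, defect] <;> norm_num

/-- The metrics of zero energy are critical. -/
theorem ZeroEnergyFamily.critical {B : Matrix (Fin 3) (Fin 3) ℝ} (h : ZeroEnergyFamily B t) :
    ¬ IsLocallySymmetric (metricOf B) ∧ IsCritical t (metricOf B) ∧
      ∀ p, energy t (metricOf B) p = 0 := by
  have key : ∀ {a₁ a₂ a₃ x y z : ℝ}, CriticalEquations a₁ a₂ a₃ x y z t → a₁ + a₂ + a₃ = 0 →
      0 < commNormSq a₁ a₂ a₃ x y z →
      ¬ IsLocallySymmetric (metricOf (normalForm a₁ a₂ a₃ x y z)) ∧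
      IsCritical t (metricOf (normalForm a₁ a₂ a₃ x y z)) ∧
      ∀ p, energy t (metricOf (normalForm a₁ a₂ a₃ x y z)) p = 0 := fun hc hθ hn =>
    ⟨not_isLocallySymmetric_of_commNormSq hn, (isCritical_normalForm_iff t).2 hc, fun p => by
      rw [hc.energy_eq, hθ]; ring⟩
  rcases h with h | h | h | h | h
  · rw [h.eq_normalForm]
    exact key h.criticalEquations (by norm_num) (by norm_num [commNormSq])
  · rw [h.eq_normalForm]
    refine key h.criticalEquations (by norm_num) ?_
    rw [commNormSq, neg_sq, one_div_sqrt_two_sq]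
    norm_num
  · have hs := h.not_isLocallySymmetric
    obtain ⟨f, p, rfl, hu, -⟩ := h.eq_normalForm
    have hc := criticalEquations_of_defect_eq_zero hu
    exact ⟨hs, (isCritical_normalForm_iff t).2 hc, fun q => by rw [hc.energy_eq, hu, mul_zero]⟩
  · obtain ⟨k, x, rfl, hk, hx, hc⟩ := h.eq_normalForm
    refine key hc (by ring) ?_
    have : 0 < 8 * (x ^ 2 * k ^ 2) := by positivity
    rw [commNormSq]
    linarith
  · obtain ⟨p, x, y, rfl, -, hp, -, hy, hc⟩ := h.eq_normalForm
    refine key hc (by ring) ?_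
    have h1 : 0 < y ^ 2 * (p - 1) ^ 2 :=
      mul_pos (by positivity) (pow_pos (by linarith : 0 < 1 - p) 2 |>.trans_eq (by ring))
    rw [commNormSq]
    nlinarith [mul_nonneg (sq_nonneg x) (sq_nonneg (-(p + 1) - p))]

/-- The metrics of non-zero energy are critical. -/
theorem NonzeroEnergyFamily.critical {B : Matrix (Fin 3) (Fin 3) ℝ} {E : ℝ}
    (h : NonzeroEnergyFamily B t E) :
    ¬ IsLocallySymmetric (metricOf B) ∧ IsCritical t (metricOf B) ∧
      (∀ p, energy t (metricOf B) p = E) ∧ E < 0 := by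
  rcases h with h | h
  · obtain ⟨f, x, rfl, hx, hf, hc, hE, hneg⟩ := h.eq_normalForm
    refine ⟨not_isLocallySymmetric_of_commNormSq ?_, (isCritical_normalForm_iff t).2 hc,
      fun p => by rw [hc.energy_eq, hE], hneg⟩
    have h1 : 0 < x ^ 2 * (f - 1 / 3) ^ 2 :=
      mul_pos (by positivity) (pow_pos (by linarith) 2)
    rw [commNormSq]
    linarith
  · obtain ⟨a, b, rfl, hb, ha, hc, hE, hneg⟩ := h.eq_normalForm
    refine ⟨not_isLocallySymmetric_of_commNormSq ?_, (isCritical_normalForm_iff t).2 hc,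
      fun p => by rw [hc.energy_eq, hE], hneg⟩
    have h1 : 0 < b ^ 2 * (a - 1 / 3) ^ 2 :=
      mul_pos (by positivity) (pow_pos (by linarith) 2)
    rw [commNormSq]
    linarith

/-! ### Algebraic Ricci solitons -/

/-- The derivations of the Lie algebra which preserve `ℝ³` and the line of `e₄`. -/
theorem isDerivation_blockMatrix_iff (D P : Matrix (Fin 3) (Fin 3) ℝ) (r : ℝ) :
    (∀ u v, blockMatrix P 0 r *ᵥ bracket D u v
      = bracket D (blockMatrix P 0 r *ᵥ u) v + bracket D u (blockMatrix P 0 r *ᵥ v)) ↔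
    P * D = D * P + r • D := by
  have hl : ∀ u : R4, (blockMatrix P 0 r *ᵥ u) (Fin.last 3) = r * u (Fin.last 3) := fun u => by
    rw [blockMatrix_mulVec, Fin.snoc_last]
  have hi : ∀ u : R4, Fin.init (α := fun _ : Fin 4 => ℝ) (blockMatrix P 0 r *ᵥ u)
      = P *ᵥ Fin.init u := fun u => by
    rw [blockMatrix_mulVec, Fin.init_snoc, smul_zero, add_zero]
  simp only [bracket_eq, hl, hi]
  simp only [blockMatrix_mulVec, Fin.init_snoc, Fin.snoc_last]
  constructor
  · intro h
    ext i j
    have h1 := congrFun (h (Fin.snoc (α := fun _ => ℝ) 0 1)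
      (Fin.snoc (α := fun _ => ℝ) (Pi.single j 1) 0)) i.castSucc
    simp only [Fin.snoc_castSucc, Fin.snoc_last, Fin.init_snoc, Pi.add_apply] at h1
    simp only [one_smul, zero_smul, sub_zero, mul_zero, mul_one, add_zero,
      Matrix.mulVec_mulVec, Pi.smul_apply, Matrix.mulVec_single_one, Matrix.col_apply] at h1
    exact h1.trans (add_comm _ _)
  · intro h u v
    ext i
    refine Fin.lastCases ?_ (fun i => ?_) i
    · simp only [Fin.snoc_last, Pi.add_apply, mul_zero, add_zero]
    · simp only [Fin.snoc_castSucc, Pi.add_apply, Matrix.mulVec_sub, Matrix.mulVec_smul,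
        Matrix.mulVec_mulVec, h, Matrix.add_mulVec, Matrix.smul_mulVec, Pi.sub_apply, Pi.smul_apply,
        smul_eq_mul, smul_zero, add_zero]
      ring

/-- The restriction of the Ricci operator to the ideal `ℝ³`. -/
def idealRicci (a₁ a₂ a₃ x y z : ℝ) : Matrix (Fin 3) (Fin 3) ℝ :=
  !![-a₁ * (a₁ + a₂ + a₃), z * (a₁ - a₂), y * (a₃ - a₁);
     z * (a₁ - a₂), -a₂ * (a₁ + a₂ + a₃), x * (a₂ - a₃);
     y * (a₃ - a₁), x * (a₂ - a₃), -a₃ * (a₁ + a₂ + a₃)]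

/-- The Ricci operator preserves the ideal `ℝ³` and the line of `e₄`. -/
theorem ricciOperator_normalForm : ricciOperator (metricOf (normalForm a₁ a₂ a₃ x y z)) 0
    = blockMatrix (idealRicci a₁ a₂ a₃ x y z) 0 (-(a₁ ^ 2 + a₂ ^ 2 + a₃ ^ 2)) := by
  have h : metricOf (normalForm a₁ a₂ a₃ x y z) 0 = 1 := leftInvariantMetric_one_zero _
  rw [ricciOperator, h, inv_one, Matrix.one_mul]
  ext i j
  rw [Matrix.of_apply, ricci_normalForm]
  fin_cases i <;> fin_cases j <;> rfl

/-- The soliton equation is `[P, D] = r D`, where `P` is the restriction of the Ricci operator to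
`ℝ³` and `D = ad e₄`; the number `l` is determined by `r` and the Ricci curvature of `e₄`. -/
theorem isAlgebraicRicciSoliton_normalForm_iff :
    IsAlgebraicRicciSoliton (derivationOf (normalForm a₁ a₂ a₃ x y z))
      (metricOf (normalForm a₁ a₂ a₃ x y z)) ↔
    ∃ r : ℝ, idealRicci a₁ a₂ a₃ x y z * normalForm (-a₁) (-a₂) (-a₃) x y z
      = normalForm (-a₁) (-a₂) (-a₃) x y z * idealRicci a₁ a₂ a₃ x y z
        + r • normalForm (-a₁) (-a₂) (-a₃) x y z := by
  have hD : derivationOf (normalForm a₁ a₂ a₃ x y z) = normalForm (-a₁) (-a₂) (-a₃) x y z := by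
    ext i j; fin_cases i <;> fin_cases j <;> simp [derivationOf, normalForm]
  have hb : ∀ (P : Matrix (Fin 3) (Fin 3) ℝ) (r l : ℝ),
      blockMatrix P 0 r = l • (1 : Matrix (Fin 4) (Fin 4) ℝ) + blockMatrix (P - l • 1) 0 (r - l) := by
    intro P r l
    rw [← blockMatrix_one]
    ext i j
    refine Fin.lastCases ?_ (fun i => ?_) i <;> refine Fin.lastCases ?_ (fun j => ?_) j <;>
    simp only [Matrix.add_apply, Matrix.smul_apply, blockMatrix_castSucc_castSucc,
      blockMatrix_castSucc_last, blockMatrix_last_castSucc, blockMatrix_last_last, Matrix.sub_apply,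
      Pi.zero_apply, smul_eq_mul] <;> ring
  rw [IsAlgebraicRicciSoliton, hD, ricciOperator_normalForm]
  set D := normalForm (-a₁) (-a₂) (-a₃) x y z
  set R := idealRicci a₁ a₂ a₃ x y z
  have hc : ∀ l r : ℝ, (R - l • 1) * D = D * (R - l • 1) + r • D ↔ R * D = D * R + r • D := by
    intro l r
    rw [Matrix.sub_mul, Matrix.mul_sub, Matrix.smul_mul, Matrix.mul_smul, Matrix.one_mul,
      Matrix.mul_one, sub_add_eq_add_sub, sub_left_inj]
  constructor
  · rintro ⟨l, A, hA, e⟩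
    rw [hb _ _ l, add_right_inj] at e
    rw [← e, isDerivation_blockMatrix_iff, hc] at hA
    exact ⟨_, hA⟩
  · rintro ⟨r, h⟩
    refine ⟨-(a₁ ^ 2 + a₂ ^ 2 + a₃ ^ 2) - r, _, ?_, hb _ _ _⟩
    rw [isDerivation_blockMatrix_iff, hc, sub_sub_cancel]
    exact h

theorem Family1.isAlgebraicRicciSoliton {B : Matrix (Fin 3) (Fin 3) ℝ} (h : Family1 B t) :
    IsAlgebraicRicciSoliton (derivationOf B) (metricOf B) := by
  rw [h.eq_normalForm, isAlgebraicRicciSoliton_normalForm_iff]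
  refine ⟨4, ?_⟩
  ext i j
  fin_cases i <;> fin_cases j <;>
    simp [idealRicci, normalForm] <;> norm_num

theorem Family2.isAlgebraicRicciSoliton {B : Matrix (Fin 3) (Fin 3) ℝ} (h : Family2 B t) :
    IsAlgebraicRicciSoliton (derivationOf B) (metricOf B) := by
  rw [h.eq_normalForm, isAlgebraicRicciSoliton_normalForm_iff]
  have hs := one_div_sqrt_two_sq
  generalize 1 / √2 = s at hs
  refine ⟨1, ?_⟩
  ext i j
  fin_cases i <;> fin_cases j <;>
    simp [idealRicci, normalForm] <;>
    first
      | ring1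
      | linear_combination 2 * hs
      | linear_combination -2 * hs

theorem Family3.isAlgebraicRicciSoliton {B : Matrix (Fin 3) (Fin 3) ℝ} (h : Family3 B t) :
    IsAlgebraicRicciSoliton (derivationOf B) (metricOf B) := by
  obtain ⟨f, p, rfl, -, -⟩ := h.eq_normalForm
  rw [isAlgebraicRicciSoliton_normalForm_iff]
  refine ⟨0, ?_⟩
  ext i j
  fin_cases i <;> fin_cases j <;> simp [idealRicci, normalForm] <;> ring

/-- The entries of the soliton equation on the diagonal and in the last column. -/
theorem soliton_entries (h : IsAlgebraicRicciSoliton (derivationOf (normalForm a₁ a₂ a₃ x y z))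
      (metricOf (normalForm a₁ a₂ a₃ x y z))) :
    ∃ r : ℝ, 2 * (y ^ 2 * (a₃ - a₁) - z ^ 2 * (a₁ - a₂)) = -(r * a₁) ∧
      2 * (z ^ 2 * (a₁ - a₂) - x ^ 2 * (a₂ - a₃)) = -(r * a₂) ∧
      y * (a₁ - a₃) ^ 2 - (a₁ + a₂ + a₃) * y * (a₁ - a₃) - x * z * (a₁ - 2 * a₂ + a₃) = r * y ∧
      x * (a₂ - a₃) ^ 2 - (a₁ + a₂ + a₃) * x * (a₂ - a₃) + y * z * (a₂ + a₃ - 2 * a₁) = r * x := by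
  obtain ⟨r, h⟩ := isAlgebraicRicciSoliton_normalForm_iff.1 h
  have h11 := congrFun (congrFun h 0) 0
  have h22 := congrFun (congrFun h 1) 1
  have h13 := congrFun (congrFun h 0) 2
  have h23 := congrFun (congrFun h 1) 2
  simp [idealRicci, normalForm] at h11 h22 h13 h23
  exact ⟨r, by linear_combination h11, by linear_combination h22, by linear_combination -h13,
    by linear_combination h23⟩

theorem Family4.not_isAlgebraicRicciSoliton {B : Matrix (Fin 3) (Fin 3) ℝ} (h : Family4 B t) :
    ¬ IsAlgebraicRicciSoliton (derivationOf B) (metricOf B) := by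
  obtain ⟨k, x, rfl, hk, hx, -⟩ := h.eq_normalForm
  intro h
  obtain ⟨r, h1, h2, -, -⟩ := soliton_entries h
  have hr : r = 0 := by linarith
  rw [hr] at h2
  have : 0 < x ^ 2 * k := by positivity
  linarith

/-- The last column of `[P, D] = r D` gives `(1 - p)² = r = (2 p + 1)²`, so `p` is `0` or `-2`. -/
theorem Family5.not_isAlgebraicRicciSoliton {B : Matrix (Fin 3) (Fin 3) ℝ} (h : Family5 B t) :
    ¬ IsAlgebraicRicciSoliton (derivationOf B) (metricOf B) := by
  obtain ⟨p, x, y, rfl, hp, hp', hx, hy, -⟩ := h.eq_normalForm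
  intro h
  obtain ⟨r, -, -, h1, h2⟩ := soliton_entries h
  have h1' : (1 - p) ^ 2 = r := mul_left_cancel₀ hy (by linear_combination h1)
  have h2' : (2 * p + 1) ^ 2 = r := mul_left_cancel₀ hx (by linear_combination h2)
  have h3 : p * (p + 2) = 0 := by linear_combination (1 / 3) * (h2' - h1')
  rcases mul_eq_zero.1 h3 with h3 | h3 <;> linarith

theorem Family6.not_isAlgebraicRicciSoliton {B : Matrix (Fin 3) (Fin 3) ℝ} {E : ℝ}
    (h : Family6 B t E) : ¬ IsAlgebraicRicciSoliton (derivationOf B) (metricOf B) := by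
  obtain ⟨f, x, rfl, hx, hf, -⟩ := h.eq_normalForm
  intro h
  obtain ⟨r, h1, h2, -, -⟩ := soliton_entries h
  have hr : r = 0 := by linarith
  rw [hr] at h2
  have : 0 < x ^ 2 * (f - 1 / 3) := mul_pos (by positivity) (by linarith)
  linarith

theorem Family7.not_isAlgebraicRicciSoliton {B : Matrix (Fin 3) (Fin 3) ℝ} {E : ℝ}
    (h : Family7 B t E) : ¬ IsAlgebraicRicciSoliton (derivationOf B) (metricOf B) := by
  obtain ⟨a, b, rfl, hb, ha, -⟩ := h.eq_normalForm
  intro h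
  obtain ⟨r, h1, h2, -, -⟩ := soliton_entries h
  have hr : r = 0 := by linarith
  rw [hr] at h1
  have : 0 < b ^ 2 * (a - 1 / 3) := mul_pos (by positivity) (by linarith)
  linarith

/-! ### Transfer to arbitrary left-invariant metrics -/

theorem ZeroEnergyFamily.energy_eq_zero {B : Matrix (Fin 3) (Fin 3) ℝ} (h : ZeroEnergyFamily B t)
    {g : MetricField} (hg : IsSmoothMetric g) (hh : Homothetic g (metricOf B)) (p : R4) :
    energy t g p = 0 := by
  obtain ⟨c, -, hc⟩ := hh.energy_eq hg (isSmoothMetric_metricOf B) t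
  obtain ⟨q, hq⟩ := hc p
  rw [hq, h.critical.2.2, mul_zero]

theorem NonzeroEnergyFamily.energy_neg {B : Matrix (Fin 3) (Fin 3) ℝ} {E : ℝ}
    (h : NonzeroEnergyFamily B t E) {g : MetricField} (hg : IsSmoothMetric g)
    (hh : Homothetic g (metricOf B)) (p : R4) : energy t g p < 0 := by
  obtain ⟨c, hc0, hc⟩ := hh.energy_eq hg (isSmoothMetric_metricOf B) t
  obtain ⟨q, hq⟩ := hc p
  rw [hq, h.critical.2.2.1]
  exact mul_neg_of_pos_of_neg hc0 h.critical.2.2.2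

/-- Every non-symmetric critical left-invariant metric is homothetic to one of the families. -/
theorem exists_homothetic_of_isCritical (D : Matrix (Fin 3) (Fin 3) ℝ)
    {Q : Matrix (Fin 4) (Fin 4) ℝ} (hQ : Q.PosDef)
    (hs : ¬ IsLocallySymmetric (leftInvariantMetric D Q))
    (hc : IsCritical t (leftInvariantMetric D Q)) :
    ∃ B, (ZeroEnergyFamily B t ∨ ∃ E, NonzeroEnergyFamily B t E) ∧
      Homothetic (leftInvariantMetric D Q) (metricOf B) := by
  have hg := isSmoothMetric_leftInvariantMetric D hQ
  obtain ⟨a₁, a₂, a₃, x, y, z, h⟩ := exists_homothetic_normalForm D hQ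
  have hg' := isSmoothMetric_metricOf (normalForm a₁ a₂ a₃ x y z)
  rw [h.isLocallySymmetric_iff hg hg'] at hs
  rw [h.isCritical_iff hg hg', isCritical_normalForm_iff] at hc
  obtain ⟨B, hB, hh⟩ := hc.isListed hs
  exact ⟨B, hB, h.trans hh⟩

end

end QuadraticCurvature

end

open QuadraticCurvature in
theorem mainTheorem1 :
    -- the classification
    (∀ (D : Matrix (Fin 3) (Fin 3) ℝ) (Q : Matrix (Fin 4) (Fin 4) ℝ), Q.PosDef →
      ¬ IsLocallySymmetric (leftInvariantMetric D Q) → ∀ t : ℝ,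
        (IsCritical t (leftInvariantMetric D Q) ↔
          ((∀ x, energy t (leftInvariantMetric D Q) x = 0) ∧
            ∃ B, ZeroEnergyFamily B t ∧ Homothetic (leftInvariantMetric D Q) (metricOf B)) ∨
          ((∀ x, energy t (leftInvariantMetric D Q) x ≠ 0) ∧
            ∃ B E, NonzeroEnergyFamily B t E ∧
              Homothetic (leftInvariantMetric D Q) (metricOf B))) ∧
        ((∃ B, ZeroEnergyFamily B t ∧ Homothetic (leftInvariantMetric D Q) (metricOf B)) →
          ∀ x, energy t (leftInvariantMetric D Q) x = 0) ∧
        ((∃ B E, NonzeroEnergyFamily B t E ∧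
            Homothetic (leftInvariantMetric D Q) (metricOf B)) →
          ∀ x, energy t (leftInvariantMetric D Q) x < 0)) ∧
    -- the metrics of the families are non-symmetric and critical, with the stated energy
    (∀ B t, ZeroEnergyFamily B t →
      ¬ IsLocallySymmetric (metricOf B) ∧ IsCritical t (metricOf B) ∧
        ∀ x, energy t (metricOf B) x = 0) ∧
    (∀ B t E, NonzeroEnergyFamily B t E →
      ¬ IsLocallySymmetric (metricOf B) ∧ IsCritical t (metricOf B) ∧
        ∀ x, energy t (metricOf B) x = E) ∧
    -- algebraic Ricci solitons
    (∀ B t, Family1 B t ∨ Family2 B t ∨ Family3 B t →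
      IsAlgebraicRicciSoliton (derivationOf B) (metricOf B)) ∧
    (∀ B t, Family4 B t ∨ Family5 B t →
      ¬ IsAlgebraicRicciSoliton (derivationOf B) (metricOf B)) ∧
    (∀ B t E, Family6 B t E ∨ Family7 B t E →
      ¬ IsAlgebraicRicciSoliton (derivationOf B) (metricOf B)) ∧
    -- the defining equations of the parameters have exactly one admissible solution
    (∃! ζ : ℝ, EqZeta ζ) ∧
    (∀ ζ : ℝ, EqZeta ζ → -1.697465 < ζ ∧ ζ < -1.697464) ∧
    (∀ κ : ℝ, √3 / 2 < κ → ∃! h : ℝ, 0 < h ∧ Eq4 κ h) ∧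
    (∀ p : ℝ, Range5 p → (∃! c : ℝ, 0 < c ∧ Eq5c p c) ∧ ∃! h : ℝ, 0 < h ∧ Eq5h p h) ∧
    (∀ h : ℝ, 0 < h → ∃! f : ℝ, 0 < f ∧ Eq6 h f) ∧
    (∀ b : ℝ, 0 < b → ∃! a : ℝ, 0 < a ∧ Eq7 b a) := by
  refine ⟨fun D Q hQ hs t => ?_, fun B t h => h.critical,
    fun B t E h => ⟨h.critical.1, h.critical.2.1, h.critical.2.2.1⟩, ?_, ?_, ?_,
    existsUnique_eqZeta, fun _ h => h.mem_Ioo, fun _ h => existsUnique_eq4 h,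
    fun _ h => ⟨existsUnique_eq5c h, existsUnique_eq5h h⟩, fun h _ => existsUnique_eq6 h,
    fun b _ => existsUnique_eq7 b⟩
  · have hg := isSmoothMetric_leftInvariantMetric D hQ
    refine ⟨⟨fun hc => ?_, ?_⟩, ?_, ?_⟩
    · obtain ⟨B, hB | ⟨E, hB⟩, hh⟩ := exists_homothetic_of_isCritical D hQ hs hc
      · exact Or.inl ⟨hB.energy_eq_zero hg hh, B, hB, hh⟩
      · exact Or.inr ⟨fun x => (hB.energy_neg hg hh x).ne, B, E, hB, hh⟩
    · rintro (⟨-, B, hB, hh⟩ | ⟨-, B, E, hB, hh⟩)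
      · exact (hh.isCritical_iff hg (isSmoothMetric_metricOf B) t).2 hB.critical.2.1
      · exact (hh.isCritical_iff hg (isSmoothMetric_metricOf B) t).2 hB.critical.2.1
    · rintro ⟨B, hB, hh⟩
      exact hB.energy_eq_zero hg hh
    · rintro ⟨B, E, hB, hh⟩
      exact hB.energy_neg hg hh
  · rintro B t (h | h | h)
    · exact h.isAlgebraicRicciSoliton
    · exact h.isAlgebraicRicciSoliton
    · exact h.isAlgebraicRicciSoliton
  · rintro B t (h | h)
    · exact h.not_isAlgebraicRicciSoliton
    · exact h.not_isAlgebraicRicciSoliton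
  · rintro B t E (h | h)
    · exact h.not_isAlgebraicRicciSoliton
    · exact h.not_isAlgebraicRicciSoliton
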